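/- Let $d \geqslant 1$, let $J = \begin{pmatrix} 0 & I_d \\ -I_d & 0 \end{pmatrix}$, and let $\omega(\mathbf{x},\mathbf{y}) = \mathbf{x}^{\intercal} J \mathbf{y}$ be the standard symplectic form on $\mathbf{R}^{2d}$. A lattice $\Lambda \subset \mathbf{R}^{2d}$ is called symplectic if it has covolume $1$ and $\omega$ takes integer values on $\Lambda \times \Lambda$. Let $Y_{2d}$ be the space of all symplectic lattices, identified with $\mathrm{Sp}(2d,\mathbf{R})/\mathrm{Sp}(2d,\mathbf{Z})$ through $g \mapsto g\mathbf{Z}^{2d}$, and let $\mu$ be the measure on $Y_{2d}$ inherited from Haar measure on $\mathrm{Sp}(2d,\mathbf{R})$, normalized to be a probability measure. For $\Lambda \in Y_{2d}$ let $$\alpha(\Lambda) = \sup_V \left\{ d(V \cap \Lambda)^{-1} : V \cap \Lambda \text{ is a lattice in } V \right\},$$ where $V$ runs over all non-zero linear subspaces of $\mathbf{R}^{2d}$ and $d(V\cap\Lambda)$ denotes the covolume of $V \cap \Lambda$ in the Euclidean space $V$. Then $\mu$ is well defined (the inherited measure is finite and non-zero, so $\mu(Y_{2d}) = 1$), and for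 every real $p$ with $0 < p \leqslant d$ the function $\alpha$ belongs to $L^p(Y_{2d}, \mu)$. Consequently, for every such $p$ there is a constant $C = C(d,p)$ such that for all $L > 0$ $$\mu\left(\left\{ \Lambda \in Y_{2d} : \alpha(\Lambda) \geqslant L \right\}\right) \leqslant C L^{-p}.$$ This is optimal in the sense that $\alpha \notin L^{d+1}(Y_{2d}, \mu)$. -/

import Mathlib

open MeasureTheory
open scoped ENNReal

noncomputable section

namespace SymplecticLattices

/-- A lattice in a real normed space `E`: a discrete subgroup that spans `E` over `ℝ`. -/
def IsLattice {E : Type*} [NormedAddCommGroup E] [NormedSpace ℝ E] (L : Submodule ℤ E) : Prop :=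
  ∃ _ : DiscreteTopology L, IsZLattice ℝ L

/-- `V ∩ Λ`, as a subgroup of `V`. -/
def inter {E : Type*} [NormedAddCommGroup E] [NormedSpace ℝ E] (Λ : Submodule ℤ E)
    (V : Submodule ℝ E) : Submodule ℤ V :=
  Λ.comap (V.subtype.restrictScalars ℤ)

/-- Schmidt's height function `α(Λ) = sup_V d(V ∩ Λ)⁻¹`, where `V` runs over the non-zero
subspaces such that `V ∩ Λ` is a lattice in `V`. The covolume is taken with respect to the
Lebesgue measure of the Euclidean space `V`. The supremum is taken in `[0, ∞]`. -/
def height {E : Type*} [NormedAddCommGroup E] [InnerProductSpace ℝ E] [FiniteDimensional ℝ E]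
    [MeasurableSpace E] [BorelSpace E] (Λ : Submodule ℤ E) : ℝ≥0∞ :=
  ⨆ (V : Submodule ℝ E) (_ : V ≠ ⊥ ∧ IsLattice (inter Λ V)),
    ENNReal.ofReal (ZLattice.covolume (inter Λ V) volume)⁻¹

/-- The Euclidean space `ℝ^{2d}`. -/
abbrev Space (d : ℕ) : Type := EuclideanSpace ℝ (Fin d ⊕ Fin d)

/-- The real symplectic group `Sp(2d, ℝ)`. -/
abbrev Sp (d : ℕ) : Type := Matrix.symplecticGroup (Fin d) ℝ

/-- The standard symplectic form `ω(x, y) = xᵀ J y` (the sign convention for `J` does not affect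
which lattices are symplectic). -/
def omega {d : ℕ} (x y : Space d) : ℝ :=
  x.ofLp ⬝ᵥ ((Matrix.J (Fin d) ℝ).mulVec y.ofLp)

/-- `Λ` is a symplectic lattice: a lattice of covolume one on which `ω` takes integer values. -/
structure IsSymplecticLattice {d : ℕ} (Λ : Submodule ℤ (Space d)) : Prop where
  isLattice : IsLattice Λ
  unimodular : ZLattice.covolume Λ volume = 1
  integral : ∀ x ∈ Λ, ∀ y ∈ Λ, ∃ n : ℤ, omega x y = n

/-- The space `Y_{2d}` of symplectic lattices in `ℝ^{2d}`. -/
def Y (d : ℕ) : Type := {Λ : Submodule ℤ (Space d) // IsSymplecticLattice Λ}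

/-! ### The group `Sp(2d, ℝ)` as a locally compact group -/

instance (d : ℕ) : IsTopologicalGroup (Sp d) where
  continuous_mul := by
    refine Continuous.subtype_mk ?_ _
    exact (continuous_subtype_val.comp continuous_fst).matrix_mul
      (continuous_subtype_val.comp continuous_snd)
  continuous_inv := by
    refine Continuous.subtype_mk (f := fun g : Sp d =>
      (-Matrix.J (Fin d) ℝ) * (g : Matrix _ _ ℝ).transpose * Matrix.J (Fin d) ℝ) ?_ _
    exact (continuous_const.matrix_mul continuous_subtype_val.matrix_transpose).matrix_mul
      continuous_const

instance (d : ℕ) : LocallyCompactSpace (Sp d) := by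
  have h : IsClosed {A : Matrix (Fin d ⊕ Fin d) (Fin d ⊕ Fin d) ℝ |
      A ∈ Matrix.symplecticGroup (Fin d) ℝ} := by
    simp only [SymplecticGroup.mem_iff]
    exact isClosed_eq ((continuous_id.matrix_mul continuous_const).matrix_mul
      continuous_id.matrix_transpose) continuous_const
  have : LocallyCompactSpace (Matrix (Fin d ⊕ Fin d) (Fin d ⊕ Fin d) ℝ) :=
    inferInstanceAs (LocallyCompactSpace (Fin d ⊕ Fin d → Fin d ⊕ Fin d → ℝ))
  exact h.isClosedEmbedding_subtypeVal.locallyCompactSpace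

instance (d : ℕ) : MeasurableSpace (Sp d) := borel _

instance (d : ℕ) : BorelSpace (Sp d) := ⟨rfl⟩

/-! ### The orbit map `g ↦ g ℤ^{2d}` -/

/-- The lattice `g ℤ^{2d}`, the integer span of the columns of `g`. -/
def latticeOf {d : ℕ} (g : Sp d) : Submodule ℤ (Space d) :=
  Submodule.span ℤ (Set.range fun j => (WithLp.toLp 2 fun i => g.1 i j : Space d))

theorem isSymplecticLattice_latticeOf {d : ℕ} (g : Sp d) : IsSymplecticLattice (latticeOf g) := by
  classical
  let v : Fin d ⊕ Fin d → Space d := fun j => WithLp.toLp 2 fun i => g.1 i j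
  let o := EuclideanSpace.basisFun (Fin d ⊕ Fin d) ℝ
  let b₀ := o.toBasis
  have hdet : b₀.det v = 1 := by
    rw [Module.Basis.det_apply, show b₀.toMatrix v = g.1 from ?_]
    · exact SymplecticGroup.det_eq_one g.2
    · ext i j
      simp [b₀, o, v, Module.Basis.toMatrix_apply]
  obtain ⟨hli, hsp⟩ := (Module.Basis.is_basis_iff_det b₀).2 (by rw [hdet]; exact isUnit_one : IsUnit (b₀.det v))
  let b := Module.Basis.mk hli hsp.ge
  have hb : ⇑b = v := Module.Basis.coe_mk _ _
  have hL : latticeOf g = Submodule.span ℤ (Set.range b) := by rw [hb]; rfl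
  refine ⟨?_, ?_, ?_⟩
  · rw [hL]
    exact ⟨inferInstance, inferInstance⟩
  · rw [hL, ZLattice.covolume_eq_measure_fundamentalDomain _ _
      (ZSpan.isAddFundamentalDomain b volume), ZSpan.measureReal_fundamentalDomain b volume b₀, hb,
      hdet, measureReal_congr (ZSpan.fundamentalDomain_ae_parallelepiped b₀ volume)]
    have : volume (parallelepiped b₀) = 1 := by
      simpa [b₀] using o.volume_parallelepiped
    simp [Measure.real, this]
  · have hJ : ∀ i j, omega (v i) (v j) = (Matrix.J (Fin d) ℝ) i j := by
      intro i j
      rw [← SymplecticGroup.mem_iff'.1 g.2]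
      simp only [omega, v, Matrix.mul_assoc]
      rfl
    have hadd₁ : ∀ x y z : Space d, omega (x + y) z = omega x z + omega y z := by
      intro x y z
      simp [omega, add_dotProduct]
    have hadd₂ : ∀ x y z : Space d, omega z (x + y) = omega z x + omega z y := by
      intro x y z
      simp [omega, Matrix.mulVec_add, dotProduct_add]
    have hz₁ : ∀ z : Space d, omega 0 z = 0 := by intro z; simp [omega]
    have hz₂ : ∀ z : Space d, omega z 0 = 0 := by intro z; simp [omega]
    have hs₁ : ∀ (n : ℤ) (x z : Space d), omega (n • x) z = n * omega x z := by
      intro n x z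
      simp [omega, ← Int.cast_smul_eq_zsmul ℝ n, smul_dotProduct]
    have hs₂ : ∀ (n : ℤ) (x z : Space d), omega z (n • x) = n * omega z x := by
      intro n x z
      simp [omega, ← Int.cast_smul_eq_zsmul ℝ n, Matrix.mulVec_smul, dotProduct_smul]
    intro x hx y hy
    refine Submodule.span_induction (p := fun x _ => ∃ n : ℤ, omega x y = n) ?_ ?_ ?_ ?_ hx
    · rintro _ ⟨i, rfl⟩
      refine Submodule.span_induction (p := fun y _ => ∃ n : ℤ, omega (v i) y = n) ?_ ?_ ?_ ?_ hy
      · rintro _ ⟨j, rfl⟩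
        refine ⟨Matrix.J (Fin d) ℤ i j, (hJ i j).trans ?_⟩
        rcases i with i | i <;> rcases j with j | j <;> simp [Matrix.J, Matrix.one_apply]
      · exact ⟨0, by simp [hz₂]⟩
      · rintro x y - - ⟨m, hm⟩ ⟨n, hn⟩
        exact ⟨m + n, by simp [hadd₂, hm, hn]⟩
      · rintro a x - ⟨m, hm⟩
        exact ⟨a * m, by simp [hs₂, hm]⟩
    · exact ⟨0, by simp [hz₁]⟩
    · rintro x y - - ⟨m, hm⟩ ⟨n, hn⟩
      exact ⟨m + n, by simp [hadd₁, hm, hn]⟩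
    · rintro a x - ⟨m, hm⟩
      exact ⟨a * m, by simp [hs₁, hm]⟩

/-- The orbit map `Sp(2d, ℝ) → Y_{2d}`, `g ↦ g ℤ^{2d}`. -/
def orbitMap {d : ℕ} (g : Sp d) : Y d := ⟨latticeOf g, isSymplecticLattice_latticeOf g⟩

/-- The σ-algebra of `Y_{2d} ≃ Sp(2d, ℝ) / Sp(2d, ℤ)`: a set of lattices is measurable if its
preimage under the orbit map is a Borel set. -/
instance (d : ℕ) : MeasurableSpace (Y d) := MeasurableSpace.map orbitMap inferInstance

/-- The measure of a set `A` of lattices that is inherited from Haar measure on `Sp(2d, ℝ)`: the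
largest Haar measure of a Borel set of `g` with `g ℤ^{2d} ∈ A` that contains at most one
representative of each lattice. (This is the Haar measure of the part above `A` of any
fundamental domain for the right action of `Sp(2d, ℤ)`.) -/
def quotientMass {d : ℕ} (A : Set (Y d)) : ℝ≥0∞ :=
  ⨆ (B : Set (Sp d)) (_ : MeasurableSet B ∧ Set.InjOn orbitMap B ∧ B ⊆ orbitMap ⁻¹' A),
    (Measure.haar : Measure (Sp d)) B

theorem quotientMass_empty {d : ℕ} : quotientMass (∅ : Set (Y d)) = 0 := by
  simp only [quotientMass, Set.preimage_empty, Set.subset_empty_iff]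
  refine le_antisymm (iSup₂_le ?_) bot_le
  rintro B ⟨-, -, rfl⟩
  simp

theorem quotientMass_iUnion {d : ℕ} (A : ℕ → Set (Y d)) (hA : ∀ i, MeasurableSet (A i))
    (hd : Pairwise (Function.onFun Disjoint A)) :
    quotientMass (⋃ i, A i) = ∑' i, quotientMass (A i) := by
  have hmeas : Measurable (orbitMap : Sp d → Y d) := fun s hs => hs
  apply le_antisymm
  · refine iSup₂_le ?_
    rintro B ⟨hB, hinj, hsub⟩
    have hBU : B = ⋃ i, B ∩ orbitMap ⁻¹' A i := by
      rw [← Set.inter_iUnion, ← Set.preimage_iUnion, Set.inter_eq_left.2 hsub]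
    rw [hBU]
    refine (measure_iUnion_le _).trans (ENNReal.tsum_le_tsum fun i => ?_)
    exact le_iSup₂_of_le (B ∩ orbitMap ⁻¹' A i)
      ⟨hB.inter (hmeas (hA i)), hinj.mono Set.inter_subset_left, Set.inter_subset_right⟩ le_rfl
  · refine ENNReal.summable.tsum_le_of_sum_le fun s => ?_
    have hmono : ∀ {S T : Set (Y d)}, S ⊆ T → quotientMass S ≤ quotientMass T := fun h =>
      iSup₂_le fun B hB => le_iSup₂_of_le B
        ⟨hB.1, hB.2.1, hB.2.2.trans (Set.preimage_mono h)⟩ le_rfl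
    have hadd : ∀ {S T : Set (Y d)}, Disjoint S T →
        quotientMass S + quotientMass T ≤ quotientMass (S ∪ T) := by
      intro S T hST
      refine ENNReal.biSup_add_biSup_le' ⟨∅, by simp⟩ ⟨∅, by simp⟩ ?_
      rintro B ⟨hB, hBi, hBS⟩ C ⟨hC, hCi, hCT⟩
      have hne : ∀ x ∈ B, ∀ y ∈ C, orbitMap x ≠ orbitMap y := fun x hx y hy =>
        hST.ne_of_mem (hBS hx) (hCT hy)
      have hBC : Disjoint B C := Set.disjoint_left.2 fun x hx hx' => hne x hx x hx' rfl
      rw [← measure_union hBC hC]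
      exact le_iSup₂_of_le (B ∪ C) ⟨hB.union hC, (Set.injOn_union hBC).2 ⟨hBi, hCi, hne⟩,
        Set.union_subset_union hBS hCT⟩ le_rfl
    refine le_trans ?_ (hmono (Set.iUnion₂_subset_iUnion (· ∈ s) A))
    induction s using Finset.induction_on with
    | empty => simp
    | insert a s ha ih =>
      rw [Finset.sum_insert ha, Finset.set_biUnion_insert]
      refine (add_le_add_right ih _).trans (hadd ?_)
      rw [Set.disjoint_iUnion₂_right]
      exact fun i hi => hd fun h => ha (h ▸ hi)

/-- The measure on `Y_{2d}` inherited from Haar measure on `Sp(2d, ℝ)`, before normalization. -/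
def quotientMeasure (d : ℕ) : Measure (Y d) :=
  Measure.ofMeasurable (fun A _ => quotientMass A) quotientMass_empty quotientMass_iUnion

/-- The measure `μ` on `Y_{2d}` inherited from Haar measure on `Sp(2d, ℝ)`, normalized to total
mass one. -/
def mu (d : ℕ) : Measure (Y d) := (quotientMeasure d Set.univ)⁻¹ • quotientMeasure d

/-- The height function `α` on `Y_{2d}`. -/
def alpha {d : ℕ} (Λ : Y d) : ℝ≥0∞ := height Λ.1

end SymplecticLattices

end

noncomputable section

namespace SymplecticLattices

open Matrix

/-! ### Unimodularity of the symplectic group -/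

section Unimodular

/-! Integrability comes from a Margulis function, in the style of Eskin, Margulis and Mozes. Only
isotropic sublattices matter: modulo the radical of `ω`, a sublattice carries a nondegenerate
integral form, whose determinant is at least one in absolute value, so the volume of the radical is
at most a constant times that of the whole sublattice (`exists_isotropic_le`). For isotropic frames,
averaging over finitely many small transvections multiplies the `d`-th power of the inverse volume
by at most some `c < 1` (`exists_contraction`). The second order term for rank `k` is a negative
multiple of `k (d + 1 - k)`, and isotropy forces `k ≤ d`.

Let `φ_k` be the largest such power in rank `k`. Either all nearly maximal frames span one subspace
and the contraction passes to `φ_k`, or the intersection and the sum of two of them give `φ_k² ≤ K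
φ_r φ_t` with `r = k - j`, `t ≤ k + j`, `j ≥ 1` (`exists_phi_drift`). Weighting `φ_k` by powers of a
small `ε` with strictly concave exponents makes the second case negligible, so the weighted sum `F`
has averages at most `c F + 1`, for a new `c < 1` (`exists_margulis_drift`). By Mahler's criterion
the sublevel sets of `F` have finite measure. Invariance and the drift inequality then give finite
total mass and integrability of `F` at once (`measure_lt_top_and_lintegral_lt_top_of_drift`), and `α
^ d ≤ C F`. Smaller exponents follow since `μ` is a probability measure, and the tail bound is
Markov's inequality.

All this uses that the inherited measure is Haar measure on a Borel fundamental domain, which needs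
`Sp(2d, ℝ)` to be unimodular.

For optimality, translate a small neighbourhood of the identity by `diag(n⁻¹, n)`. Its Haar measure
is unchanged, the image of a Lagrangian `ℤ^d` forces `α ≥ n ^ d / 2`, and the orbit map is at most
`(3 n²) ^ (d (d + 1) / 2)`-to-one there (`exists_le_mul_quotientMeasure`). So `{α ≥ L}` has measure
at least a constant times `L ^ (-(d + 1))` along `L = n ^ d / 2`. By absolute continuity of the
integral this excludes integrability of `α ^ (d + 1)`. -/

instance (d : ℕ) : SecondCountableTopology (Sp d) :=
  haveI : SecondCountableTopology (Matrix (Fin d ⊕ Fin d) (Fin d ⊕ Fin d) ℝ) :=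
    inferInstanceAs (SecondCountableTopology (Fin d ⊕ Fin d → Fin d ⊕ Fin d → ℝ))
  TopologicalSpace.Subtype.secondCountableTopology _

/-- The upper unipotent element with upper right block `B`. -/
def upperUnipotent {d : ℕ} (B : Matrix (Fin d) (Fin d) ℝ) (hB : Bᵀ = B) : Sp d :=
  ⟨fromBlocks 1 B 0 1, SymplecticGroup.fromBlocks_mem_iff.2 (by simp [hB])⟩

/-- The lower unipotent element with lower left block `C`. -/
def lowerUnipotent {d : ℕ} (C : Matrix (Fin d) (Fin d) ℝ) (hC : Cᵀ = C) : Sp d :=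
  ⟨fromBlocks 1 0 C 1, SymplecticGroup.fromBlocks_mem_iff.2 (by simp [hC])⟩

/-- The Levi element `diag(A, A⁻ᵀ)`. -/
def levi {d : ℕ} (A : (Matrix (Fin d) (Fin d) ℝ)ˣ) : Sp d :=
  ⟨fromBlocks A 0 0 ((A⁻¹ : (Matrix (Fin d) (Fin d) ℝ)ˣ) : Matrix _ _ ℝ)ᵀ,
    SymplecticGroup.fromBlocks_mem_iff.2 (by
      simp [← transpose_mul])⟩

theorem levi_mul {d : ℕ} (A B : (Matrix (Fin d) (Fin d) ℝ)ˣ) : levi (A * B) = levi A * levi B := by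
  apply Subtype.ext
  simp [levi, fromBlocks_multiply, -coe_units_inv]

theorem levi_one {d : ℕ} : levi (1 : (Matrix (Fin d) (Fin d) ℝ)ˣ) = 1 := by
  apply Subtype.ext
  simp [levi]

/-! ### Triviality of positive characters -/

variable {d : ℕ} (χ : Sp d →* NNReal)

theorem character_ne_zero (g : Sp d) : χ g ≠ 0 := fun h => by
  simpa [h] using map_mul χ g g⁻¹

/-- A character with commutative values ignores conjugation, so `χ g = (χ g)²`. -/
theorem character_eq_one_of_conj_sq {g a : Sp d} (h : a * g = g * g * a) : χ g = 1 := by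
  have := congrArg χ h
  simp only [map_mul] at this
  have h2 : χ g * χ a * χ g = χ g * χ a * 1 := by
    rw [mul_one, mul_right_comm, ← this, mul_comm]
  exact mul_left_cancel₀ (mul_ne_zero (character_ne_zero χ _) (character_ne_zero χ _)) h2

/-- Here `(χ g)² = 1`, and nonnegativity excludes `-1`. -/
theorem character_eq_one_of_conj_inv {g a : Sp d} (h : a * g = g⁻¹ * a) : χ g = 1 := by
  have := congrArg χ h
  simp only [map_mul] at this
  rw [mul_comm] at this
  have h2 := mul_right_cancel₀ (character_ne_zero χ _) this
  have h3 : χ g * χ g = 1 := by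
    nth_rw 1 [h2]; rw [← map_mul]; simp
  have h4 : (χ g) ^ 2 = 1 := by rw [sq, h3]
  exact (pow_eq_one_iff_of_nonneg zero_le (by norm_num)).1 h4

/-- The square root of two, as an invertible scalar matrix. -/
def sqrtTwo (d : ℕ) : (Matrix (Fin d) (Fin d) ℝ)ˣ :=
  ⟨diagonal fun _ => √2, diagonal fun _ => (√2)⁻¹, by
    rw [diagonal_mul_diagonal]; simp, by rw [diagonal_mul_diagonal]; simp⟩

/-- Conjugation by `diag(√2, 1/√2)` doubles the block `B`, which squares the element. -/
theorem character_upperUnipotent (B : Matrix (Fin d) (Fin d) ℝ) (hB : Bᵀ = B) :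
    χ (upperUnipotent B hB) = 1 := by
  refine character_eq_one_of_conj_sq χ (a := levi (sqrtTwo d)) ?_
  apply Subtype.ext
  simp only [levi, upperUnipotent, sqrtTwo, Submonoid.coe_mul, Units.inv_mk, fromBlocks_multiply,
    diagonal_transpose]
  have h2 : (√2 : ℝ) = 2 * (√2)⁻¹ := by
    have : √2 * √2 = (2 : ℝ) := Real.mul_self_sqrt (by norm_num)
    field_simp; linarith
  congr 1 <;> ext i j <;> simp [diagonal_mul, mul_diagonal]
  linear_combination B i j * h2

theorem character_lowerUnipotent (C : Matrix (Fin d) (Fin d) ℝ) (hC : Cᵀ = C) :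
    χ (lowerUnipotent C hC) = 1 := by
  refine character_eq_one_of_conj_sq χ (a := levi (sqrtTwo d)⁻¹) ?_
  apply Subtype.ext
  simp only [levi, lowerUnipotent, sqrtTwo, Submonoid.coe_mul, Units.inv_mk, fromBlocks_multiply,
    diagonal_transpose]
  have h2 : (√2 : ℝ) = 2 * (√2)⁻¹ := by
    have : √2 * √2 = (2 : ℝ) := Real.mul_self_sqrt (by norm_num)
    field_simp; linarith
  congr 1 <;> ext i j <;> simp [diagonal_mul, mul_diagonal]
  linear_combination C i j * h2

/-- Conjugation by `J` exchanges the two diagonal blocks, which inverts the element when `A` is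
symmetric. -/
theorem character_levi_of_transpose (A : (Matrix (Fin d) (Fin d) ℝ)ˣ)
    (hA : (A : Matrix (Fin d) (Fin d) ℝ)ᵀ = A) : χ (levi A) = 1 := by
  refine character_eq_one_of_conj_inv χ (a := SymplecticGroup.symJ (Fin d) ℝ) ?_
  have : (levi A)⁻¹ = levi A⁻¹ := by
    rw [inv_eq_iff_mul_eq_one, ← levi_mul, mul_inv_cancel, levi_one]
  rw [this]
  apply Subtype.ext
  have hA' : (A : Matrix (Fin d) (Fin d) ℝ)⁻¹ᵀ = (A : Matrix _ _ ℝ)⁻¹ := by rw [transpose_nonsing_inv, hA]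
  simp [levi, J, fromBlocks_multiply, hA', hA]

theorem character_levi (A : (Matrix (Fin d) (Fin d) ℝ)ˣ) : χ (levi A) = 1 := by
  have key : ∀ M : Matrix (Fin d) (Fin d) ℝ, M.det ≠ 0 →
      ∀ A : (Matrix (Fin d) (Fin d) ℝ)ˣ, (A : Matrix _ _ ℝ) = M → χ (levi A) = 1 := by
    intro M hM
    refine diagonal_transvection_induction_of_det_ne_zero
      (fun M => ∀ A : (Matrix (Fin d) (Fin d) ℝ)ˣ, (A : Matrix _ _ ℝ) = M → χ (levi A) = 1)
      M hM ?_ ?_ ?_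
    · intro D _ A hA
      exact character_levi_of_transpose χ A (by rw [hA, diagonal_transpose])
    · rintro ⟨i, j, hij, c⟩ A hA
      -- Conjugating by this diagonal matrix doubles the entry `c`, which squares the transvection.
      let D : Fin d → ℝ := Function.update 1 i 2
      have hD : ∀ k, D k ≠ 0 := by
        intro k
        by_cases hk : k = i <;> simp [D, hk]
      let a : (Matrix (Fin d) (Fin d) ℝ)ˣ := ⟨diagonal D, diagonal fun k => (D k)⁻¹,
        by rw [diagonal_mul_diagonal]; simp [hD], by rw [diagonal_mul_diagonal]; simp [hD]⟩
      refine character_eq_one_of_conj_sq χ (a := levi a) ?_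
      rw [← levi_mul, ← levi_mul, ← levi_mul]
      congr 1
      apply Units.ext
      simp only [Units.val_mul, hA, TransvectionStruct.toMatrix_mk, transvection_mul_transvection_same
        _ _ hij, a]
      ext k l
      simp only [transvection, D, diagonal_mul, mul_diagonal, Matrix.add_apply, single_apply, one_apply,
        Function.update_apply, Pi.one_apply]
      grind
    · intro A B hA hB ihA ihB U hU
      have hA' : IsUnit A := (isUnit_iff_isUnit_det A).2 (isUnit_iff_ne_zero.2 hA)
      have hB' : IsUnit B := (isUnit_iff_isUnit_det B).2 (isUnit_iff_ne_zero.2 hB)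
      obtain ⟨a, rfl⟩ := hA'
      obtain ⟨b, rfl⟩ := hB'
      have : U = a * b := Units.ext hU
      rw [this, levi_mul, map_mul, ihA a rfl, ihB b rfl, one_mul]
  exact key A ((isUnit_iff_isUnit_det _).1 A.isUnit).ne_zero A rfl

/-- If the polynomial `det (A + τ C)` vanished at all real `τ`, it would vanish at `τ = i`. The
symmetry of `Aᵀ C` gives `(A - iC)ᵀ (A + iC) = Aᵀ A + Cᵀ C`, which is positive definite because the
kernels meet trivially. -/
theorem exists_det_add_smul_ne_zero {A C : Matrix (Fin d) (Fin d) ℝ} (hs : Aᵀ * C = Cᵀ * A)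
    (hker : ∀ x : Fin d → ℝ, A *ᵥ x = 0 → C *ᵥ x = 0 → x = 0) : ∃ τ : ℝ, (A + τ • C).det ≠ 0 := by
  by_contra! h
  let p : Polynomial ℝ := (A.map Polynomial.C + (Polynomial.X : Polynomial ℝ) •
    C.map Polynomial.C).det
  have hp : p = 0 := by
    refine Polynomial.funext fun τ => ?_
    have := h τ
    rw [Polynomial.eval_zero, ← this, ← Polynomial.coe_evalRingHom, RingHom.map_det]
    congr 1
    ext i j
    simp
    ring
  have hI : (A.map (algebraMap ℝ ℂ) + Complex.I • C.map (algebraMap ℝ ℂ)).det = 0 := by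
    have : (Polynomial.eval₂RingHom (algebraMap ℝ ℂ) Complex.I) p = 0 := by rw [hp, map_zero]
    rw [RingHom.map_det] at this
    rw [← this]
    congr 1
    ext i j
    simp
    ring
  have hprod : (A.map (algebraMap ℝ ℂ) - Complex.I • C.map (algebraMap ℝ ℂ))ᵀ *
      (A.map (algebraMap ℝ ℂ) + Complex.I • C.map (algebraMap ℝ ℂ)) =
      (Aᵀ * A + Cᵀ * C).map (algebraMap ℝ ℂ) := by
    have hs' := congrArg (fun M => M.map (algebraMap ℝ ℂ)) hs
    simp only [Matrix.map_mul] at hs'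
    rw [Matrix.map_add _ (map_add _), Matrix.map_mul, Matrix.map_mul, transpose_sub,
      transpose_smul, sub_mul, mul_add, mul_add, Matrix.mul_smul, Matrix.smul_mul, Matrix.smul_mul,
      Matrix.mul_smul, smul_smul, Complex.I_mul_I, ← transpose_map, ← transpose_map, hs']
    module
  have hdet : (Aᵀ * A + Cᵀ * C).det = 0 := by
    have h1 := congrArg det hprod
    rw [det_mul, hI, mul_zero] at h1
    have h2 : algebraMap ℝ ℂ (Aᵀ * A + Cᵀ * C).det = 0 := by rw [RingHom.map_det]; exact h1.symm
    exact (map_eq_zero _).1 h2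
  obtain ⟨x, hx0, hx⟩ := exists_mulVec_eq_zero_iff.2 hdet
  have h3 : (A *ᵥ x) ⬝ᵥ (A *ᵥ x) + (C *ᵥ x) ⬝ᵥ (C *ᵥ x) = 0 := by
    have := congrArg (fun y => x ⬝ᵥ y) hx
    simp only [add_mulVec, dotProduct_add, ← mulVec_mulVec, dotProduct_zero,
      dotProduct_mulVec _ _ᵀ, vecMul_transpose] at this
    exact this
  have hA : 0 ≤ (A *ᵥ x) ⬝ᵥ (A *ᵥ x) := Finset.sum_nonneg fun _ _ => mul_self_nonneg _
  have hC : 0 ≤ (C *ᵥ x) ⬝ᵥ (C *ᵥ x) := Finset.sum_nonneg fun _ _ => mul_self_nonneg _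
  exact hx0 (hker x (dotProduct_self_eq_zero.1 (by linarith))
    (dotProduct_self_eq_zero.1 (by linarith)))

/-- Block elimination with the invertible corner as pivot writes `g` as lower unipotent times Levi
times upper unipotent. -/
theorem character_eq_one_of_isUnit (g : Sp d) (hg : IsUnit g.1.toBlocks₁₁) : χ g = 1 := by
  obtain ⟨a, ha⟩ := hg
  obtain ⟨A, B, C, D, hABCD⟩ : ∃ A B C D, g.1 = fromBlocks A B C D :=
    ⟨_, _, _, _, (fromBlocks_toBlocks g.1).symm⟩
  rw [hABCD, toBlocks_fromBlocks₁₁] at ha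
  subst ha
  have hmem := g.2
  rw [hABCD] at hmem
  obtain ⟨h1, -, -⟩ := SymplecticGroup.fromBlocks_mem_iff.1 hmem
  let A' : Matrix (Fin d) (Fin d) ℝ := ((a⁻¹ : (Matrix (Fin d) (Fin d) ℝ)ˣ) : Matrix _ _ ℝ)
  have hA1 : A' * a = 1 := a.inv_mul
  have hA2 : (a : Matrix (Fin d) (Fin d) ℝ) * A' = 1 := a.mul_inv
  have hX : (-(C * A'))ᵀ = -(C * A') := by
    have h2 : A'ᵀ * ((a : Matrix (Fin d) (Fin d) ℝ)ᵀ * C) * A' =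
        A'ᵀ * (Cᵀ * (a : Matrix (Fin d) (Fin d) ℝ)) * A' := by rw [h1]
    have h3 : A'ᵀ * (a : Matrix (Fin d) (Fin d) ℝ)ᵀ = 1 := by rw [← transpose_mul, hA2, transpose_one]
    rw [← Matrix.mul_assoc A'ᵀ, h3, Matrix.one_mul, ← Matrix.mul_assoc A'ᵀ, Matrix.mul_assoc _ _ A',
      hA2, Matrix.mul_one] at h2
    rw [transpose_neg, transpose_mul, h2]
  have hl : (lowerUnipotent (-(C * A')) hX * g).1 = fromBlocks a B 0 (D - C * A' * B) := by
    simp only [lowerUnipotent, Submonoid.coe_mul, hABCD, fromBlocks_multiply]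
    congr 1
    · simp
    · simp
    · rw [Matrix.neg_mul, Matrix.mul_assoc, hA1]; simp
    · rw [Matrix.neg_mul, Matrix.one_mul]; abel
  set D' := D - C * A' * B
  have hmem' := (lowerUnipotent (-(C * A')) hX * g).2
  rw [hl] at hmem'
  obtain ⟨-, h4, h5⟩ := SymplecticGroup.fromBlocks_mem_iff.1 hmem'
  simp only [transpose_zero, Matrix.zero_mul, sub_zero] at h5
  have h6 : D'ᵀ * (a : Matrix (Fin d) (Fin d) ℝ) = 1 := by simpa using congrArg transpose h5
  have h7 : D'ᵀ = A' := by
    calc D'ᵀ = D'ᵀ * ((a : Matrix (Fin d) (Fin d) ℝ) * A') := by rw [hA2, Matrix.mul_one]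
      _ = A' := by rw [← Matrix.mul_assoc, h6, Matrix.one_mul]
  have hY : (-(D'ᵀ * B))ᵀ = -(D'ᵀ * B) := by
    rw [transpose_neg, transpose_mul, transpose_transpose, h4]
  have hfin : lowerUnipotent (-(C * A')) hX * g * upperUnipotent (-(D'ᵀ * B)) hY = levi a := by
    apply Subtype.ext
    rw [Submonoid.coe_mul, hl]
    simp only [upperUnipotent, levi, fromBlocks_multiply]
    congr 1
    · simp
    · rw [h7, Matrix.mul_neg, ← Matrix.mul_assoc, hA2]; simp
    · simp
    · simp only [Matrix.zero_mul, Matrix.mul_one, zero_add]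
      change D' = A'ᵀ
      rw [← h7, transpose_transpose]
  have := congrArg χ hfin
  rwa [map_mul, map_mul, character_lowerUnipotent, character_upperUnipotent, character_levi, one_mul,
    mul_one] at this

/-- A left factor with block `τ • 1` replaces the corner `A` by `A + τ C`, invertible for a suitable
`τ`. -/
theorem character_eq_one (g : Sp d) : χ g = 1 := by
  obtain ⟨A, B, C, D, hABCD⟩ : ∃ A B C D, g.1 = fromBlocks A B C D :=
    ⟨_, _, _, _, (fromBlocks_toBlocks g.1).symm⟩
  have hmem := g.2
  rw [hABCD] at hmem
  obtain ⟨h1, -, h3⟩ := SymplecticGroup.fromBlocks_mem_iff.1 hmem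
  obtain ⟨τ, hτ⟩ := exists_det_add_smul_ne_zero h1 (fun x hA hC => by
    have h4 : Dᵀ * A - Bᵀ * C = 1 := by simpa using congrArg transpose h3
    have := congrArg (fun M => M *ᵥ x) h4
    simpa [sub_mulVec, ← mulVec_mulVec, hA, hC] using this.symm)
  have hsym : (τ • (1 : Matrix (Fin d) (Fin d) ℝ))ᵀ = τ • 1 := by simp
  have h5 : (upperUnipotent (τ • 1) hsym * g).1.toBlocks₁₁ = A + τ • C := by
    simp [upperUnipotent, hABCD, fromBlocks_multiply]
  have h6 := character_eq_one_of_isUnit χ (upperUnipotent (τ • 1) hsym * g)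
    (by rw [h5]; exact (isUnit_iff_isUnit_det _).2 (isUnit_iff_ne_zero.2 hτ))
  rwa [map_mul, character_upperUnipotent, one_mul] at h6

/-- The modular character is trivial. Right invariance lets Haar measure descend to the quotient by
right multiplication with `Sp(2d, ℤ)`. -/
instance (d : ℕ) : (Measure.haar : Measure (Sp d)).IsMulRightInvariant where
  map_mul_right_eq_self g := by
    rw [Measure.map_right_mul_eq_modularCharacterFun_smul]
    have : Measure.modularCharacterFun g = 1 := character_eq_one Measure.modularCharacter g
    rw [this, one_smul]

end Unimodular

section Quotient

open scoped Pointwise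

/-! ### The arithmetic subgroup and its fundamental domains -/

/-- The subgroup `Sp(2d, ℤ)` of `Sp(2d, ℝ)`. -/
def intSp (d : ℕ) : Subgroup (Sp d) where
  carrier := {g | ∃ M : Matrix (Fin d ⊕ Fin d) (Fin d ⊕ Fin d) ℤ, g.1 = M.map (Int.castRingHom ℝ)}
  one_mem' := ⟨1, by ext i j; simp [one_apply, apply_ite]⟩
  mul_mem' := by
    rintro a b ⟨M, hM⟩ ⟨N, hN⟩
    exact ⟨M * N, by rw [Matrix.map_mul, ← hM, ← hN]; rfl⟩
  inv_mem' := by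
    rintro a ⟨M, hM⟩
    refine ⟨-J (Fin d) ℤ * Mᵀ * J (Fin d) ℤ, ?_⟩
    rw [SymplecticGroup.coe_inv, hM, Matrix.map_mul, Matrix.map_mul, transpose_map,
      Matrix.map_neg _ (map_neg _), map_J]

variable {d : ℕ}

instance : Countable (intSp d) := by
  have : Countable (Matrix (Fin d ⊕ Fin d) (Fin d ⊕ Fin d) ℤ) :=
    inferInstanceAs (Countable (Fin d ⊕ Fin d → Fin d ⊕ Fin d → ℤ))
  choose f hf using fun g : intSp d => g.2
  refine Function.Injective.countable (f := f) fun a b hab => ?_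
  apply Subtype.ext
  apply Subtype.ext
  rw [hf a, hf b, hab]

instance : Countable (intSp d).op :=
  (Subgroup.equivOp (intSp d)).symm.injective.countable

theorem mem_latticeOf {g : Sp d} {x : Space d} :
    x ∈ latticeOf g ↔ ∃ z : Fin d ⊕ Fin d → ℤ, x = WithLp.toLp 2 (g.1 *ᵥ fun i => (z i : ℝ)) := by
  rw [latticeOf, Submodule.mem_span_range_iff_exists_fun]
  refine exists_congr fun z => ?_
  have : ∑ i, z i • (WithLp.toLp 2 fun j => g.1 j i : Space d) =
      WithLp.toLp 2 (g.1 *ᵥ fun i => (z i : ℝ)) := by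
    ext j
    simp [mulVec, dotProduct, mul_comm]
  rw [this, eq_comm]

theorem latticeOf_mul_le (g : Sp d) {γ : Sp d} (hγ : γ ∈ intSp d) :
    latticeOf (g * γ) ≤ latticeOf g := by
  obtain ⟨M, hM⟩ := hγ
  intro x hx
  obtain ⟨z, rfl⟩ := mem_latticeOf.1 hx
  refine mem_latticeOf.2 ⟨M *ᵥ z, ?_⟩
  congr 1
  rw [Submonoid.coe_mul, hM, ← mulVec_mulVec]
  congr 1
  ext i
  simp [mulVec, dotProduct]

theorem orbitMap_mul (g : Sp d) {γ : Sp d} (hγ : γ ∈ intSp d) : orbitMap (g * γ) = orbitMap g := by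
  apply Subtype.ext
  refine le_antisymm (latticeOf_mul_le g hγ) ?_
  have := latticeOf_mul_le (g * γ) (inv_mem hγ)
  rwa [mul_inv_cancel_right] at this

/-- The columns of `h` have integral coordinates with respect to those of `g`. With `orbitMap_mul`,
the fibres of the orbit map are exactly the cosets of `Sp(2d, ℤ)`. -/
theorem inv_mul_mem_of_orbitMap_eq {g h : Sp d} (hgh : orbitMap g = orbitMap h) :
    g⁻¹ * h ∈ intSp d := by
  have hl : latticeOf g = latticeOf h := congrArg Subtype.val hgh
  have hcol : ∀ j, ∃ z : Fin d ⊕ Fin d → ℤ,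
      (WithLp.toLp 2 fun i => h.1 i j : Space d) = WithLp.toLp 2 (g.1 *ᵥ fun i => (z i : ℝ)) :=
    fun j => mem_latticeOf.1 (hl ▸ Submodule.subset_span ⟨j, rfl⟩)
  choose z hz using hcol
  refine ⟨of fun i j => z j i, ?_⟩
  have h1 : h.1 = g.1 * (of fun i j => z j i).map (Int.castRingHom ℝ) := by
    ext i j
    have := congrArg (fun x : Space d => x i) (hz j)
    simpa [mul_apply, mulVec, dotProduct] using this
  rw [Submonoid.coe_mul, h1, ← Matrix.mul_assoc, ← Submonoid.coe_mul, inv_mul_cancel]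
  simp

theorem measurable_orbitMap : Measurable (orbitMap : Sp d → Y d) := fun _ hs => hs

/-! ### Discreteness and a Borel fundamental domain -/

theorem eq_one_of_mem_intSp {γ : Sp d} (hγ : γ ∈ intSp d)
    (h : ∀ i j, |γ.1 i j - (1 : Matrix _ _ ℝ) i j| < 1) : γ = 1 := by
  obtain ⟨M, hM⟩ := hγ
  apply Subtype.ext
  ext i j
  have h1 := h i j
  have h2 : γ.1 i j = M i j := by rw [hM]; rfl
  have h3 : (1 : Matrix (Fin d ⊕ Fin d) (Fin d ⊕ Fin d) ℝ) i j =
    ((1 : Matrix (Fin d ⊕ Fin d) (Fin d ⊕ Fin d) ℤ) i j : ℝ) := by simp [one_apply, apply_ite]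
  rw [h2, h3] at h1
  have h4 : |M i j - (1 : Matrix (Fin d ⊕ Fin d) (Fin d ⊕ Fin d) ℤ) i j| < 1 := by exact_mod_cast h1
  rw [Int.abs_lt_one_iff, sub_eq_zero] at h4
  change γ.1 i j = (1 : Matrix (Fin d ⊕ Fin d) (Fin d ⊕ Fin d) ℝ) i j
  rw [h2, h3, h4]

/-- The symplectic matrices whose entries differ from those of the identity by less than `r`. -/
def nearOne (d : ℕ) (r : ℝ) : Set (Sp d) :=
  ⋂ i, ⋂ j, {g : Sp d | |g.1 i j - (1 : Matrix _ _ ℝ) i j| < r}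

theorem mem_nearOne {r : ℝ} {g : Sp d} :
    g ∈ nearOne d r ↔ ∀ i j, |g.1 i j - (1 : Matrix _ _ ℝ) i j| < r := by
  simp only [nearOne, Set.mem_iInter]
  rfl

theorem isOpen_nearOne (r : ℝ) : IsOpen (nearOne d r) := by
  refine isOpen_iInter_of_finite fun i => isOpen_iInter_of_finite fun j => ?_
  refine isOpen_lt ?_ continuous_const
  exact ((continuous_subtype_val.matrix_elem i j).sub continuous_const).abs

/-- Arbitrarily small neighbourhoods of the identity whose quotients stay close to one. -/
theorem exists_isOpen_inv_mul_mem_nearOne (r : ℝ) (hr : 0 < r) :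
    ∃ U : Set (Sp d), IsOpen U ∧ (1 : Sp d) ∈ U ∧ ∀ u ∈ U, ∀ v ∈ U, u⁻¹ * v ∈ nearOne d r := by
  have h1 : nearOne d r ∈ nhds ((1 : Sp d)⁻¹ * 1) := by
    rw [inv_one, one_mul]
    refine (isOpen_nearOne r).mem_nhds (mem_nearOne.2 fun i j => ?_)
    change |(1 : Matrix (Fin d ⊕ Fin d) (Fin d ⊕ Fin d) ℝ) i j - _| < r
    rwa [sub_self, abs_zero]
  have h2 : Filter.Tendsto (fun p : Sp d × Sp d => p.1⁻¹ * p.2) (nhds 1 ×ˢ nhds 1)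
      (nhds ((1 : Sp d)⁻¹ * 1)) :=
    (Filter.tendsto_fst.inv).mul Filter.tendsto_snd
  obtain ⟨u, hu, v, hv, huv⟩ := Filter.mem_prod_iff.1 (h2 h1)
  obtain ⟨U, hUuv, hU, h1U⟩ := mem_nhds_iff.1 (Filter.inter_mem hu hv)
  refine ⟨U, hU, h1U, fun a ha b hb => ?_⟩
  exact @huv (a, b) (Set.mk_mem_prod (hUuv ha).1 (hUuv hb).2)

/-- Countably many translates `V n` of a small neighbourhood cover the group, and each meets a coset
of the discrete subgroup at most once. Each coset is represented in the first `V n` that it meets.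
-/
theorem exists_fundamentalSet (d : ℕ) : ∃ F : Set (Sp d), MeasurableSet F ∧
    ∀ x : Sp d, ∃! γ : (intSp d).op, γ • x ∈ F := by
  obtain ⟨U, hU, h1U, hUU⟩ := exists_isOpen_inv_mul_mem_nearOne (d := d) 1 one_pos
  let h : ℕ → Sp d := TopologicalSpace.denseSeq (Sp d)
  let V : ℕ → Set (Sp d) := fun n => (fun x => (h n)⁻¹ * x) ⁻¹' U
  have hVo : ∀ n, IsOpen (V n) := fun n => hU.preimage (continuous_const_mul _)
  have hVc : ∀ x, ∃ n, x ∈ V n := by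
    intro x
    have hopen : IsOpen ((fun y : Sp d => y⁻¹ * x) ⁻¹' U) :=
      hU.preimage (continuous_inv.mul continuous_const)
    obtain ⟨n, hn⟩ := (TopologicalSpace.denseRange_denseSeq (Sp d)).exists_mem_open hopen
      ⟨x, by simpa using h1U⟩
    exact ⟨n, hn⟩
  have hinj : ∀ n, ∀ x ∈ V n, ∀ y ∈ V n, x⁻¹ * y ∈ intSp d → x = y := by
    intro n x hx y hy hxy
    have h1 : x⁻¹ * y = 1 := eq_one_of_mem_intSp hxy (by
      have := hUU _ hx _ hy
      rw [_root_.mul_inv_rev, inv_inv, mul_assoc, mul_inv_cancel_left] at this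
      exact mem_nearOne.1 this)
    exact (inv_mul_eq_one.1 h1)
  let S : ℕ → Set (Sp d) := fun n => {x | ∃ γ : (intSp d).op, γ • x ∈ V n}
  have hSm : ∀ n, MeasurableSet (S n) := by
    intro n
    have : S n = ⋃ γ : (intSp d).op, (fun x => γ • x) ⁻¹' V n := by
      ext x; simp [S]
    rw [this]
    exact MeasurableSet.iUnion fun γ => ((hVo n).preimage (continuous_const_smul γ)).measurableSet
  have hSinv : ∀ n (γ : (intSp d).op) x, γ • x ∈ S n ↔ x ∈ S n := by
    intro n γ x
    constructor
    · rintro ⟨δ, hδ⟩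
      exact ⟨δ * γ, by rwa [mul_smul]⟩
    · rintro ⟨δ, hδ⟩
      exact ⟨δ * γ⁻¹, by rwa [mul_smul, inv_smul_smul]⟩
  let F : Set (Sp d) := ⋃ n, V n \ ⋃ j ∈ Set.Iio n, S j
  have hF : ∀ x, x ∈ F ↔ ∃ n, x ∈ V n ∧ ∀ j < n, x ∉ S j := by
    intro x; simp [F]
  refine ⟨F, MeasurableSet.iUnion fun n => (hVo n).measurableSet.diff
    (MeasurableSet.biUnion (Set.to_countable _) fun j _ => hSm j), fun x => ?_⟩
  classical
  have hex : ∃ n, x ∈ S n := by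
    obtain ⟨n, hn⟩ := hVc x
    exact ⟨n, 1, by simpa using hn⟩
  obtain ⟨γ, hγ⟩ := Nat.find_spec hex
  refine ⟨γ, (hF _).2 ⟨Nat.find hex, hγ, fun j hj => ?_⟩, fun δ hδ => ?_⟩
  · rw [hSinv]
    exact Nat.find_min hex hj
  · obtain ⟨n, hn, hn'⟩ := (hF _).1 hδ
    have hn1 : n = Nat.find hex := by
      refine le_antisymm ?_ ?_
      · by_contra! hlt
        exact hn' _ hlt ((hSinv _ _ _).2 (Nat.find_spec hex))
      · exact Nat.find_min' hex ⟨δ, hn⟩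
    rw [hn1] at hn
    have hmem : (δ • x)⁻¹ * (γ • x) ∈ intSp d := by
      have h1 : δ • x = x * δ.1.unop := rfl
      have h2 : γ • x = x * γ.1.unop := rfl
      rw [h1, h2, _root_.mul_inv_rev, mul_assoc, inv_mul_cancel_left]
      exact mul_mem (inv_mem δ.2) γ.2
    have heq := hinj _ _ hn _ hγ hmem
    have h1 : x * δ.1.unop = x * γ.1.unop := heq
    exact Subtype.ext (MulOpposite.unop_injective (mul_left_cancel h1))

/-- A Borel set containing exactly one representative of each coset of `Sp(2d, ℤ)`. -/
def fundSet (d : ℕ) : Set (Sp d) := (exists_fundamentalSet d).choose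

theorem measurableSet_fundSet (d : ℕ) : MeasurableSet (fundSet d) :=
  (exists_fundamentalSet d).choose_spec.1

theorem existsUnique_smul_mem_fundSet (x : Sp d) : ∃! γ : (intSp d).op, γ • x ∈ fundSet d :=
  (exists_fundamentalSet d).choose_spec.2 x

/-! ### The inherited measure on a fundamental domain -/

instance : SMulInvariantMeasure (intSp d).op (Sp d) Measure.haar := inferInstance

theorem isFundamentalDomain_fundSet (d : ℕ) :
    IsFundamentalDomain (intSp d).op (fundSet d) (Measure.haar : Measure (Sp d)) :=
  IsFundamentalDomain.mk' (measurableSet_fundSet d).nullMeasurableSet existsUnique_smul_mem_fundSet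

theorem orbitMap_smul (γ : (intSp d).op) (x : Sp d) : orbitMap (γ • x) = orbitMap x :=
  orbitMap_mul x γ.2

theorem injOn_orbitMap_fundSet : Set.InjOn orbitMap (fundSet d) := by
  intro x hx y hy hxy
  have hmem := inv_mul_mem_of_orbitMap_eq hxy
  let γ : (intSp d).op := ⟨MulOpposite.op (x⁻¹ * y), hmem⟩
  have hγ : γ • x = y := by
    change x * (x⁻¹ * y) = y
    group
  have := (existsUnique_smul_mem_fundSet x).unique (y₁ := γ) (y₂ := 1) (by rwa [hγ]) (by simpa using hx)
  rw [← hγ, this, one_smul]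

/-- A Borel set on which the orbit map is injective can be cut into countably many pieces and moved
into the fundamental domain without overlap, so the fundamental domain attains the supremum. -/
theorem quotientMass_eq {A : Set (Y d)} (hA : MeasurableSet A) :
    quotientMass A = (Measure.haar : Measure (Sp d)) (fundSet d ∩ orbitMap ⁻¹' A) := by
  refine le_antisymm (iSup₂_le ?_) ?_
  · rintro B ⟨hB, hinj, hsub⟩
    rw [(isFundamentalDomain_fundSet d).measure_eq_tsum B]
    rw [← measure_iUnion]
    · refine measure_mono ?_
      intro x hx
      obtain ⟨γ, hγ, hxF⟩ := Set.mem_iUnion.1 hx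
      refine ⟨hxF, ?_⟩
      obtain ⟨b, hb, rfl⟩ := hγ
      change orbitMap (γ • b) ∈ A
      rw [orbitMap_smul]
      exact hsub hb
    · intro γ δ hγδ
      refine Set.disjoint_left.2 ?_
      rintro x ⟨⟨b, hb, rfl⟩, -⟩ ⟨⟨c, hc, hbc⟩, -⟩
      apply hγδ
      have hbc' : δ • c = γ • b := hbc
      have : b = c := hinj hb hc (by rw [← orbitMap_smul γ b, ← hbc', orbitMap_smul])
      subst this
      have h1 : b * δ.1.unop = b * γ.1.unop := hbc'
      exact (Subtype.ext (MulOpposite.unop_injective (mul_left_cancel h1))).symm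
    · exact fun γ => (hB.const_smul γ).inter (measurableSet_fundSet d)
  · exact le_iSup₂_of_le (fundSet d ∩ orbitMap ⁻¹' A) ⟨(measurableSet_fundSet d).inter
      (measurable_orbitMap hA), injOn_orbitMap_fundSet.mono Set.inter_subset_left,
      Set.inter_subset_right⟩ le_rfl

theorem quotientMeasure_eq_map (d : ℕ) : quotientMeasure d =
    ((Measure.haar : Measure (Sp d)).restrict (fundSet d)).map orbitMap := by
  ext A hA
  rw [quotientMeasure, Measure.ofMeasurable_apply _ hA, quotientMass_eq hA,
    Measure.map_apply measurable_orbitMap hA, Measure.restrict_apply (measurable_orbitMap hA),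
    Set.inter_comm]

/-- Left translation invariance of integrals of `Sp(2d, ℤ)`-invariant functions. -/
theorem setLIntegral_fundSet_mul_left (f : Sp d → ℝ≥0∞) (hf : ∀ x, ∀ γ ∈ intSp d, f (x * γ) = f x)
    (g : Sp d) : ∫⁻ x in fundSet d, f (g * x) ∂Measure.haar =
      ∫⁻ x in fundSet d, f x ∂Measure.haar := by
  -- Left and right multiplication commute, so the left translate is again a fundamental domain.
  have h1 := (isFundamentalDomain_fundSet d).smul_of_comm g
  rw [(isFundamentalDomain_fundSet d).setLIntegral_eq h1 f (fun γ x => hf x _ γ.2)]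
  have h2 := (measurePreserving_mul_left (Measure.haar : Measure (Sp d)) g).setLIntegral_comp_emb
    (measurableEmbedding_mulLeft g) f (fundSet d)
  exact h2

/-- Moving `C` back into the fundamental domain covers `A`. With `C` compact this bounds the measure
of a part of the quotient. -/
theorem measure_le_of_translate_cover {A C : Set (Sp d)} (hA : A ⊆ fundSet d)
    (hAC : ∀ x ∈ A, ∃ γ ∈ intSp d, x * γ ∈ C) : Measure.haar A ≤ Measure.haar C := by
  rw [(isFundamentalDomain_fundSet d).measure_eq_tsum C]
  refine le_trans (measure_mono ?_) (measure_iUnion_le _)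
  intro x hx
  obtain ⟨γ, hγ, hxC⟩ := hAC x hx
  let δ : (intSp d).op := ⟨MulOpposite.op γ, hγ⟩
  refine Set.mem_iUnion.2 ⟨δ⁻¹, ⟨_, hxC, ?_⟩, hA hx⟩
  change δ⁻¹ • (δ • x) = x
  rw [inv_smul_smul]

/-- A measurable set on which the orbit map is at most `N`-to-one has an image of measure at least
`1 / N` times its own. -/
theorem measure_le_mul_quotientMeasure {S : Set (Sp d)} {A : Set (Y d)} (hS : MeasurableSet S)
    (hA : MeasurableSet A) (hSA : S ⊆ orbitMap ⁻¹' A) (N : ℕ)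
    (hN : ∀ x ∈ S, {γ : (intSp d).op | γ • x ∈ S}.encard ≤ N) :
    Measure.haar S ≤ N * quotientMeasure d A := by
  rw [quotientMeasure, Measure.ofMeasurable_apply _ hA, quotientMass_eq hA,
    (isFundamentalDomain_fundSet d).measure_eq_tsum S]
  have h1 : ∀ γ : (intSp d).op, Measure.haar (γ • S ∩ fundSet d) =
      ∫⁻ x in fundSet d ∩ orbitMap ⁻¹' A, (γ • S).indicator 1 x ∂Measure.haar := by
    intro γ
    have hγS := hS.const_smul γ
    rw [lintegral_indicator_one hγS, Measure.restrict_apply hγS]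
    congr 1
    ext x
    simp only [Set.mem_inter_iff, Set.mem_preimage]
    refine ⟨fun ⟨h, h'⟩ => ⟨h, h', ?_⟩, fun ⟨h, h', _⟩ => ⟨h, h'⟩⟩
    obtain ⟨s, hs, rfl⟩ := h
    change orbitMap (γ • s) ∈ A
    rw [orbitMap_smul]
    exact hSA hs
  simp_rw [h1]
  rw [← lintegral_tsum fun γ => (measurable_one.indicator (hS.const_smul γ)).aemeasurable]
  rw [← setLIntegral_const]
  refine lintegral_mono fun x => ?_
  by_cases hx : ∃ γ : (intSp d).op, γ • x ∈ S
  · obtain ⟨γ₀, hγ₀⟩ := hx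
    have h2 : ∀ γ : (intSp d).op, (γ • S).indicator (1 : Sp d → ℝ≥0∞) x =
        Set.indicator {γ : (intSp d).op | γ⁻¹ • x ∈ S} 1 γ := by
      intro γ
      by_cases hγ : γ⁻¹ • x ∈ S
      · rw [Set.indicator_of_mem (Set.mem_smul_set_iff_inv_smul_mem.2 hγ),
          Set.indicator_of_mem (by exact hγ)]
        rfl
      · rw [Set.indicator_of_notMem (fun h => hγ (Set.mem_smul_set_iff_inv_smul_mem.1 h)),
          Set.indicator_of_notMem (by exact hγ)]
    simp_rw [h2]
    rw [← tsum_subtype]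
    simp only [Pi.one_apply, ENNReal.tsum_set_one]
    -- The multiplicity bound is only known at points of `S`, so the count is shifted to `γ₀ • x`.
    have h3 : {γ : (intSp d).op | γ⁻¹ • x ∈ S}.encard ≤ N := by
      refine le_trans ?_ (hN _ hγ₀)
      refine Set.encard_le_encard_of_injOn (f := fun γ => γ⁻¹ * γ₀⁻¹) ?_ ?_
      · intro γ hγ
        simpa [mul_smul] using hγ
      · intro a _ b _ hab
        simpa using hab
    exact_mod_cast (ENat.toENNReal_le.2 h3)
  · push Not at hx
    have h2 : ∀ γ : (intSp d).op, (γ • S).indicator (1 : Sp d → ℝ≥0∞) x = 0 := by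
      intro γ
      rw [Set.indicator_of_notMem]
      rw [Set.mem_smul_set_iff_inv_smul_mem]
      exact hx _
    simp [h2]

end Quotient

/-! ### Functions contracted by an averaging operator -/

section Drift

variable {X I : Type*} [MeasurableSpace X] [Fintype I] {m : Measure X} {f : X → ℝ≥0∞}
  {T : I → X → X} {w : I → ℝ≥0∞} {c b : ℝ≥0∞}

/-- Since `f` is not known to be integrable, the drift inequality is integrated for the truncation
`R - f`, which is supported in the set `{f ≤ R}` of finite measure. Its integral is invariant under
each `T i`, so it may be cancelled. The resulting ratio `b / (1 - c)` does not depend on `R`. -/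
theorem setLIntegral_le_of_drift (hf : Measurable f) (hTf : ∀ i, Measurable fun x => f (T i x))
    (hw : ∑ i, w i = 1) (hinv : ∀ i (R : ℝ≥0∞), ∫⁻ x, (R - f (T i x)) ∂m = ∫⁻ x, (R - f x) ∂m)
    (hc : c < 1) (hdrift : ∀ x, ∑ i, w i * f (T i x) ≤ c * f x + b)
    {R : ℝ≥0∞} (hR : R ≠ ∞) (hfin : m {x | f x ≤ R} ≠ ∞) :
    ∫⁻ x in {x | f x ≤ R}, f x ∂m ≤ b / (1 - c) * m {x | f x ≤ R} := by
  set E := {x | f x ≤ R} with hE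
  have hEm : MeasurableSet E := measurableSet_le hf measurable_const
  have hu : ∫⁻ x, (R - f x) ∂m ≠ ∞ := by
    have h1 : ∀ x, R - f x ≤ E.indicator (fun _ => R) x := by
      intro x
      by_cases hx : x ∈ E
      · rw [Set.indicator_of_mem hx]; exact tsub_le_self
      · rw [Set.indicator_of_notMem hx, tsub_eq_zero_of_le (not_le.1 hx).le]
    refine ((lintegral_mono h1).trans_lt ?_).ne
    rw [lintegral_indicator hEm, setLIntegral_const]
    exact ENNReal.mul_lt_top hR.lt_top hfin.lt_top
  have hA : ∫⁻ x, (R - (c * f x + b)) ∂m ≤ ∫⁻ x, (R - f x) ∂m := by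
    have h1 : ∀ x, R - (c * f x + b) ≤ ∑ i, w i * (R - f (T i x)) := by
      intro x
      rw [tsub_le_iff_right]
      calc R = ∑ i, w i * R := by rw [← Finset.sum_mul, hw, one_mul]
        _ ≤ ∑ i, (w i * (R - f (T i x)) + w i * f (T i x)) := by
          refine Finset.sum_le_sum fun i _ => ?_
          rw [← mul_add]
          exact mul_le_mul_right le_tsub_add _
        _ = ∑ i, w i * (R - f (T i x)) + ∑ i, w i * f (T i x) := Finset.sum_add_distrib
        _ ≤ _ := by gcongr; exact hdrift x
    calc ∫⁻ x, (R - (c * f x + b)) ∂m ≤ ∫⁻ x, ∑ i, w i * (R - f (T i x)) ∂m := lintegral_mono h1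
      _ = ∑ i, w i * ∫⁻ x, (R - f x) ∂m := by
        rw [lintegral_finsetSum _ fun i _ => (((hTf i).const_sub R).const_mul _)]
        refine Finset.sum_congr rfl fun i _ => ?_
        rw [lintegral_const_mul _ ((hTf i).const_sub R), hinv]
      _ = _ := by rw [← Finset.sum_mul, hw, one_mul]
  have hpt : ∀ x, (R - f x) + E.indicator f x ≤
      (R - (c * f x + b)) + E.indicator (fun x => c * f x + b) x := by
    intro x
    by_cases hx : x ∈ E
    · rw [Set.indicator_of_mem hx, Set.indicator_of_mem hx, tsub_add_cancel_of_le hx]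
      exact le_tsub_add
    · rw [Set.indicator_of_notMem hx, tsub_eq_zero_of_le (not_le.1 hx).le, zero_add]
      exact zero_le
  have hint := lintegral_mono (μ := m) hpt
  rw [lintegral_add_left (hf.const_sub R), lintegral_indicator hEm,
    lintegral_add_left (((hf.const_mul c).add_const b).const_sub R),
    lintegral_indicator hEm, lintegral_add_right _ measurable_const, setLIntegral_const,
    lintegral_const_mul _ hf] at hint
  set a := ∫⁻ x in E, f x ∂m
  have ha : a ≠ ∞ := by
    refine ((setLIntegral_mono measurable_const (fun x hx => hx) :
      a ≤ ∫⁻ x in E, R ∂m).trans_lt ?_).ne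
    rw [setLIntegral_const]
    exact ENNReal.mul_lt_top hR.lt_top hfin.lt_top
  have h2 : a ≤ c * a + b * m E :=
    (ENNReal.add_le_add_iff_left hu).1 (hint.trans (by gcongr))
  have h3 : (1 - c) * a ≤ b * m E := by
    rw [ENNReal.sub_mul (fun _ _ => ha), one_mul]
    exact tsub_le_iff_left.2 h2
  have h4 : (1 - c) ≠ 0 := (tsub_pos_of_lt hc).ne'
  have h5 : (1 - c) ≠ ∞ := (tsub_le_self.trans_lt ENNReal.one_lt_top).ne
  rw [← ENNReal.mul_div_right_comm, ENNReal.le_div_iff_mul_le (Or.inl h4) (Or.inl h5), mul_comm]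
  exact h3

/-- On every sublevel set the mean of `f` is at most `K`, so at least half of its mass lies in `{f ≤
2 K}`. Letting the level grow bounds the total mass by twice that of one sublevel set. -/
theorem measure_lt_top_and_lintegral_lt_top_of_drift (hf : Measurable f)
    (hTf : ∀ i, Measurable fun x => f (T i x)) (hf' : ∀ x, f x ≠ ∞)
    (hw : ∑ i, w i = 1) (hinv : ∀ i (R : ℝ≥0∞), ∫⁻ x, (R - f (T i x)) ∂m = ∫⁻ x, (R - f x) ∂m)
    (hc : c < 1) (hb : b ≠ ∞) (hdrift : ∀ x, ∑ i, w i * f (T i x) ≤ c * f x + b)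
    (hfin : ∀ R : ℝ≥0∞, R ≠ ∞ → m {x | f x ≤ R} ≠ ∞) :
    m Set.univ < ∞ ∧ ∫⁻ x, f x ∂m < ∞ := by
  -- The summand `1` makes `K` nonzero, so that it can be cancelled.
  set K : ℝ≥0∞ := b / (1 - c) + 1 with hK
  have hK0 : K ≠ 0 := by simp [hK]
  have hKt : K ≠ ∞ := by
    simp only [hK]
    exact ENNReal.add_ne_top.2 ⟨ENNReal.div_ne_top hb (tsub_pos_of_lt hc).ne', ENNReal.one_ne_top⟩
  have hle : ∀ R : ℝ≥0∞, R ≠ ∞ → ∫⁻ x in {x | f x ≤ R}, f x ∂m ≤ K * m {x | f x ≤ R} :=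
    fun R hR => (setLIntegral_le_of_drift hf hTf hw hinv hc hdrift hR (hfin R hR)).trans
      (by gcongr; exact le_self_add)
  have hmeas : ∀ R, MeasurableSet {x | f x ≤ R} := fun R => measurableSet_le hf measurable_const
  have hM : 2 * K ≠ ∞ := ENNReal.mul_ne_top ENNReal.ofNat_ne_top hKt
  have hball : ∀ R : ℝ≥0∞, R ≠ ∞ → m {x | f x ≤ R} ≤ 2 * m {x | f x ≤ 2 * K} := by
    intro R hR
    set s := {x | f x ≤ R}
    set t := {x | f x ≤ 2 * K}
    have hsplit : m s ≤ m t + m (s \ t) := by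
      refine (measure_mono ?_).trans (measure_union_le t (s \ t))
      intro x hx
      by_cases hxt : x ∈ t
      · exact Or.inl hxt
      · exact Or.inr ⟨hx, hxt⟩
    have h1 : 2 * K * m (s \ t) ≤ ∫⁻ x in s, f x ∂m := by
      rw [← setLIntegral_const]
      refine (setLIntegral_mono hf fun x hx => (not_le.1 hx.2).le).trans ?_
      exact lintegral_mono_set Set.sdiff_subset
    have h2 : 2 * K * m (s \ t) ≤ K * m t + K * m (s \ t) := by
      rw [← mul_add]
      exact (h1.trans (hle R hR)).trans (by gcongr)
    have hfin' : m (s \ t) ≠ ∞ := ((measure_mono Set.sdiff_subset).trans_lt (hfin R hR).lt_top).ne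
    rw [two_mul, add_mul, ENNReal.add_le_add_iff_right (ENNReal.mul_ne_top hKt hfin'),
      ENNReal.mul_le_mul_iff_right hK0 hKt] at h2
    rw [two_mul]
    exact hsplit.trans (by gcongr)
  have huniv : (⋃ n : ℕ, {x | f x ≤ n}) = Set.univ := by
    refine Set.eq_univ_of_forall fun x => ?_
    obtain ⟨n, hn⟩ := ENNReal.exists_nat_gt (hf' x)
    exact Set.mem_iUnion.2 ⟨n, hn.le⟩
  have hmono : Monotone fun n : ℕ => {x | f x ≤ n} := by
    intro a b hab x hx
    exact le_trans (show f x ≤ a from hx) (by exact_mod_cast hab)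
  have hmu : m Set.univ ≤ 2 * m {x | f x ≤ 2 * K} := by
    rw [← huniv, hmono.measure_iUnion]
    exact iSup_le fun n => hball n (ENNReal.natCast_ne_top n)
  have hmu' : m Set.univ < ∞ :=
    hmu.trans_lt (ENNReal.mul_lt_top ENNReal.ofNat_lt_top (hfin _ hM).lt_top)
  refine ⟨hmu', ?_⟩
  have h3 : ∫⁻ x, f x ∂m ≤ K * m Set.univ := by
    rw [← setLIntegral_univ, ← huniv, setLIntegral_iUnion_of_directed f hmono.directed_le]
    refine iSup_le fun n => (hle n (ENNReal.natCast_ne_top n)).trans ?_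
    gcongr
    exact Set.subset_iUnion (fun n : ℕ => {x | f x ≤ n}) n
  exact h3.trans_lt (ENNReal.mul_lt_top hKt.lt_top hmu')

end Drift

/-! ### Gram determinants -/

section Gram

set_option linter.unusedSectionVars false

variable {ι κ κ' : Type*} [Fintype ι] [Fintype κ] [DecidableEq κ] [Fintype κ'] [DecidableEq κ']

/-- The Gram determinant of the columns of a matrix, the square of their volume. -/
def gramDet (B : Matrix ι κ ℝ) : ℝ := (Bᵀ * B).det

theorem posSemidef_transpose_mul_self (B : Matrix ι κ ℝ) : (Bᵀ * B).PosSemidef := by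
  simpa using posSemidef_conjTranspose_mul_self B

theorem gramDet_nonneg (B : Matrix ι κ ℝ) : 0 ≤ gramDet B :=
  (posSemidef_transpose_mul_self B).det_nonneg

theorem gramDet_mul (B : Matrix ι κ ℝ) (A : Matrix κ κ ℝ) :
    gramDet (B * A) = A.det ^ 2 * gramDet B := by
  rw [gramDet, transpose_mul, Matrix.mul_assoc, ← Matrix.mul_assoc Bᵀ, det_mul, det_mul,
    det_transpose, gramDet]
  ring

theorem gramDet_submatrix (B : Matrix ι κ ℝ) (e : κ' ≃ κ) :
    gramDet (B.submatrix id e) = gramDet B := by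
  have h := submatrix_mul_equiv Bᵀ B e (Equiv.refl ι) e
  rw [Equiv.coe_refl] at h
  rw [gramDet, transpose_submatrix, h, det_submatrix_equiv_self, gramDet]

theorem exists_eq_conj_mul_self {S : Matrix κ κ ℝ} (hS : S.PosSemidef) :
    ∃ C : Matrix κ κ ℝ, S = Cᵀ * C := by
  open scoped MatrixOrder in
  obtain ⟨C, hC⟩ := CStarAlgebra.nonneg_iff_eq_star_mul_self.1 hS.nonneg
  exact ⟨C, by rw [hC, star_eq_conjTranspose, conjTranspose_eq_transpose_of_trivial]⟩

/-- Factor `Bᵀ B = Cᵀ C` and take `Q = B C⁻¹`. This reduces statements about frames to orthonormal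
ones. -/
theorem exists_orthonormal_mul {B : Matrix ι κ ℝ} (hB : gramDet B ≠ 0) :
    ∃ (Q : Matrix ι κ ℝ) (C : Matrix κ κ ℝ), B = Q * C ∧ Qᵀ * Q = 1 ∧ C.det ^ 2 = gramDet B ∧
      ∃ D : Matrix κ κ ℝ, Q = B * D := by
  obtain ⟨C, hC⟩ := exists_eq_conj_mul_self (posSemidef_transpose_mul_self B)
  have hdet : C.det ^ 2 = gramDet B := by
    rw [gramDet, hC, det_mul, det_transpose, sq]
  have hu : IsUnit C.det := isUnit_iff_ne_zero.2 fun h => hB (by rw [← hdet, h]; ring)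
  have hu' : IsUnit Cᵀ.det := by rwa [det_transpose]
  refine ⟨B * C⁻¹, C, by rw [Matrix.mul_assoc, nonsing_inv_mul _ hu, Matrix.mul_one], ?_, hdet,
    C⁻¹, rfl⟩
  rw [transpose_mul, Matrix.mul_assoc, ← Matrix.mul_assoc Bᵀ, hC, transpose_nonsing_inv,
    Matrix.mul_assoc, mul_nonsing_inv _ hu, Matrix.mul_one, nonsing_inv_mul _ hu']

theorem one_le_det_one_add {Z : Matrix κ κ ℝ} (hZ : Z.PosSemidef) : 1 ≤ (1 + Z).det := by
  have hH : (1 + Z).IsHermitian := isHermitian_one.add hZ.isHermitian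
  rw [hH.det_eq_prod_eigenvalues]
  simp only [RCLike.ofReal_real_eq_id, id]
  rw [← Finset.prod_const_one (s := (Finset.univ : Finset κ))]
  refine Finset.prod_le_prod (fun _ _ => zero_le_one) fun i _ => ?_
  rw [hH.eigenvalues_eq]
  have h1 := hZ.dotProduct_mulVec_nonneg (hH.eigenvectorBasis i).ofLp
  have h2 : star (hH.eigenvectorBasis i).ofLp ⬝ᵥ (hH.eigenvectorBasis i).ofLp = 1 := by
    have := hH.eigenvectorBasis.orthonormal.1 i
    have h3 := real_inner_self_eq_norm_sq (hH.eigenvectorBasis i)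
    rw [this, EuclideanSpace.inner_eq_star_dotProduct] at h3
    rw [dotProduct_comm]
    simpa using h3
  rw [add_mulVec, one_mulVec, dotProduct_add, h2]
  simpa using h1

/-- Writing `S = Cᵀ C` with `C` invertible reduces the claim to `1 ≤ det (1 + Z)`. -/
theorem det_le_det_add {S T : Matrix κ κ ℝ} (hS : S.PosSemidef) (hT : T.PosSemidef) :
    S.det ≤ (S + T).det := by
  by_cases h0 : S.det = 0
  · rw [h0]; exact (hS.add hT).det_nonneg
  obtain ⟨C, rfl⟩ := exists_eq_conj_mul_self hS
  have hu : IsUnit C.det := isUnit_iff_ne_zero.2 fun h => h0 (by rw [det_mul, h, mul_zero])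
  have hu' : IsUnit Cᵀ.det := by rwa [det_transpose]
  have h1 : Cᵀ * C + T = Cᵀ * (1 + C⁻¹ᵀ * T * C⁻¹) * C := by
    rw [Matrix.mul_add, Matrix.add_mul, Matrix.mul_one, transpose_nonsing_inv, ← Matrix.mul_assoc,
      ← Matrix.mul_assoc, mul_nonsing_inv _ hu', Matrix.one_mul, Matrix.mul_assoc T,
      nonsing_inv_mul _ hu, Matrix.mul_one]
  have h2 : (C⁻¹ᵀ * T * C⁻¹).PosSemidef := by
    simpa using hT.conjTranspose_mul_mul_same C⁻¹
  rw [h1, det_mul, det_mul, det_mul, det_transpose]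
  nlinarith [one_le_det_one_add h2, mul_self_nonneg C.det]

/-! ### Projections and submodularity of volumes -/

variable [DecidableEq ι]

/-- The orthogonal projection onto the complement of the column space. -/
def compProj (C : Matrix ι κ ℝ) : Matrix ι ι ℝ := 1 - C * (Cᵀ * C)⁻¹ * Cᵀ

theorem compProj_transpose (C : Matrix ι κ ℝ) : (compProj C)ᵀ = compProj C := by
  simp [compProj, transpose_mul, transpose_nonsing_inv, Matrix.mul_assoc]

theorem compProj_mul_self {C : Matrix ι κ ℝ} (hC : gramDet C ≠ 0) :
    compProj C * compProj C = compProj C := by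
  have hu : IsUnit (Cᵀ * C).det := isUnit_iff_ne_zero.2 hC
  have : C * (Cᵀ * C)⁻¹ * Cᵀ * (C * (Cᵀ * C)⁻¹ * Cᵀ) = C * (Cᵀ * C)⁻¹ * Cᵀ := by
    calc _ = C * (Cᵀ * C)⁻¹ * ((Cᵀ * C) * (Cᵀ * C)⁻¹) * Cᵀ := by simp only [Matrix.mul_assoc]
      _ = _ := by rw [mul_nonsing_inv _ hu, Matrix.mul_one]
  simp only [compProj, Matrix.sub_mul, Matrix.mul_sub, this, Matrix.one_mul, Matrix.mul_one,
    sub_self, sub_zero]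

/-- Schur complement of the block Gram matrix: it is the Gram matrix of `X` projected away from `C`.
-/
theorem gramDet_fromCols {C : Matrix ι κ ℝ} (hC : gramDet C ≠ 0) (X : Matrix ι κ' ℝ) :
    gramDet (fromCols C X) = gramDet C * gramDet (compProj C * X) := by
  have hu : IsUnit (Cᵀ * C).det := isUnit_iff_ne_zero.2 hC
  let _ := invertibleOfIsUnitDet _ hu
  rw [gramDet, transpose_fromCols, fromRows_mul_fromCols, det_fromBlocks₁₁, gramDet, gramDet]
  congr 2
  rw [transpose_mul, compProj_transpose, Matrix.mul_assoc Xᵀ (compProj C),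
    ← Matrix.mul_assoc (compProj C), compProj_mul_self hC, compProj, invOf_eq_nonsing_inv]
  simp only [Matrix.sub_mul, Matrix.mul_sub, Matrix.mul_assoc, Matrix.one_mul]

/-- By Pythagoras, `Xᵀ X` is the Gram matrix of the projection plus a positive semidefinite matrix.
-/
theorem gramDet_compProj_mul_le {C : Matrix ι κ ℝ} (hC : gramDet C ≠ 0) (X : Matrix ι κ' ℝ) :
    gramDet (compProj C * X) ≤ gramDet X := by
  have h1 : Xᵀ * X = (compProj C * X)ᵀ * (compProj C * X) +
      ((1 - compProj C) * X)ᵀ * ((1 - compProj C) * X) := by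
    have h2 : compProj C * (compProj C * X) = compProj C * X := by
      rw [← Matrix.mul_assoc, compProj_mul_self hC]
    simp only [transpose_mul, transpose_sub, compProj_transpose, Matrix.mul_assoc,
      Matrix.sub_mul, Matrix.mul_sub, Matrix.one_mul, h2]
    abel
  rw [gramDet, gramDet, h1]
  exact det_le_det_add (posSemidef_transpose_mul_self _) (posSemidef_transpose_mul_self _)

theorem gramDet_fromCols_le {A : Matrix ι κ ℝ} (hA : gramDet A ≠ 0) (B : Matrix ι κ' ℝ) :
    gramDet (fromCols A B) ≤ gramDet A * gramDet B := by
  rw [gramDet_fromCols hA]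
  exact mul_le_mul_of_nonneg_left (gramDet_compProj_mul_le hA B) (gramDet_nonneg A)

/-- Strong subadditivity of volumes. -/
theorem gramDet_fromCols_mul_le {κ'' : Type*} [Fintype κ''] [DecidableEq κ'']
    {C : Matrix ι κ'' ℝ} {A : Matrix ι κ ℝ} (hC : gramDet C ≠ 0)
    (hCA : gramDet (fromCols C A) ≠ 0) (B : Matrix ι κ' ℝ) :
    gramDet (fromCols C (fromCols A B)) * gramDet C ≤
      gramDet (fromCols C A) * gramDet (fromCols C B) := by
  -- Factoring out `C` everywhere leaves submultiplicativity for the projected frames.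
  have hA : gramDet (compProj C * A) ≠ 0 := fun h => hCA (by rw [gramDet_fromCols hC, h, mul_zero])
  rw [gramDet_fromCols hC, gramDet_fromCols hC, gramDet_fromCols hC, mul_fromCols]
  have := gramDet_fromCols_le hA (compProj C * B)
  have h0 := mul_nonneg (gramDet_nonneg C) (gramDet_nonneg C)
  nlinarith [mul_le_mul_of_nonneg_left this h0]

theorem abs_apply_le_one_of_orthonormal {Q : Matrix ι κ ℝ} (hQ : Qᵀ * Q = 1) (i : ι) (j : κ) :
    |Q i j| ≤ 1 := by
  have h1 : ∑ l, Q l j * Q l j = 1 := by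
    have := congrFun (congrFun hQ j) j
    simpa [mul_apply] using this
  have h2 : Q i j * Q i j ≤ 1 := by
    rw [← h1]
    exact Finset.single_le_sum (f := fun l => Q l j * Q l j) (fun l _ => mul_self_nonneg _)
      (Finset.mem_univ i)
  rw [← sq_le_one_iff_abs_le_one, sq]
  exact h2

theorem card_le_of_orthonormal {Q : Matrix ι κ ℝ} (hQ : Qᵀ * Q = 1) :
    Fintype.card κ ≤ Fintype.card ι := by
  have h1 : (Qᵀ * Q).rank = Fintype.card κ := by rw [hQ, rank_one]
  have h2 := (rank_mul_le_right Qᵀ Q).trans (rank_le_card_height Q)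
  omega

theorem card_le_of_gramDet_ne_zero {B : Matrix ι κ ℝ} (hB : gramDet B ≠ 0) :
    Fintype.card κ ≤ Fintype.card ι := by
  obtain ⟨Q, -, -, hQ, -⟩ := exists_orthonormal_mul hB
  exact card_le_of_orthonormal hQ

/-- Any bound on the entries of `Qᵀ M Q`, for `Q` with orthonormal columns, bounds its
determinant. -/
theorem exists_abs_det_conj_le (M : Matrix ι ι ℝ) : ∃ K : ℝ, 1 ≤ K ∧
    ∀ {k : ℕ} (Q : Matrix ι (Fin k) ℝ), Qᵀ * Q = 1 → |(Qᵀ * M * Q).det| ≤ K := by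
  set c : ℝ := 1 + ∑ i, ∑ j, |M i j| with hc
  have hc1 : 1 ≤ c := by
    have : 0 ≤ ∑ i, ∑ j, |M i j| := Finset.sum_nonneg fun _ _ => Finset.sum_nonneg fun _ _ =>
      abs_nonneg _
    linarith
  set n := Fintype.card ι
  have hfac : (1 : ℝ) ≤ n.factorial := by exact_mod_cast Nat.one_le_of_lt n.factorial_pos
  -- Leibniz expansion with entries at most `c`; orthonormality forces `k ≤ n`, so the bound is
  -- uniform in the rank.
  refine ⟨n.factorial * c ^ n, ?_, fun {k} Q hQ => ?_⟩
  · nlinarith [one_le_pow₀ hc1 (n := n)]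
  have hk : k ≤ n := by simpa using card_le_of_orthonormal hQ
  have hentry : ∀ i j, |(Qᵀ * M * Q) i j| ≤ c := by
    intro i j
    have h1 : (Qᵀ * M * Q) i j = ∑ b, ∑ a, Q a i * M a b * Q b j := by
      simp [mul_apply, Finset.sum_mul]
    rw [h1]
    calc |∑ b, ∑ a, Q a i * M a b * Q b j| ≤ ∑ b, ∑ a, |Q a i * M a b * Q b j| :=
          (Finset.abs_sum_le_sum_abs _ _).trans
            (Finset.sum_le_sum fun b _ => Finset.abs_sum_le_sum_abs _ _)
      _ ≤ ∑ b, ∑ a, |M a b| := by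
          refine Finset.sum_le_sum fun b _ => Finset.sum_le_sum fun a _ => ?_
          rw [abs_mul, abs_mul]
          have h2 := abs_apply_le_one_of_orthonormal hQ a i
          have h3 := abs_apply_le_one_of_orthonormal hQ b j
          calc |Q a i| * |M a b| * |Q b j| ≤ 1 * |M a b| * 1 := by gcongr
            _ = |M a b| := by ring
      _ = ∑ a, ∑ b, |M a b| := Finset.sum_comm
      _ ≤ c := by linarith
  have h := det_le (abv := AbsoluteValue.abs) hentry
  simp only [AbsoluteValue.abs_apply, Fintype.card_fin, nsmul_eq_mul] at h
  refine h.trans ?_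
  have h4 : (k.factorial : ℝ) ≤ n.factorial := by exact_mod_cast Nat.factorial_le hk
  gcongr

/-- With `B = Q C` the factor `det C ^ 2` cancels, leaving a determinant bounded over all
orthonormal `Q`. -/
theorem exists_gramDet_mul_le (M : Matrix ι ι ℝ) : ∃ K : ℝ, 1 ≤ K ∧
    ∀ {k : ℕ} (B : Matrix ι (Fin k) ℝ), gramDet B ≠ 0 → gramDet (M * B) ≤ K * gramDet B := by
  obtain ⟨K, hK, h⟩ := exists_abs_det_conj_le (Mᵀ * M)
  refine ⟨K, hK, fun {k} B hB => ?_⟩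
  obtain ⟨Q, C, rfl, hQ, hC, -⟩ := exists_orthonormal_mul hB
  rw [← Matrix.mul_assoc, gramDet_mul, ← hC, mul_comm]
  refine mul_le_mul_of_nonneg_right ?_ (sq_nonneg _)
  refine le_trans (le_of_eq ?_) ((le_abs_self _).trans (h Q hQ))
  rw [gramDet, transpose_mul]
  simp only [Matrix.mul_assoc]

end Gram

/-! ### Symplectic transvections -/

section Transvection

variable {d : ℕ}

theorem dotProduct_J_self (u : Fin d ⊕ Fin d → ℝ) : (u ᵥ* J (Fin d) ℝ) ⬝ᵥ u = 0 := by
  have h1 : (u ᵥ* J (Fin d) ℝ) ⬝ᵥ u = -((u ᵥ* J (Fin d) ℝ) ⬝ᵥ u) := by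
    conv_lhs => rw [dotProduct_comm, ← mulVec_transpose, J_transpose, neg_mulVec, dotProduct_neg,
      dotProduct_mulVec]
  linarith

/-- The symplectic transvection `x ↦ x + t ω(u, x) u`. -/
def transv (u : Fin d ⊕ Fin d → ℝ) (t : ℝ) : Sp d :=
  ⟨1 + t • vecMulVec u (u ᵥ* J (Fin d) ℝ), by
    have h0 : vecMulVec (u ᵥ* J (Fin d) ℝ) u * (J (Fin d) ℝ * vecMulVec u (u ᵥ* J (Fin d) ℝ)) =
        0 := by
      rw [mul_vecMulVec, vecMulVec_mul_vecMulVec, dotProduct_mulVec, dotProduct_J_self]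
      simp
    have h1 : J (Fin d) ℝ * vecMulVec u (u ᵥ* J (Fin d) ℝ) =
        - vecMulVec (u ᵥ* J (Fin d) ℝ) (u ᵥ* J (Fin d) ℝ) := by
      rw [mul_vecMulVec, ← vecMul_transpose, J_transpose, vecMul_neg, neg_vecMulVec]
    have h2 : vecMulVec (u ᵥ* J (Fin d) ℝ) u * J (Fin d) ℝ =
        vecMulVec (u ᵥ* J (Fin d) ℝ) (u ᵥ* J (Fin d) ℝ) := vecMulVec_mul _ _ _
    rw [SymplecticGroup.mem_iff', transpose_add, transpose_one, transpose_smul,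
      transpose_vecMulVec, Matrix.mul_assoc]
    simp only [Matrix.mul_add, Matrix.add_mul, Matrix.mul_one, Matrix.one_mul, Matrix.mul_smul,
      Matrix.smul_mul]
    rw [h0, h1, h2]
    simp⟩

/-- The Gram matrix of the image is a rank two perturbation `1 + P R` of the identity. Since `det (1
+ P R) = det (1 + R P)`, it becomes a `2 × 2` determinant. -/
theorem gramDet_transv_mul {k : ℕ} {Q : Matrix (Fin d ⊕ Fin d) (Fin k) ℝ} (hQ : Qᵀ * Q = 1)
    (u : Fin d ⊕ Fin d → ℝ) (t : ℝ) :
    gramDet ((transv u t).1 * Q) =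
      (1 + t * ((u ᵥ* Q) ⬝ᵥ (u ᵥ* (J (Fin d) ℝ * Q)))) ^ 2 +
      t ^ 2 * (((u ᵥ* (J (Fin d) ℝ * Q)) ⬝ᵥ (u ᵥ* (J (Fin d) ℝ * Q))) *
        (u ⬝ᵥ u - (u ᵥ* Q) ⬝ᵥ (u ᵥ* Q))) := by
  set a := u ᵥ* Q with ha
  set b := u ᵥ* (J (Fin d) ℝ * Q) with hb
  have h1 : (transv u t).1 * Q = Q + t • vecMulVec u b := by
    rw [transv, Matrix.add_mul, Matrix.one_mul, Matrix.smul_mul, vecMulVec_mul, vecMul_vecMul, hb]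
  let P : Matrix (Fin k) (Fin 2) ℝ := of fun i j => ![b i, t * a i] j
  let R : Matrix (Fin 2) (Fin k) ℝ := of ![t • a + (t ^ 2 * (u ⬝ᵥ u)) • b, b]
  have h2 : (Q + t • vecMulVec u b)ᵀ * (Q + t • vecMulVec u b) = 1 + P * R := by
    have h3 : Qᵀ * vecMulVec u b = vecMulVec a b := by
      rw [mul_vecMulVec, mulVec_transpose, ha]
    have h4 : vecMulVec b u * Q = vecMulVec b a := by rw [vecMulVec_mul]
    have h5 : vecMulVec b u * vecMulVec u b = (u ⬝ᵥ u) • vecMulVec b b := by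
      rw [vecMulVec_mul_vecMulVec, vecMulVec_smul]
    rw [transpose_add, transpose_smul, transpose_vecMulVec, Matrix.add_mul, Matrix.mul_add,
      Matrix.mul_add, hQ, Matrix.mul_smul, Matrix.smul_mul, Matrix.smul_mul, Matrix.mul_smul, h3,
      h4, h5]
    ext i j
    simp only [Matrix.add_apply, Matrix.smul_apply, vecMulVec_apply, mul_apply, Fin.sum_univ_two, P, R, of_apply,
      smul_eq_mul, cons_val_zero, cons_val_one, Pi.add_apply, Pi.smul_apply]
    ring
  have h6 : R * P = !![t * (a ⬝ᵥ b) + t ^ 2 * (u ⬝ᵥ u) * (b ⬝ᵥ b),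
      t * (t * (a ⬝ᵥ a) + t ^ 2 * (u ⬝ᵥ u) * (a ⬝ᵥ b)); b ⬝ᵥ b, t * (a ⬝ᵥ b)] := by
    ext i j
    fin_cases i <;> fin_cases j <;>
      simp only [P, R, mul_apply, of_apply, Fin.zero_eta, Fin.mk_one, cons_val_zero, cons_val_one,
        Pi.add_apply, Pi.smul_apply, smul_eq_mul, dotProduct, Finset.mul_sum,
        ← Finset.sum_add_distrib, cons_val', cons_val_fin_one] <;>
      refine Finset.sum_congr rfl fun l _ => ?_ <;> ring
  rw [gramDet, h1, h2, det_one_add_mul_comm, h6, det_fin_two]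
  simp only [Matrix.add_apply, one_apply, of_apply, cons_val', cons_val_zero, cons_val_one,
    cons_val_fin_one, Fin.isValue]
  simp
  ring

end Transvection

/-! ### A finite design of degree four -/

section Design

set_option linter.unusedSectionVars false

variable {ι : Type*} [Fintype ι] [DecidableEq ι]

/-- The sign vector attached to a Boolean vector. -/
def signVec (σ : ι → Bool) (i : ι) : ℝ := if σ i then 1 else -1

theorem signVec_mul_self (σ : ι → Bool) (i : ι) : signVec σ i * signVec σ i = 1 := by
  unfold signVec; split_ifs <;> norm_num

theorem flipAt_involutive (i : ι) :
    Function.Involutive fun σ : ι → Bool => Function.update σ i (!σ i) := fun σ => by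
  ext j; by_cases h : j = i <;> simp [h]

/-- Flip one coordinate of a Boolean vector. -/
def flipAt (i : ι) : Equiv.Perm (ι → Bool) :=
  Function.Involutive.toPerm _ (flipAt_involutive i)

theorem flipAt_apply (i : ι) (σ : ι → Bool) : flipAt i σ = Function.update σ i (!σ i) := rfl

theorem signVec_flipAt_same (i : ι) (σ : ι → Bool) : signVec (flipAt i σ) i = -signVec σ i := by
  simp only [signVec, flipAt_apply, Function.update_self]
  cases σ i <;> simp

theorem signVec_flipAt_of_ne {i j : ι} (h : j ≠ i) (σ : ι → Bool) :
    signVec (flipAt i σ) j = signVec σ j := by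
  simp [signVec, flipAt_apply, h]

/-- Flipping the sign `i` permutes the summands and negates the sum. -/
theorem sum_signVec_mul_eq_zero (i : ι) (F : (ι → Bool) → ℝ) (hF : ∀ σ, F (flipAt i σ) = F σ) :
    ∑ σ, signVec σ i * F σ = 0 := by
  have h := Equiv.sum_comp (flipAt i) fun σ => signVec σ i * F σ
  simp only [signVec_flipAt_same, hF, neg_mul, Finset.sum_neg_distrib] at h
  linarith

/-- The partial sums `∑ σ_i p_i`. -/
def signSum (s : Finset ι) (p : ι → ℝ) (σ : ι → Bool) : ℝ := ∑ i ∈ s, signVec σ i * p i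

theorem signSum_flipAt {s : Finset ι} {i : ι} (hi : i ∉ s) (p : ι → ℝ) (σ : ι → Bool) :
    signSum s p (flipAt i σ) = signSum s p σ :=
  Finset.sum_congr rfl fun j hj => by rw [signVec_flipAt_of_ne (ne_of_mem_of_not_mem hj hi)]

theorem sum_signSum_mul (s : Finset ι) (p q : ι → ℝ) :
    ∑ σ, signSum s p σ * signSum s q σ = Fintype.card (ι → Bool) * ∑ i ∈ s, p i * q i := by
  induction s using Finset.induction_on with
  | empty => simp [signSum]
  | insert i s hi ih =>
    have h1 := sum_signVec_mul_eq_zero i (fun σ => p i * signSum s q σ + q i * signSum s p σ)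
      (fun σ => by simp only [signSum_flipAt hi])
    have h2 : ∀ σ : ι → Bool, signSum (insert i s) p σ * signSum (insert i s) q σ =
        signSum s p σ * signSum s q σ + p i * q i +
          signVec σ i * (p i * signSum s q σ + q i * signSum s p σ) := by
      intro σ
      have := signVec_mul_self σ i
      have e : ∀ p : ι → ℝ, signSum (insert i s) p σ = signVec σ i * p i + signSum s p σ :=
        fun p => Finset.sum_insert hi
      rw [e, e]
      linear_combination (p i * q i) * this
    rw [Finset.sum_congr rfl fun σ _ => h2 σ, Finset.sum_add_distrib, Finset.sum_add_distrib, h1,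
      ih, Finset.sum_insert hi]
    simp only [Finset.sum_const, Finset.card_univ, nsmul_eq_mul]
    ring

/-- Fourth moments of random signs: Wick's formula with a diagonal correction, since the fourth
moment of a sign is `1` and not `3`. -/
theorem sum_signSum_mul_four (s : Finset ι) (p q r t : ι → ℝ) :
    ∑ σ, signSum s p σ * signSum s q σ * signSum s r σ * signSum s t σ =
      Fintype.card (ι → Bool) * ((∑ i ∈ s, p i * q i) * (∑ i ∈ s, r i * t i) +
        (∑ i ∈ s, p i * r i) * (∑ i ∈ s, q i * t i) + (∑ i ∈ s, p i * t i) * (∑ i ∈ s, q i * r i) -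
        2 * ∑ i ∈ s, p i * q i * r i * t i) := by
  induction s using Finset.induction_on with
  | empty => simp [signSum]
  | insert i s hi ih =>
    have h1 := sum_signVec_mul_eq_zero i
      (fun σ => p i * (signSum s q σ * signSum s r σ * signSum s t σ) +
        q i * (signSum s p σ * signSum s r σ * signSum s t σ) +
        r i * (signSum s p σ * signSum s q σ * signSum s t σ) +
        t i * (signSum s p σ * signSum s q σ * signSum s r σ) +
        p i * q i * r i * signSum s t σ + p i * q i * t i * signSum s r σ +
        p i * r i * t i * signSum s q σ + q i * r i * t i * signSum s p σ)
      (fun σ => by simp only [signSum_flipAt hi])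
    have h2 : ∀ σ : ι → Bool, signSum (insert i s) p σ * signSum (insert i s) q σ *
          signSum (insert i s) r σ * signSum (insert i s) t σ =
        signSum s p σ * signSum s q σ * signSum s r σ * signSum s t σ + p i * q i * r i * t i +
        ((p i * q i) * (signSum s r σ * signSum s t σ) +
          (p i * r i) * (signSum s q σ * signSum s t σ) +
          (p i * t i) * (signSum s q σ * signSum s r σ) +
          (q i * r i) * (signSum s p σ * signSum s t σ) +
          (q i * t i) * (signSum s p σ * signSum s r σ) +
          (r i * t i) * (signSum s p σ * signSum s q σ)) +
        signVec σ i * (p i * (signSum s q σ * signSum s r σ * signSum s t σ) +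
        q i * (signSum s p σ * signSum s r σ * signSum s t σ) +
        r i * (signSum s p σ * signSum s q σ * signSum s t σ) +
        t i * (signSum s p σ * signSum s q σ * signSum s r σ) +
        p i * q i * r i * signSum s t σ + p i * q i * t i * signSum s r σ +
        p i * r i * t i * signSum s q σ + q i * r i * t i * signSum s p σ) := by
      intro σ
      have hs := signVec_mul_self σ i
      have e : ∀ p : ι → ℝ, signSum (insert i s) p σ = signVec σ i * p i + signSum s p σ :=
        fun p => Finset.sum_insert hi
      rw [e, e, e, e]
      generalize signVec σ i = x at *
      generalize signSum s p σ = P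
      generalize signSum s q σ = Q
      generalize signSum s r σ = R
      generalize signSum s t σ = T
      linear_combination (p i * q i * r i * t i * (x * x + 1) +
        x * (p i * q i * r i * T + p i * q i * t i * R + p i * r i * t i * Q + q i * r i * t i * P) +
        (p i * q i * R * T + p i * r i * Q * T + p i * t i * Q * R + q i * r i * P * T +
          q i * t i * P * R + r i * t i * P * Q)) * hs
    rw [Finset.sum_congr rfl fun σ _ => h2 σ]
    simp only [Finset.sum_add_distrib, ← Finset.mul_sum, sum_signSum_mul] at h1 ⊢
    rw [h1, ih]
    simp only [Finset.sum_insert hi, Finset.sum_const, Finset.card_univ, nsmul_eq_mul]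
    ring

/-- The points of the design: the sign vectors and the coordinate vectors. -/
def designVec : (ι → Bool) ⊕ ι → ι → ℝ := Sum.elim signVec fun i => Pi.single i 1

/-- The weights of the design. -/
def designWeight : (ι → Bool) ⊕ ι → ℝ :=
  Sum.elim (fun _ => (Fintype.card (ι → Bool) : ℝ)⁻¹) fun _ => 2

theorem designWeight_pos (j : (ι → Bool) ⊕ ι) : 0 < designWeight j := by
  rcases j with j | j
  · exact inv_pos.2 (by exact_mod_cast Fintype.card_pos)
  · exact two_pos

theorem abs_designVec_le (j : (ι → Bool) ⊕ ι) (i : ι) : |designVec j i| ≤ 1 := by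
  rcases j with j | j
  · simp only [designVec, Sum.elim_inl, signVec]; split_ifs <;> norm_num
  · simp only [designVec, Sum.elim_inr, Pi.single_apply]; split_ifs <;> norm_num

/-- The coordinate vectors with weight `2` cancel the diagonal correction of the sign vectors, so
the finite design has exactly the Gaussian fourth moments. -/
theorem sum_design (p q r t : ι → ℝ) :
    ∑ j, designWeight j * ((designVec j ⬝ᵥ p) * (designVec j ⬝ᵥ q) * (designVec j ⬝ᵥ r) *
      (designVec j ⬝ᵥ t)) =
    (p ⬝ᵥ q) * (r ⬝ᵥ t) + (p ⬝ᵥ r) * (q ⬝ᵥ t) + (p ⬝ᵥ t) * (q ⬝ᵥ r) := by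
  have hN : (Fintype.card (ι → Bool) : ℝ) ≠ 0 := by exact_mod_cast Fintype.card_ne_zero
  have h := sum_signSum_mul_four Finset.univ p q r t
  rw [Fintype.sum_sum_type]
  simp only [designWeight, designVec, Sum.elim_inl, Sum.elim_inr, single_one_dotProduct]
  rw [← Finset.mul_sum, ← Finset.mul_sum]
  have h' : ∑ σ : ι → Bool, (signVec σ ⬝ᵥ p) * (signVec σ ⬝ᵥ q) * (signVec σ ⬝ᵥ r) *
      (signVec σ ⬝ᵥ t) = _ := h
  rw [h', inv_mul_cancel_left₀ hN]
  simp only [dotProduct]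
  ring

end Design

/-! ### A second order expansion -/

section Expansion

/-- Second order Taylor bound for `(1 + τ) ^ (-s)` with explicit cubic error. The bound `|τ| ≤ 1 /
2` controls the logarithm, and `2 s |τ| ≤ 1` keeps the exponent in the range of the exponential
estimate. -/
theorem exp_neg_mul_log_le {s τ : ℝ} (hs : 0 ≤ s) (hτ : |τ| ≤ 1 / 2) (hsτ : 2 * s * |τ| ≤ 1) :
    Real.exp (-s * Real.log (1 + τ)) ≤
      1 - s * τ + s * (s + 1) / 2 * τ ^ 2 + (2 * s + 3 * s ^ 2 + 8 * s ^ 3) * |τ| ^ 3 := by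
  have hlog : τ - τ ^ 2 / 2 - 2 * |τ| ^ 3 ≤ Real.log (1 + τ) := by
    have h1 : |τ| ^ (2 + 1) / (1 - |τ|) ≤ 2 * |τ| ^ 3 := by
      rw [div_le_iff₀ (by linarith), ← sub_nonneg]
      have h5 : 2 * |τ| ^ 3 * (1 - |τ|) - |τ| ^ (2 + 1) = 2 * (|τ| ^ 3 * (1 / 2 - |τ|)) := by ring
      rw [h5]
      exact mul_nonneg zero_le_two (mul_nonneg (pow_nonneg (abs_nonneg τ) 3) (sub_nonneg.2 hτ))
    have h := Real.abs_log_sub_add_sum_range_le (x := -τ) (by rw [abs_neg]; linarith) 2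
    simp only [Finset.sum_range_succ, Finset.sum_range_zero, abs_neg, sub_neg_eq_add] at h
    have h2 := neg_abs_le (0 + (-τ) ^ (0 + 1) / ((0 : ℕ) + 1 : ℝ) + (-τ) ^ (1 + 1) / ((1 : ℕ) + 1 : ℝ) +
      Real.log (1 + τ))
    have h3 : (0 + (-τ) ^ (0 + 1) / ((0 : ℕ) + 1 : ℝ) + (-τ) ^ (1 + 1) / ((1 : ℕ) + 1 : ℝ) +
      Real.log (1 + τ)) = -τ + τ ^ 2 / 2 + Real.log (1 + τ) := by
      push_cast; ring
    rw [h3] at h h2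
    linarith
  set y := |τ| with hy
  have hy0 : 0 ≤ y := abs_nonneg _
  have hτ2 : τ ^ 2 = y ^ 2 := (sq_abs τ).symm
  set Y := -s * τ + s * τ ^ 2 / 2 + 2 * s * y ^ 3 with hY
  have hle : -s * Real.log (1 + τ) ≤ Y := by
    rw [hY]; nlinarith
  have e1 : |s * τ ^ 2 / 2 + 2 * s * y ^ 3| ≤ 3 / 2 * s * y ^ 2 := by
    rw [abs_of_nonneg (by positivity), hτ2]
    nlinarith [mul_nonneg hs (sq_nonneg y)]
  have e1' : |s * τ ^ 2 / 2 + 2 * s * y ^ 3| ≤ s * y := by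
    refine e1.trans ?_
    nlinarith [mul_nonneg hs hy0]
  have e2 : |-s * τ| = s * y := by rw [abs_mul, abs_neg, abs_of_nonneg hs]
  have hYa : |Y| ≤ 2 * s * y := by
    calc |Y| = |-s * τ + (s * τ ^ 2 / 2 + 2 * s * y ^ 3)| := by rw [hY, add_assoc]
      _ ≤ |-s * τ| + |s * τ ^ 2 / 2 + 2 * s * y ^ 3| := abs_add_le _ _
      _ ≤ _ := by rw [e2]; linarith
  have hexp := Real.exp_bound (x := Y) (hYa.trans hsτ) (n := 3) (by norm_num)
  simp only [Finset.sum_range_succ, Finset.sum_range_zero, Nat.factorial] at hexp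
  have hexp' := (le_abs_self _).trans hexp
  norm_num at hexp'
  have hY3 : |Y| ^ 3 ≤ 8 * s ^ 3 * y ^ 3 := by
    calc |Y| ^ 3 ≤ (2 * s * y) ^ 3 := by gcongr
      _ = _ := by ring
  have hY2 : Y ^ 2 ≤ s ^ 2 * τ ^ 2 + 6 * s ^ 2 * y ^ 3 := by
    have h1 : Y ^ 2 - s ^ 2 * τ ^ 2 = (s * τ ^ 2 / 2 + 2 * s * y ^ 3) * (Y + -s * τ) := by
      rw [hY]; ring
    have h2 : |Y + -s * τ| ≤ 3 * s * y := (abs_add_le _ _).trans (by rw [e2]; linarith)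
    have h3 : (s * τ ^ 2 / 2 + 2 * s * y ^ 3) * (Y + -s * τ) ≤ 3 / 2 * s * y ^ 2 * (3 * s * y) := by
      refine (le_abs_self _).trans ?_
      rw [abs_mul]
      gcongr
    nlinarith [mul_nonneg (sq_nonneg s) (pow_nonneg hy0 3)]
  have hfin : Real.exp Y ≤ 1 + Y + Y ^ 2 / 2 + |Y| ^ 3 := by
    nlinarith [pow_nonneg (abs_nonneg Y) 3]
  refine (Real.exp_le_exp.2 hle).trans (hfin.trans ?_)
  rw [hY] at hY2 ⊢
  nlinarith

theorem inv_sqrt_pow_eq_exp {τ : ℝ} (hτ : |τ| ≤ 1 / 2) (d : ℕ) :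
    (√(1 + τ))⁻¹ ^ d = Real.exp (-(d / 2) * Real.log (1 + τ)) := by
  have h1 : 0 < 1 + τ := by linarith [neg_abs_le τ]
  have h2 : √(1 + τ) = Real.exp (Real.log (1 + τ) / 2) := by
    rw [← Real.log_sqrt h1.le, Real.exp_log (Real.sqrt_pos.2 h1)]
  rw [h2, ← Real.exp_neg, ← Real.exp_nat_mul]
  congr 1
  ring

set_option maxHeartbeats 800000 in
/-- The second order expansion of the symmetrized inverse volume. -/
theorem exists_symmetrized_le (d : ℕ) (B : ℝ) (hB : 0 ≤ B) : ∃ C ε₀ : ℝ, 0 ≤ C ∧ 0 < ε₀ ∧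
    ∀ x z ε : ℝ, |x| ≤ B → |z| ≤ B → 0 < ε → ε ≤ ε₀ →
      (√((1 + ε * x) ^ 2 + ε ^ 2 * z))⁻¹ ^ d + (√((1 + -ε * x) ^ 2 + (-ε) ^ 2 * z))⁻¹ ^ d ≤
        2 + d * ε ^ 2 * ((d + 1) * x ^ 2 - z) + C * ε ^ 3 := by
  obtain ⟨s, hs⟩ : ∃ s : ℝ, s = d / 2 := ⟨_, rfl⟩
  have hs0 : 0 ≤ s := by rw [hs]; positivity
  -- `ε B'` bounds the perturbation `τ = 2 t x + t² (x² + z)` for `|t| = ε ≤ 1`.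
  obtain ⟨B', hB'⟩ : ∃ B' : ℝ, B' = 2 * B + (B ^ 2 + B) + 1 := ⟨_, rfl⟩
  have hB'1 : 1 ≤ B' := by nlinarith
  obtain ⟨K, hK⟩ : ∃ K : ℝ, K = 2 * s + 3 * s ^ 2 + 8 * s ^ 3 := ⟨_, rfl⟩
  have hK0 : 0 ≤ K := by rw [hK]; positivity
  refine ⟨s * (s + 1) * (B ^ 2 + B) ^ 2 + 2 * K * B' ^ 3, min 1 (1 / ((2 + 2 * s) * B')),
    by positivity, by positivity, fun x z ε hx hz hε hε₀ => ?_⟩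
  have hε1 : ε ≤ 1 := hε₀.trans (min_le_left _ _)
  -- This single condition yields both `|τ| ≤ 1 / 2` and `2 s |τ| ≤ 1`.
  have hε2 : ε * B' * (2 + 2 * s) ≤ 1 := by
    have := hε₀.trans (min_le_right _ _)
    rw [le_div_iff₀ (by positivity)] at this
    linarith
  have hx2 : x ^ 2 ≤ B ^ 2 := sq_le_sq' (by linarith [neg_abs_le x]) ((le_abs_self x).trans hx)
  have hxz : |x ^ 2 + z| ≤ B ^ 2 + B := by
    refine (abs_add_le _ _).trans ?_
    rw [abs_of_nonneg (sq_nonneg x)]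
    linarith
  have key : ∀ t : ℝ, |t| = ε → |2 * t * x + t ^ 2 * (x ^ 2 + z)| ≤ ε * B' := by
    intro t ht
    have h1 : |2 * t * x| ≤ ε * (2 * B) := by
      rw [abs_mul, abs_mul, ht, abs_two]
      nlinarith
    have h2 : |t ^ 2 * (x ^ 2 + z)| ≤ ε * (B ^ 2 + B) := by
      rw [abs_mul, abs_pow, ht]
      have : ε ^ 2 ≤ ε := by nlinarith
      gcongr
    refine (abs_add_le _ _).trans ?_
    rw [hB']
    nlinarith
  have one : ∀ t : ℝ, |t| = ε → (√((1 + t * x) ^ 2 + t ^ 2 * z))⁻¹ ^ d ≤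
      1 - s * (2 * t * x + t ^ 2 * (x ^ 2 + z)) +
        s * (s + 1) / 2 * (2 * t * x + t ^ 2 * (x ^ 2 + z)) ^ 2 + K * (ε * B') ^ 3 := by
    intro t ht
    have hk := key t ht
    obtain ⟨τ, hτ⟩ : ∃ τ, τ = 2 * t * x + t ^ 2 * (x ^ 2 + z) := ⟨_, rfl⟩
    rw [← hτ] at hk ⊢
    have h1 : (1 + t * x) ^ 2 + t ^ 2 * z = 1 + τ := by rw [hτ]; ring
    have hp : 0 ≤ ε * B' := by positivity
    have h2 : |τ| ≤ 1 / 2 := by nlinarith [mul_nonneg hp hs0]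
    rw [h1, inv_sqrt_pow_eq_exp h2, ← hs, hK]
    rw [hK] at hK0
    refine (exp_neg_mul_log_le hs0 h2 (by nlinarith [mul_le_mul_of_nonneg_left hk hs0])).trans ?_
    have : |τ| ^ 3 ≤ (ε * B') ^ 3 := by gcongr
    linarith [mul_le_mul_of_nonneg_left this hK0]
  have hp := one ε (abs_of_pos hε)
  have hm := one (-ε) (by rw [abs_neg, abs_of_pos hε])
  have h4 : ε ^ 4 * (x ^ 2 + z) ^ 2 ≤ ε ^ 3 * (B ^ 2 + B) ^ 2 := by
    have h5 : (x ^ 2 + z) ^ 2 ≤ (B ^ 2 + B) ^ 2 := by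
      rw [← sq_abs (x ^ 2 + z)]; gcongr
    have h6 : ε ^ 4 ≤ ε ^ 3 := pow_le_pow_of_le_one hε.le hε1 (by norm_num)
    gcongr
  have h7 := mul_le_mul_of_nonneg_left h4 (by positivity : 0 ≤ s * (s + 1))
  have hd : (d : ℝ) = 2 * s := by rw [hs]; ring
  refine (add_le_add hp hm).trans ?_
  rw [hd]
  -- The terms odd in `ε` cancel between `ε` and `-ε`.
  have e : (1 - s * (2 * ε * x + ε ^ 2 * (x ^ 2 + z)) + s * (s + 1) / 2 * (2 * ε * x + ε ^ 2 *
      (x ^ 2 + z)) ^ 2 + K * (ε * B') ^ 3) + (1 - s * (2 * -ε * x + (-ε) ^ 2 * (x ^ 2 + z)) +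
      s * (s + 1) / 2 * (2 * -ε * x + (-ε) ^ 2 * (x ^ 2 + z)) ^ 2 + K * (ε * B') ^ 3) =
      2 + 2 * s * ε ^ 2 * ((2 * s + 1) * x ^ 2 - z) +
        s * (s + 1) * (ε ^ 4 * (x ^ 2 + z) ^ 2) + 2 * K * B' ^ 3 * ε ^ 3 := by ring
  rw [e]
  linarith

end Expansion

/-! ### Contraction of inverse volumes of isotropic frames -/

section Contraction

variable {d : ℕ}

/-- The volume spanned by the columns of a matrix. -/
def vol {ι κ : Type*} [Fintype ι] [Fintype κ] [DecidableEq κ] (B : Matrix ι κ ℝ) : ℝ := √(gramDet B)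

variable {k : ℕ} {Q : Matrix (Fin d ⊕ Fin d) (Fin k) ℝ}

theorem transpose_J_mul_J : (J (Fin d) ℝ)ᵀ * J (Fin d) ℝ = 1 := by
  rw [J_transpose, Matrix.neg_mul, J_squared, neg_neg]

theorem orthonormal_J_mul (hQ : Qᵀ * Q = 1) : (J (Fin d) ℝ * Q)ᵀ * (J (Fin d) ℝ * Q) = 1 := by
  rw [transpose_mul, Matrix.mul_assoc, ← Matrix.mul_assoc _ _ Q, transpose_J_mul_J, Matrix.one_mul, hQ]

/-- For isotropic orthonormal `Q`, the columns of `Q` and `J Q` together are orthonormal in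
dimension `2 d`. -/
theorem two_mul_card_le_of_isotropic (hQ : Qᵀ * Q = 1) (hJ : Qᵀ * J (Fin d) ℝ * Q = 0) : k ≤ d := by
  have h1 : (fromCols Q (J (Fin d) ℝ * Q))ᵀ * fromCols Q (J (Fin d) ℝ * Q) = 1 := by
    have h2 : (J (Fin d) ℝ * Q)ᵀ * Q = 0 := by
      have := congrArg transpose hJ
      rw [transpose_mul, transpose_mul, transpose_transpose, transpose_zero] at this
      rw [transpose_mul, Matrix.mul_assoc, this]
    rw [transpose_fromCols, fromRows_mul_fromCols, hQ, orthonormal_J_mul hQ, h2, ← Matrix.mul_assoc,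
      hJ, fromBlocks_one]
  have := card_le_of_orthonormal h1
  simp only [Fintype.card_sum, Fintype.card_fin] at this
  omega

theorem col_dotProduct_col {ι κ κ' : Type*} [Fintype ι] (A : Matrix ι κ ℝ) (B : Matrix ι κ' ℝ)
    (i : κ) (j : κ') : A.col i ⬝ᵥ B.col j = (Aᵀ * B) i j := rfl

/-- Expands both scalar products over columns and applies the fourth moment identity `sum_design`
termwise. -/
theorem sum_design_mul_self {κ κ' ι : Type*} [Fintype ι] [DecidableEq ι] [Fintype κ] [Fintype κ']
    (A : Matrix ι κ ℝ) (B : Matrix ι κ ℝ) (C : Matrix ι κ' ℝ) (D : Matrix ι κ' ℝ) :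
    ∑ j, designWeight j * (((designVec j ᵥ* A) ⬝ᵥ (designVec j ᵥ* B)) *
      ((designVec j ᵥ* C) ⬝ᵥ (designVec j ᵥ* D))) =
    ∑ a, ∑ c, ((Aᵀ * B) a a * (Cᵀ * D) c c + (Aᵀ * C) a c * (Bᵀ * D) a c +
      (Aᵀ * D) a c * (Bᵀ * C) a c) := by
  have h1 : ∀ j : (ι → Bool) ⊕ ι, designWeight j * (((designVec j ᵥ* A) ⬝ᵥ (designVec j ᵥ* B)) *
      ((designVec j ᵥ* C) ⬝ᵥ (designVec j ᵥ* D))) = ∑ a, ∑ c, designWeight j *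
      ((designVec j ⬝ᵥ A.col a) * (designVec j ⬝ᵥ B.col a) * (designVec j ⬝ᵥ C.col c) *
        (designVec j ⬝ᵥ D.col c)) := by
    intro j
    have h2 : ((designVec j ᵥ* A) ⬝ᵥ (designVec j ᵥ* B)) * ((designVec j ᵥ* C) ⬝ᵥ (designVec j ᵥ* D)) =
        (∑ a, (designVec j ⬝ᵥ A.col a) * (designVec j ⬝ᵥ B.col a)) *
          ∑ c, (designVec j ⬝ᵥ C.col c) * (designVec j ⬝ᵥ D.col c) := rfl
    rw [h2, Finset.sum_mul_sum, Finset.mul_sum]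
    refine Finset.sum_congr rfl fun a _ => ?_
    rw [Finset.mul_sum]
    exact Finset.sum_congr rfl fun c _ => by ring
  simp_rw [h1]
  rw [Finset.sum_comm]
  refine Finset.sum_congr rfl fun a _ => ?_
  rw [Finset.sum_comm]
  refine Finset.sum_congr rfl fun c _ => ?_
  rw [sum_design]
  simp only [col_dotProduct_col]

/-- The quadratic coefficient in the expansion of the average inverse volume. -/
theorem sum_design_quadratic (hQ : Qᵀ * Q = 1) (hJ : Qᵀ * J (Fin d) ℝ * Q = 0) :
    ∑ j, designWeight j * (((d : ℝ) + 1) * ((designVec j ᵥ* Q) ⬝ᵥ (designVec j ᵥ* (J (Fin d) ℝ * Q))) ^ 2 -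
      ((designVec j ᵥ* (J (Fin d) ℝ * Q)) ⬝ᵥ (designVec j ᵥ* (J (Fin d) ℝ * Q))) *
        (designVec j ⬝ᵥ designVec j - (designVec j ᵥ* Q) ⬝ᵥ (designVec j ᵥ* Q))) =
      -(k * (d + 1 - k) : ℝ) := by
  set R := J (Fin d) ℝ * Q with hR
  have hQR : Qᵀ * R = 0 := by rw [hR, ← Matrix.mul_assoc, hJ]
  have hRQ : Rᵀ * Q = 0 := by simpa using congrArg transpose hQR
  have hRR : Rᵀ * R = 1 := orthonormal_J_mul hQ
  -- The three moments are `k`, `2 d k + 2 k` and `k²`, and `(d + 1) k - (2 d k + 2 k) + k² = -k (d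
  -- + 1 - k)`.
  have e1 := sum_design_mul_self Q R Q R
  have e2 := sum_design_mul_self R R (1 : Matrix (Fin d ⊕ Fin d) (Fin d ⊕ Fin d) ℝ) 1
  have e3 := sum_design_mul_self R R Q Q
  have hk : ∑ a : Fin k, ∑ c : Fin k, (1 : Matrix (Fin k) (Fin k) ℝ) a c *
      (1 : Matrix (Fin k) (Fin k) ℝ) a c = k := by
    simp [one_apply]
  have hRk : ∑ a : Fin k, ∑ c, Rᵀ a c * Rᵀ a c = k := by
    have : ∀ a : Fin k, ∑ c, Rᵀ a c * Rᵀ a c = 1 := fun a => by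
      have := congrFun (congrFun hRR a) a
      simpa [mul_apply] using this
    rw [Finset.sum_congr rfl fun a _ => this a]
    simp
  simp only [hQR, hRQ, hRR, hQ, Matrix.zero_apply, mul_zero, zero_add, add_zero, hk] at e1
  simp only [hRR, Matrix.transpose_one, Matrix.mul_one, Matrix.one_apply_eq, vecMul_one,
    Finset.sum_add_distrib, hRk, Finset.sum_const, Finset.card_univ, nsmul_eq_mul, Fintype.card_sum,
    Fintype.card_fin] at e2
  simp only [hRR, hRQ, hQ, Matrix.one_apply_eq, Matrix.zero_apply, mul_zero, add_zero,
    Finset.sum_const, Finset.card_univ, nsmul_eq_mul, Fintype.card_fin] at e3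
  have h : ∀ j : (Fin d ⊕ Fin d → Bool) ⊕ (Fin d ⊕ Fin d),
      designWeight j * (((d : ℝ) + 1) * ((designVec j ᵥ* Q) ⬝ᵥ (designVec j ᵥ* R)) ^ 2 -
      ((designVec j ᵥ* R) ⬝ᵥ (designVec j ᵥ* R)) *
        (designVec j ⬝ᵥ designVec j - (designVec j ᵥ* Q) ⬝ᵥ (designVec j ᵥ* Q))) =
      ((d : ℝ) + 1) * (designWeight j * (((designVec j ᵥ* Q) ⬝ᵥ (designVec j ᵥ* R)) *
        ((designVec j ᵥ* Q) ⬝ᵥ (designVec j ᵥ* R)))) -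
      designWeight j * (((designVec j ᵥ* R) ⬝ᵥ (designVec j ᵥ* R)) *
        (designVec j ⬝ᵥ designVec j)) +
      designWeight j * (((designVec j ᵥ* R) ⬝ᵥ (designVec j ᵥ* R)) *
        ((designVec j ᵥ* Q) ⬝ᵥ (designVec j ᵥ* Q))) := fun j => by ring
  rw [Finset.sum_congr rfl fun j _ => h j, Finset.sum_add_distrib, Finset.sum_sub_distrib,
    ← Finset.mul_sum, e1, e2, e3]
  push_cast
  ring

theorem abs_vecMul_le {ι κ : Type*} [Fintype ι] [DecidableEq ι] [Fintype κ] [DecidableEq κ]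
    {Q : Matrix ι κ ℝ} (hQ : Qᵀ * Q = 1) {u : ι → ℝ}
    (hu : ∀ i, |u i| ≤ 1) (j : κ) : |(u ᵥ* Q) j| ≤ Fintype.card ι := by
  calc |(u ᵥ* Q) j| ≤ ∑ i, |u i * Q i j| := Finset.abs_sum_le_sum_abs _ _
    _ ≤ ∑ _i : ι, (1 : ℝ) := by
      refine Finset.sum_le_sum fun i _ => ?_
      rw [abs_mul]
      exact mul_le_one₀ (hu i) (abs_nonneg _) (abs_apply_le_one_of_orthonormal hQ i j)
    _ = _ := by simp

theorem abs_dotProduct_le {κ : Type*} [Fintype κ] {a b : κ → ℝ} {A : ℝ}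
    (ha : ∀ j, |a j| ≤ A) (hb : ∀ j, |b j| ≤ A) : |a ⬝ᵥ b| ≤ Fintype.card κ * (A * A) := by
  calc |a ⬝ᵥ b| ≤ ∑ j, |a j * b j| := Finset.abs_sum_le_sum_abs _ _
    _ ≤ ∑ _j : κ, A * A := by
      refine Finset.sum_le_sum fun j _ => ?_
      rw [abs_mul]
      exact mul_le_mul (ha j) (hb j) (abs_nonneg _) ((abs_nonneg _).trans (ha j))
    _ = _ := by simp

/-- Transvections along the design vectors with parameters `±ε` are averaged. The first order terms
cancel, and the weighted second order term is `-d ε² k (d + 1 - k) ≤ -ε²`, because isotropy gives `1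
≤ k ≤ d`. -/
theorem exists_contraction_orthonormal (hd : 1 ≤ d) :
    ∃ (I : Type) (_ : Fintype I) (w : I → ℝ) (g : I → Sp d) (c : ℝ), (∀ i, 0 ≤ w i) ∧
      ∑ i, w i = 1 ∧ 0 ≤ c ∧ c < 1 ∧ ∀ {k : ℕ} (Q : Matrix (Fin d ⊕ Fin d) (Fin k) ℝ), 1 ≤ k →
        Qᵀ * Q = 1 → Qᵀ * J (Fin d) ℝ * Q = 0 → ∑ i, w i * (vol ((g i).1 * Q))⁻¹ ^ d ≤ c := by
  let D := (Fin d ⊕ Fin d → Bool) ⊕ (Fin d ⊕ Fin d)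
  set n : ℝ := ((Fintype.card (Fin d ⊕ Fin d) : ℕ) : ℝ) with hn
  have hn0 : 0 ≤ n := by positivity
  set B : ℝ := n * (n * n) + n * (n * n) * (n * (1 * 1) + n * (n * n)) with hB
  have hB0 : 0 ≤ B := by positivity
  obtain ⟨C, ε₀, hC, hε₀, key⟩ := exists_symmetrized_le d B hB0
  set W : ℝ := ∑ j : D, designWeight j with hW
  have hWpos : 0 < W := by
    have : Nonempty D := ⟨Sum.inl fun _ => true⟩
    exact Finset.sum_pos (fun j _ => designWeight_pos j) Finset.univ_nonempty
  have hdpos : (1 : ℝ) ≤ d := by exact_mod_cast hd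
  -- With this `ε` the total cubic error is at most `ε² / 2`, half of the second order gain.
  obtain ⟨ε, hε, hε1, hε2⟩ : ∃ ε : ℝ, 0 < ε ∧ ε ≤ ε₀ ∧ C * W * ε ≤ 1 / 2 := by
    refine ⟨min ε₀ (1 / (2 * (C * W + 1))), by positivity, min_le_left _ _, ?_⟩
    have h1 : C * W * min ε₀ (1 / (2 * (C * W + 1))) ≤ C * W * (1 / (2 * (C * W + 1))) := by
      gcongr; exact min_le_right _ _
    refine h1.trans ?_
    rw [mul_one_div, div_le_iff₀ (by positivity)]
    nlinarith [mul_nonneg hC hWpos.le]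
  have main : ∀ {k : ℕ} (Q : Matrix (Fin d ⊕ Fin d) (Fin k) ℝ), 1 ≤ k → Qᵀ * Q = 1 →
      Qᵀ * J (Fin d) ℝ * Q = 0 → ∑ j : D, designWeight j *
        ((vol ((transv (designVec j) ε).1 * Q))⁻¹ ^ d +
          (vol ((transv (designVec j) (-ε)).1 * Q))⁻¹ ^ d) ≤ 2 * W - ε ^ 2 / 2 := by
    intro k Q hk hQ hJ
    have hkd : k ≤ d := two_mul_card_le_of_isotropic hQ hJ
    have hkn : (k : ℝ) ≤ n := by
      rw [hn]; simp only [Fintype.card_sum, Fintype.card_fin]; exact_mod_cast (by omega)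
    have hpt : ∀ j : D, (vol ((transv (designVec j) ε).1 * Q))⁻¹ ^ d +
        (vol ((transv (designVec j) (-ε)).1 * Q))⁻¹ ^ d ≤
        2 + d * ε ^ 2 * (((d : ℝ) + 1) *
          ((designVec j ᵥ* Q) ⬝ᵥ (designVec j ᵥ* (J (Fin d) ℝ * Q))) ^ 2 -
          ((designVec j ᵥ* (J (Fin d) ℝ * Q)) ⬝ᵥ (designVec j ᵥ* (J (Fin d) ℝ * Q))) *
          (designVec j ⬝ᵥ designVec j - (designVec j ᵥ* Q) ⬝ᵥ (designVec j ᵥ* Q))) + C * ε ^ 3 := by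
      intro j
      have hu := abs_designVec_le j
      have ha := abs_vecMul_le hQ hu
      have hb := abs_vecMul_le (orthonormal_J_mul hQ) hu
      have huu := abs_dotProduct_le hu hu
      have hab := abs_dotProduct_le ha hb
      have hbb := abs_dotProduct_le hb hb
      have haa := abs_dotProduct_le ha ha
      simp only [Fintype.card_fin] at hab hbb haa
      rw [← hn] at hab hbb haa huu
      have hkn' : (k : ℝ) * (n * n) ≤ n * (n * n) := by gcongr
      unfold vol
      rw [gramDet_transv_mul hQ, gramDet_transv_mul hQ]
      refine key _ _ ε ?_ ?_ hε hε1
      · refine (hab.trans hkn').trans ?_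
        rw [hB]
        have : 0 ≤ n * (n * n) * (n * (1 * 1) + n * (n * n)) := by positivity
        linarith
      · rw [abs_mul]
        have h2 : |designVec j ⬝ᵥ designVec j - (designVec j ᵥ* Q) ⬝ᵥ (designVec j ᵥ* Q)| ≤
            n * (1 * 1) + n * (n * n) := by
          refine (abs_sub _ _).trans ?_
          linarith
        have h3 := mul_le_mul (hbb.trans hkn') h2 (abs_nonneg _) (by positivity)
        refine h3.trans ?_
        rw [hB]
        have : 0 ≤ n * (n * n) := by positivity
        linarith
    have hsum := Finset.sum_le_sum fun (j : D) (_ : j ∈ Finset.univ) =>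
      mul_le_mul_of_nonneg_left (hpt j) (designWeight_pos j).le
    refine hsum.trans ?_
    have hq := sum_design_quadratic hQ hJ
    have hexpand : ∀ (y : D → ℝ), ∑ j : D, designWeight j * (2 + d * ε ^ 2 * y j + C * ε ^ 3) =
        2 * W + d * ε ^ 2 * ∑ j : D, designWeight j * y j + W * (C * ε ^ 3) := by
      intro y
      rw [hW, Finset.mul_sum, Finset.mul_sum, Finset.sum_mul, ← Finset.sum_add_distrib,
        ← Finset.sum_add_distrib]
      exact Finset.sum_congr rfl fun j _ => by ring
    rw [hexpand, hq]
    have hk1 : (1 : ℝ) ≤ k := by exact_mod_cast hk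
    have hkd' : (k : ℝ) ≤ d := by exact_mod_cast hkd
    have h1 : (1 : ℝ) ≤ d * (k * (d + 1 - k)) := by
      have : (1 : ℝ) ≤ k * (d + 1 - k) := by nlinarith
      nlinarith
    have h2 : W * (C * ε ^ 3) ≤ ε ^ 2 / 2 := by
      have := mul_le_mul_of_nonneg_left hε2 (sq_nonneg ε)
      nlinarith
    have h3 := mul_le_mul_of_nonneg_left h1 (sq_nonneg ε)
    nlinarith
  have hvolnn : ∀ {k : ℕ} (B : Matrix (Fin d ⊕ Fin d) (Fin k) ℝ), 0 ≤ (vol B)⁻¹ ^ d :=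
    fun B => pow_nonneg (inv_nonneg.2 (Real.sqrt_nonneg _)) _
  refine ⟨D × Bool, inferInstance, fun i => designWeight i.1 / (2 * W),
    fun i => transv (designVec i.1) (if i.2 then ε else -ε), max 0 ((2 * W - ε ^ 2 / 2) / (2 * W)),
    fun i => div_nonneg (designWeight_pos _).le (by positivity), ?_, le_max_left _ _, ?_, ?_⟩
  · rw [Fintype.sum_prod_type]
    simp only [Fintype.sum_bool, ← Finset.sum_div, Finset.sum_add_distrib]
    rw [← hW, div_eq_one_iff_eq (by positivity)]
    ring
  · refine max_lt one_pos ?_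
    rw [div_lt_one (by positivity)]
    nlinarith [sq_pos_of_pos hε]
  · intro k Q hk hQ hJ
    refine le_trans ?_ (le_max_right _ _)
    rw [Fintype.sum_prod_type, le_div_iff₀ (by positivity)]
    refine le_trans (le_of_eq ?_) (main Q hk hQ hJ)
    rw [Finset.sum_mul]
    refine Finset.sum_congr rfl fun j _ => ?_
    simp only [Fintype.sum_bool]
    have : 2 * W ≠ 0 := by positivity
    field_simp
    simp

/-- There is a finitely supported averaging operator on `Sp(2d, ℝ)` which contracts the `d`-th
powers of the inverse volumes of all isotropic frames. -/
theorem exists_contraction (hd : 1 ≤ d) :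
    ∃ (I : Type) (_ : Fintype I) (w : I → ℝ) (g : I → Sp d) (c : ℝ), (∀ i, 0 ≤ w i) ∧
      ∑ i, w i = 1 ∧ 0 ≤ c ∧ c < 1 ∧ ∀ {k : ℕ} (B : Matrix (Fin d ⊕ Fin d) (Fin k) ℝ), 1 ≤ k →
        gramDet B ≠ 0 → Bᵀ * J (Fin d) ℝ * B = 0 →
        ∃ r : I → ℝ, (∀ i, 0 ≤ r i) ∧ ∑ i, w i * r i ≤ c ∧
          ∀ (A : Matrix (Fin k) (Fin k) ℝ) (i : I),
            (vol ((g i).1 * (B * A)))⁻¹ ^ d = r i * (vol (B * A))⁻¹ ^ d := by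
  obtain ⟨I, hI, w, g, c, hw, hw1, hc0, hc1, h⟩ := exists_contraction_orthonormal hd
  refine ⟨I, hI, w, g, c, hw, hw1, hc0, hc1, fun {k} B hk hB hJ => ?_⟩
  obtain ⟨Q, C, rfl, hQ, -, D, hD⟩ := exists_orthonormal_mul hB
  have hJ' : Qᵀ * J (Fin d) ℝ * Q = 0 := by
    calc Qᵀ * J (Fin d) ℝ * Q = (Q * C * D)ᵀ * J (Fin d) ℝ * (Q * C * D) := by rw [← hD]
      _ = Dᵀ * ((Q * C)ᵀ * J (Fin d) ℝ * (Q * C)) * D := by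
        simp only [transpose_mul, Matrix.mul_assoc]
      _ = 0 := by rw [hJ]; simp
  -- The distortion factor depends only on the real column span, so every frame `B * A` in that span
  -- gets the same `r i`.
  refine ⟨fun i => (vol ((g i).1 * Q))⁻¹ ^ d,
    fun i => pow_nonneg (inv_nonneg.2 (Real.sqrt_nonneg _)) _, h Q hk hQ hJ', fun A i => ?_⟩
  have h1 : gramDet Q = 1 := by rw [gramDet, hQ, det_one]
  unfold vol
  rw [Matrix.mul_assoc Q, ← Matrix.mul_assoc, gramDet_mul, gramDet_mul, h1, mul_one,
    Real.sqrt_mul (sq_nonneg _), mul_inv, mul_pow, mul_comm]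

end Contraction

/-! ### Integral frames and their real volumes -/

section Frames

set_option linter.unusedSectionVars false

variable {ι κ κ' : Type*} [Fintype ι] [DecidableEq ι] [Fintype κ] [DecidableEq κ] [Fintype κ']
  [DecidableEq κ']

theorem gramDet_ne_zero_iff {B : Matrix ι κ ℝ} : gramDet B ≠ 0 ↔ ∀ v, B *ᵥ v = 0 → v = 0 := by
  constructor
  · intro h v hv
    by_contra hv0
    exact h (exists_mulVec_eq_zero_iff.1 ⟨v, hv0, by rw [← mulVec_mulVec, hv, mulVec_zero]⟩)
  · intro h h0
    obtain ⟨v, hv0, hv⟩ := exists_mulVec_eq_zero_iff.2 h0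
    refine hv0 (h v (dotProduct_self_eq_zero.1 ?_))
    rw [dotProduct_mulVec, ← mulVec_transpose, mulVec_mulVec, hv, zero_dotProduct]

theorem card_le_of_eq_mul {B : Matrix ι κ ℝ} {B' : Matrix ι κ' ℝ} {A : Matrix κ' κ ℝ}
    (h : B = B' * A) (hB : gramDet B ≠ 0) : Fintype.card κ ≤ Fintype.card κ' := by
  refine card_le_of_gramDet_ne_zero (B := A) (gramDet_ne_zero_iff.2 fun v hv => ?_)
  refine gramDet_ne_zero_iff.1 hB v ?_
  rw [h, ← mulVec_mulVec, hv, mulVec_zero]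

/-- The real matrix underlying an integral matrix. -/
def rmat {ι κ : Type*} (b : Matrix ι κ ℤ) : Matrix ι κ ℝ := b.map (Int.castRingHom ℝ)

theorem rmat_mul (b : Matrix ι κ ℤ) (A : Matrix κ κ' ℤ) : rmat (b * A) = rmat b * rmat A :=
  Matrix.map_mul

theorem rmat_fromCols (b : Matrix ι κ ℤ) (A : Matrix ι κ' ℤ) :
    rmat (fromCols b A) = fromCols (rmat b) (rmat A) := by
  ext i (j | j) <;> rfl

theorem rmat_transpose (b : Matrix ι κ ℤ) : rmat bᵀ = (rmat b)ᵀ := rfl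

theorem rmat_injective : Function.Injective (rmat : Matrix ι κ ℤ → Matrix ι κ ℝ) := by
  intro a b h
  ext i j
  have := congrFun (congrFun h i) j
  exact Int.cast_injective (α := ℝ) this

theorem rmat_mulVec (b : Matrix ι κ ℤ) (v : κ → ℤ) :
    rmat b *ᵥ (fun i => (v i : ℝ)) = fun i => ((b *ᵥ v) i : ℝ) := by
  ext i
  simp [rmat, mulVec, dotProduct]

theorem det_rmat (A : Matrix κ κ ℤ) : (rmat A).det = (A.det : ℝ) := by
  have := RingHom.map_det (Int.castRingHom ℝ) A
  exact this.symm

/-- The columns of `b` are linearly independent. -/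
def IsFrame (b : Matrix ι κ ℤ) : Prop := ∀ v : κ → ℤ, b *ᵥ v = 0 → v = 0

/-- The Gram determinant is an integer, and it vanishes exactly when there is an integral kernel
vector; so independence over `ℤ` and over `ℝ` agree. -/
theorem isFrame_iff_gramDet {b : Matrix ι κ ℤ} : IsFrame b ↔ gramDet (rmat b) ≠ 0 := by
  have hcast : gramDet (rmat b) = ((bᵀ * b).det : ℝ) := by
    rw [gramDet, ← rmat_transpose, ← rmat_mul, det_rmat]
  constructor
  · intro h h0
    rw [hcast, Int.cast_eq_zero] at h0
    obtain ⟨v, hv0, hv⟩ := exists_mulVec_eq_zero_iff.2 h0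
    refine hv0 (h v (dotProduct_self_eq_zero.1 ?_))
    rw [dotProduct_mulVec, ← mulVec_transpose, mulVec_mulVec, hv, zero_dotProduct]
  · intro h v hv
    have h1 := gramDet_ne_zero_iff.1 h (fun i => (v i : ℝ)) (by
      rw [rmat_mulVec, hv]; ext; simp)
    ext i
    exact Int.cast_eq_zero.1 (congrFun h1 i)

/-- A positive integer is at least one. -/
theorem IsFrame.one_le_gramDet {b : Matrix ι κ ℤ} (hb : IsFrame b) : 1 ≤ gramDet (rmat b) := by
  have hcast : gramDet (rmat b) = ((bᵀ * b).det : ℝ) := by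
    rw [gramDet, ← rmat_transpose, ← rmat_mul, det_rmat]
  have h1 := isFrame_iff_gramDet.1 hb
  have h2 := gramDet_nonneg (rmat b)
  rw [hcast] at *
  have h3 : (0 : ℤ) < (bᵀ * b).det := by
    have : (0 : ℝ) < ((bᵀ * b).det : ℝ) := lt_of_le_of_ne h2 h1.symm
    exact_mod_cast this
  exact_mod_cast h3

/-- The columns of `b` form a basis of `N`. -/
structure IsBasisMat (b : Matrix ι κ ℤ) (N : Submodule ℤ (ι → ℤ)) : Prop where
  isFrame : IsFrame b
  mem_iff : ∀ x, x ∈ N ↔ ∃ v, x = b *ᵥ v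

theorem exists_isBasisMat (N : Submodule ℤ (ι → ℤ)) :
    ∃ (r : ℕ) (C : Matrix ι (Fin r) ℤ), IsBasisMat C N := by
  let β := Module.finBasis ℤ N
  have hmul : ∀ v, (of fun i j => (β j).1 i : Matrix ι _ ℤ) *ᵥ v = ((∑ j, v j • β j : N) : ι → ℤ) := by
    intro v
    ext i
    simp [mulVec, dotProduct, mul_comm]
  refine ⟨_, of fun i j => (β j).1 i, fun v hv => ?_, fun x => ⟨fun hx => ?_, ?_⟩⟩
  · rw [hmul] at hv
    have h0 : (∑ j, v j • β j : N) = 0 := Subtype.ext hv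
    exact funext (Fintype.linearIndependent_iff.1 β.linearIndependent v h0)
  · refine ⟨β.repr ⟨x, hx⟩, ?_⟩
    rw [hmul, β.sum_repr]
  · rintro ⟨v, rfl⟩
    rw [hmul]
    exact Subtype.coe_prop _

/-- Primitivity makes `Q / P` torsion free, hence free; lifts of a basis complete the given basis of
`P`. -/
theorem exists_isBasisMat_fromCols {P Q : Submodule ℤ (ι → ℤ)} (hPQ : P ≤ Q)
    (hprim : ∀ x ∈ Q, ∀ n : ℤ, n ≠ 0 → n • x ∈ P → x ∈ P) {r : ℕ} {C : Matrix ι (Fin r) ℤ}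
    (hC : IsBasisMat C P) : ∃ (m : ℕ) (A : Matrix ι (Fin m) ℤ), IsBasisMat (fromCols C A) Q := by
  let W : Submodule ℤ Q := P.comap Q.subtype
  have htf : Module.IsTorsionFree ℤ (Q ⧸ W) := by
    refine Module.IsTorsionFree.of_smul_eq_zero fun n x hnx => ?_
    by_cases hn : n = 0
    · exact Or.inl hn
    right
    obtain ⟨y, rfl⟩ := Submodule.Quotient.mk_surjective W x
    rw [← Submodule.Quotient.mk_smul, Submodule.Quotient.mk_eq_zero] at hnx
    rw [Submodule.Quotient.mk_eq_zero]
    exact hprim y.1 y.2 n hn hnx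
  let γ := Module.finBasis ℤ (Q ⧸ W)
  choose a ha using fun j => Submodule.Quotient.mk_surjective W (γ j)
  have hmul : ∀ w, (of fun i j => (a j).1 i : Matrix ι _ ℤ) *ᵥ w = ((∑ j, w j • a j : Q) : ι → ℤ) := by
    intro v
    ext i
    simp [mulVec, dotProduct, mul_comm]
  have hq : ∀ w : Fin (Module.finrank ℤ (Q ⧸ W)) → ℤ, Submodule.Quotient.mk (p := W) (∑ j, w j • a j) = ∑ j, w j • γ j := by
    intro w
    simp only [← ha]
    exact map_sum W.mkQ _ _
  refine ⟨_, of fun i j => (a j).1 i, fun v hv => ?_, fun x => ⟨fun hx => ?_, ?_⟩⟩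
  · rw [fromCols_mulVec, hmul] at hv
    have hCP : C *ᵥ (v ∘ Sum.inl) ∈ P := (hC.mem_iff _).2 ⟨_, rfl⟩
    have h1 : (∑ j, (v ∘ Sum.inr) j • a j : Q) ∈ W := by
      change ((∑ j, (v ∘ Sum.inr) j • a j : Q) : ι → ℤ) ∈ P
      rw [eq_neg_of_add_eq_zero_right hv]
      exact neg_mem hCP
    rw [← Submodule.Quotient.mk_eq_zero, hq] at h1
    have h2 := Fintype.linearIndependent_iff.1 γ.linearIndependent _ h1
    have h3 : (∑ j, (v ∘ Sum.inr) j • a j : Q) = 0 :=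
      Finset.sum_eq_zero fun j _ => by rw [h2 j, zero_smul]
    rw [h3, Submodule.coe_zero, add_zero] at hv
    have h4 := hC.isFrame _ hv
    ext (i | i)
    · exact congrFun h4 i
    · exact h2 i
  · let w := γ.repr (Submodule.Quotient.mk ⟨x, hx⟩)
    have h1 : (⟨x, hx⟩ : Q) - ∑ j, w j • a j ∈ W := by
      rw [← Submodule.Quotient.mk_eq_zero, Submodule.Quotient.mk_sub, hq, γ.sum_repr, sub_self]
    obtain ⟨v, hv⟩ := (hC.mem_iff _).1 h1
    refine ⟨Sum.elim v w, ?_⟩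
    rw [fromCols_mulVec, Sum.elim_comp_inl, Sum.elim_comp_inr, hmul, ← hv]
    simp
  · rintro ⟨v, rfl⟩
    rw [fromCols_mulVec, hmul]
    exact add_mem (hPQ ((hC.mem_iff _).2 ⟨_, rfl⟩)) (Subtype.coe_prop _)

theorem IsBasisMat.exists_eq_mul {b' : Matrix ι κ' ℤ} {N : Submodule ℤ (ι → ℤ)}
    (hb' : IsBasisMat b' N) {b : Matrix ι κ ℤ} (hb : ∀ j, b.col j ∈ N) :
    ∃ A : Matrix κ' κ ℤ, b = b' * A := by
  choose v hv using fun j => (hb'.mem_iff _).1 (hb j)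
  refine ⟨of fun i j => v j i, ?_⟩
  ext i j
  have := congrFun (hv j) i
  simpa [mul_apply, mulVec, dotProduct] using this

theorem IsBasisMat.col_mem {b : Matrix ι κ ℤ} {N : Submodule ℤ (ι → ℤ)} (hb : IsBasisMat b N)
    (j : κ) : b.col j ∈ N :=
  (hb.mem_iff _).2 ⟨Pi.single j 1, by rw [mulVec_single_one]⟩

/-- Passing to a sublattice of the same rank increases the volume. -/
theorem gramDet_le_of_eq_mul {ι' : Type*} [Fintype ι'] {b : Matrix ι κ ℤ} {b' : Matrix ι κ' ℤ}
    (hb : IsFrame b) (hcard : Fintype.card κ = Fintype.card κ') {A : Matrix κ' κ ℤ}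
    (h : b = b' * A) (M : Matrix ι' ι ℝ) : gramDet (M * rmat b') ≤ gramDet (M * rmat b) := by
  let e : κ ≃ κ' := Fintype.equivOfCardEq hcard
  let A' : Matrix κ κ ℤ := A.submatrix e id
  have h' : b = b'.submatrix id e * A' := by
    rw [h]
    have := submatrix_mul_equiv b' A (id : ι → ι) e (id : κ → κ)
    rw [this]
    simp
  have hdet : A'.det ≠ 0 := by
    intro h0
    obtain ⟨v, hv0, hv⟩ := exists_mulVec_eq_zero_iff.2 h0
    exact hv0 (hb v (by rw [h', ← mulVec_mulVec, hv, mulVec_zero]))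
  have h1 : gramDet (M * rmat b') = gramDet (M * rmat (b'.submatrix id e)) := by
    rw [← gramDet_submatrix (M * rmat b') e]
    rfl
  rw [h1, h', rmat_mul, ← Matrix.mul_assoc, gramDet_mul, det_rmat]
  -- The Gram determinant is multiplied by the square of a nonzero integer, the index.
  have h2 : (1 : ℝ) ≤ (A'.det : ℝ) ^ 2 := by
    have : (1 : ℤ) ≤ A'.det ^ 2 := by
      have := sq_pos_of_ne_zero hdet
      omega
    exact_mod_cast this
  nlinarith [gramDet_nonneg (M * rmat (b'.submatrix id e))]

theorem gramDet_mul_ne_zero {g g' : Matrix ι ι ℝ} (hg : g' * g = 1) {B : Matrix ι κ ℝ}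
    (hB : gramDet B ≠ 0) : gramDet (g * B) ≠ 0 := by
  rw [gramDet_ne_zero_iff] at *
  intro v hv
  refine hB v ?_
  have := congrArg (fun x => g' *ᵥ x) hv
  simpa [mulVec_mulVec, ← Matrix.mul_assoc, hg] using this

/-- The integral points of the real span of the columns of `b`. -/
def sat (b : Matrix ι κ ℤ) : Submodule ℤ (ι → ℤ) where
  carrier := {x | ∃ v : κ → ℝ, (fun i => (x i : ℝ)) = rmat b *ᵥ v}
  zero_mem' := ⟨0, by ext; simp⟩
  add_mem' := by
    rintro x y ⟨v, hv⟩ ⟨w, hw⟩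
    refine ⟨v + w, ?_⟩
    rw [mulVec_add, ← hv, ← hw]
    ext; simp
  smul_mem' := by
    rintro n x ⟨v, hv⟩
    refine ⟨(n : ℝ) • v, ?_⟩
    rw [mulVec_smul, ← hv]
    ext; simp

theorem mem_sat_of_smul_mem {b : Matrix ι κ ℤ} {x : ι → ℤ} {n : ℤ} (hn : n ≠ 0)
    (h : n • x ∈ sat b) : x ∈ sat b := by
  obtain ⟨v, hv⟩ := h
  refine ⟨(n : ℝ)⁻¹ • v, ?_⟩
  rw [mulVec_smul, ← hv]
  have : (n : ℝ) ≠ 0 := by exact_mod_cast hn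
  ext i
  simp [this]

theorem col_mem_sat (b : Matrix ι κ ℤ) (j : κ) : b.col j ∈ sat b :=
  ⟨Pi.single j 1, by rw [mulVec_single_one]; rfl⟩

theorem exists_eq_rmat_mul_of_col_mem_sat {b : Matrix ι κ ℤ} {b' : Matrix ι κ' ℤ}
    (h : ∀ j, b'.col j ∈ sat b) : ∃ A : Matrix κ κ' ℝ, rmat b' = rmat b * A := by
  choose v hv using h
  refine ⟨of fun i j => v j i, ?_⟩
  ext i j
  have := congrFun (hv j) i
  simpa [mul_apply, mulVec, dotProduct, rmat] using this

/-- A basis of the saturation has the same number of elements and a smaller volume. -/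
theorem IsBasisMat.card_eq_of_sat {b : Matrix ι κ ℤ} (hb : IsFrame b) {c : Matrix ι κ' ℤ}
    (hc : IsBasisMat c (sat b)) : Fintype.card κ = Fintype.card κ' := by
  obtain ⟨A, hA⟩ := hc.exists_eq_mul (col_mem_sat b)
  obtain ⟨A', hA'⟩ := exists_eq_rmat_mul_of_col_mem_sat hc.col_mem
  refine le_antisymm ?_ ?_
  · exact card_le_of_eq_mul (by rw [hA, rmat_mul]) (isFrame_iff_gramDet.1 hb)
  · exact card_le_of_eq_mul hA' (isFrame_iff_gramDet.1 hc.isFrame)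

theorem IsBasisMat.gramDet_le_of_sat {b : Matrix ι κ ℤ} (hb : IsFrame b) {c : Matrix ι κ' ℤ}
    (hc : IsBasisMat c (sat b)) (M : Matrix ι ι ℝ) :
    gramDet (M * rmat c) ≤ gramDet (M * rmat b) := by
  obtain ⟨A, hA⟩ := hc.exists_eq_mul (col_mem_sat b)
  exact gramDet_le_of_eq_mul hb (hc.card_eq_of_sat hb) hA M

end Frames

/-! ### Isotropic sublattices -/

section Isotropic

set_option linter.unusedSectionVars false

variable {d : ℕ} {κ κ' : Type} [Fintype κ] [DecidableEq κ] [Fintype κ'] [DecidableEq κ']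

/-- The columns of `b` span an isotropic subspace. -/
def IsIsotropic (b : Matrix (Fin d ⊕ Fin d) κ ℤ) : Prop := bᵀ * J (Fin d) ℤ * b = 0

theorem rmat_J : rmat (J (Fin d) ℤ) = J (Fin d) ℝ := map_J _ _

theorem conj_J (g : Sp d) (B : Matrix (Fin d ⊕ Fin d) κ ℝ) (C : Matrix (Fin d ⊕ Fin d) κ' ℝ) :
    (g.1 * B)ᵀ * J (Fin d) ℝ * (g.1 * C) = Bᵀ * J (Fin d) ℝ * C := by
  have h := SymplecticGroup.mem_iff'.1 g.2
  calc (g.1 * B)ᵀ * J (Fin d) ℝ * (g.1 * C) = Bᵀ * (g.1ᵀ * J (Fin d) ℝ * g.1) * C := by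
        simp only [transpose_mul, Matrix.mul_assoc]
    _ = _ := by rw [h]

theorem rmat_form (b : Matrix (Fin d ⊕ Fin d) κ ℤ) (c : Matrix (Fin d ⊕ Fin d) κ' ℤ) :
    (rmat b)ᵀ * J (Fin d) ℝ * rmat c = rmat (bᵀ * J (Fin d) ℤ * c) := by
  rw [rmat_mul, rmat_mul, rmat_transpose, rmat_J]

theorem IsIsotropic.rmat {b : Matrix (Fin d ⊕ Fin d) κ ℤ} (hb : IsIsotropic b) :
    (rmat b)ᵀ * J (Fin d) ℝ * SymplecticLattices.rmat b = 0 := by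
  rw [rmat_form, hb]
  ext; simp [SymplecticLattices.rmat]

theorem IsFrame.gramDet_ne_zero {b : Matrix (Fin d ⊕ Fin d) κ ℤ} (hb : IsFrame b) (g : Sp d) :
    gramDet (g.1 * rmat b) ≠ 0 := by
  refine gramDet_mul_ne_zero (g' := g⁻¹.1) ?_ (isFrame_iff_gramDet.1 hb)
  rw [← Submonoid.coe_mul, inv_mul_cancel]
  rfl

/-- The radical of the symplectic form on the lattice spanned by the columns of `s`. -/
def radical (s : Matrix (Fin d ⊕ Fin d) κ ℤ) : Submodule ℤ (Fin d ⊕ Fin d → ℤ) where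
  carrier := {x | (∃ v, x = s *ᵥ v) ∧ (sᵀ * J (Fin d) ℤ) *ᵥ x = 0}
  zero_mem' := ⟨⟨0, by simp⟩, by simp⟩
  add_mem' := by
    rintro x y ⟨⟨v, rfl⟩, hx⟩ ⟨⟨w, rfl⟩, hy⟩
    exact ⟨⟨v + w, by rw [mulVec_add]⟩, by rw [mulVec_add, hx, hy, add_zero]⟩
  smul_mem' := by
    rintro n x ⟨⟨v, rfl⟩, hx⟩
    exact ⟨⟨n • v, by rw [mulVec_smul]⟩, by rw [mulVec_smul, hx, smul_zero]⟩

theorem form_eq_zero_of_col {b : Matrix (Fin d ⊕ Fin d) κ ℤ} {c : Matrix (Fin d ⊕ Fin d) κ' ℤ}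
    (h : ∀ j, (bᵀ * J (Fin d) ℤ) *ᵥ c.col j = 0) : bᵀ * J (Fin d) ℤ * c = 0 := by
  ext i j
  exact congrFun (h j) i

/-- A nondegenerate integral form has determinant at least one in absolute value. In the frame `E =
Q C` that determinant is `det (Qᵀ J Q) det C ^ 2`, at most `K` times the Gram determinant of `E`. -/
theorem one_le_abs_det_mul_gramDet {K : ℝ}
    (hK : ∀ {k : ℕ} (Q : Matrix (Fin d ⊕ Fin d) (Fin k) ℝ), Qᵀ * Q = 1 →
      |(Qᵀ * J (Fin d) ℝ * Q).det| ≤ K) {m : ℕ} {E : Matrix (Fin d ⊕ Fin d) (Fin m) ℝ}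
    (hE : gramDet E ≠ 0) {Ω : Matrix (Fin m) (Fin m) ℤ} (hΩ : Ω.det ≠ 0)
    (h : Eᵀ * J (Fin d) ℝ * E = rmat Ω) : 1 ≤ K * gramDet E := by
  obtain ⟨Q, C, rfl, hQ, hC, -⟩ := exists_orthonormal_mul hE
  have h1 : (Q * C)ᵀ * J (Fin d) ℝ * (Q * C) = Cᵀ * (Qᵀ * J (Fin d) ℝ * Q) * C := by
    simp only [transpose_mul, Matrix.mul_assoc]
  have h2 : |(Ω.det : ℝ)| = |(Qᵀ * J (Fin d) ℝ * Q).det| * C.det ^ 2 := by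
    rw [← det_rmat, ← h, h1, det_mul, det_mul, det_transpose, abs_mul, abs_mul, ← sq_abs C.det]
    ring
  have h3 : (1 : ℝ) ≤ |(Ω.det : ℝ)| := by
    have : (1 : ℤ) ≤ |Ω.det| := Int.one_le_abs hΩ
    exact_mod_cast this
  rw [← hC]
  calc (1 : ℝ) ≤ _ := h3
    _ = _ := h2
    _ ≤ _ := mul_le_mul_of_nonneg_right (hK Q hQ) (sq_nonneg _)

/-- The volume of any sublattice is bounded below by that of an isotropic sublattice of at most the
same rank. -/
theorem exists_isotropic_le (d : ℕ) : ∃ K : ℝ, 1 ≤ K ∧ ∀ {κ : Type} [Fintype κ] [DecidableEq κ]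
    (s : Matrix (Fin d ⊕ Fin d) κ ℤ), IsFrame s → ∃ r : ℕ, r ≤ Fintype.card κ ∧
      ∃ c : Matrix (Fin d ⊕ Fin d) (Fin r) ℤ, IsFrame c ∧ IsIsotropic c ∧
        ∀ g : Sp d, gramDet (g.1 * rmat c) ≤ K * gramDet (g.1 * rmat s) := by
  obtain ⟨K, hK1, hK⟩ := exists_abs_det_conj_le (J (Fin d) ℝ)
  refine ⟨K, hK1, fun {κ} _ _ s hs => ?_⟩
  -- The isotropic sublattice is the radical, whose basis `c` is extended by `e` to one of the whole
  -- lattice.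
  obtain ⟨r, c, hc⟩ := exists_isBasisMat (radical s)
  let S : Submodule ℤ (Fin d ⊕ Fin d → ℤ) := LinearMap.range s.mulVecLin
  have hsS : IsBasisMat s S := ⟨hs, fun x => ⟨fun ⟨v, hv⟩ => ⟨v, hv.symm⟩, fun ⟨v, hv⟩ => ⟨v, hv.symm⟩⟩⟩
  obtain ⟨m, e, he⟩ := exists_isBasisMat_fromCols (P := radical s) (Q := S)
    (fun x hx => (hsS.mem_iff x).2 hx.1) (fun x hx n hn hnx => by
      refine ⟨(hsS.mem_iff x).1 hx, ?_⟩
      have := hnx.2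
      rw [mulVec_smul] at this
      exact (smul_eq_zero.1 this).resolve_left hn) hc
  obtain ⟨A, hA⟩ := hsS.exists_eq_mul he.col_mem
  obtain ⟨A', hA'⟩ := he.exists_eq_mul hsS.col_mem
  have hcard : Fintype.card κ = Fintype.card (Fin r ⊕ Fin m) :=
    le_antisymm (card_le_of_eq_mul (by rw [hA', rmat_mul]) (isFrame_iff_gramDet.1 hs))
      (card_le_of_eq_mul (by rw [hA, rmat_mul]) (isFrame_iff_gramDet.1 he.isFrame))
  have hsc : sᵀ * J (Fin d) ℤ * c = 0 := form_eq_zero_of_col fun j => (hc.col_mem j).2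
  have hce : (fromCols c e)ᵀ * J (Fin d) ℤ * c = 0 := by
    rw [hA, transpose_mul, Matrix.mul_assoc, Matrix.mul_assoc, ← Matrix.mul_assoc sᵀ, hsc,
      Matrix.mul_zero]
  have hcc : cᵀ * J (Fin d) ℤ * c = 0 := by
    ext i j
    exact congrFun (congrFun hce (Sum.inl i)) j
  have hec : eᵀ * J (Fin d) ℤ * c = 0 := by
    ext i j
    exact congrFun (congrFun hce (Sum.inr i)) j
  have hce' : cᵀ * J (Fin d) ℤ * e = 0 := by
    have := congrArg transpose hec
    rw [transpose_mul, transpose_mul, transpose_transpose, J_transpose, transpose_zero,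
      Matrix.neg_mul, Matrix.mul_neg, neg_eq_zero, ← Matrix.mul_assoc] at this
    exact this
  -- A kernel vector would give an element of the radical in the span of `e`, contradicting
  -- independence of `c` and `e`.
  have hΩ : (eᵀ * J (Fin d) ℤ * e).det ≠ 0 := by
    intro h0
    obtain ⟨v, hv0, hv⟩ := exists_mulVec_eq_zero_iff.2 h0
    have hx : e *ᵥ v ∈ radical s := by
      refine ⟨(hsS.mem_iff _).1 ((he.mem_iff _).2 ⟨Sum.elim 0 v, ?_⟩), ?_⟩
      · rw [fromCols_mulVec, Sum.elim_comp_inl, Sum.elim_comp_inr, mulVec_zero, zero_add]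
      · have h1 : ((fromCols c e)ᵀ * J (Fin d) ℤ) *ᵥ (e *ᵥ v) = 0 := by
          ext (i | i)
          · have : ((cᵀ * J (Fin d) ℤ) *ᵥ (e *ᵥ v)) i = 0 := by
              rw [mulVec_mulVec, hce', zero_mulVec]; rfl
            exact this
          · have : ((eᵀ * J (Fin d) ℤ) *ᵥ (e *ᵥ v)) i = 0 := by
              rw [mulVec_mulVec, hv]; rfl
            exact this
        rw [hA', transpose_mul, Matrix.mul_assoc, ← mulVec_mulVec, h1, mulVec_zero]
    obtain ⟨w, hw⟩ := (hc.mem_iff _).1 hx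
    have h2 := he.isFrame (Sum.elim (-w) v) (by
      rw [fromCols_mulVec, Sum.elim_comp_inl, Sum.elim_comp_inr, mulVec_neg, hw, neg_add_cancel])
    exact hv0 (funext fun i => congrFun h2 (Sum.inr i))
  refine ⟨r, by rw [hcard]; simp, c, hc.isFrame, hcc, fun g => ?_⟩
  have hle := gramDet_le_of_eq_mul hs hcard hA' g.1
  refine le_trans ?_ (mul_le_mul_of_nonneg_left hle (by linarith))
  have hcne := hc.isFrame.gramDet_ne_zero g
  have hne := he.isFrame.gramDet_ne_zero g
  rw [rmat_fromCols, mul_fromCols, gramDet_fromCols hcne] at hne ⊢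
  set E := g.1 * rmat e with hE
  set C := g.1 * rmat c with hC
  have hCC : Cᵀ * J (Fin d) ℝ * C = 0 := by
    rw [hC, conj_J, rmat_form, hcc]; ext; simp [rmat]
  have hCE : Cᵀ * J (Fin d) ℝ * E = 0 := by
    rw [hC, hE, conj_J, rmat_form, hce']; ext; simp [rmat]
  have hEC : Eᵀ * J (Fin d) ℝ * C = 0 := by
    rw [hC, hE, conj_J, rmat_form, hec]; ext; simp [rmat]
  have hEE : Eᵀ * J (Fin d) ℝ * E = rmat (eᵀ * J (Fin d) ℤ * e) := by
    rw [hE, conj_J, rmat_form]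
  -- Projecting away from `C` changes `E` only by radical vectors, so the form on it is still the
  -- integral matrix above.
  obtain ⟨Z, hZ⟩ : ∃ Z : Matrix (Fin r) (Fin m) ℝ, compProj C * E = E - C * Z :=
    ⟨(Cᵀ * C)⁻¹ * (Cᵀ * E), by simp only [compProj, Matrix.sub_mul, Matrix.one_mul, Matrix.mul_assoc]⟩
  have hform : (compProj C * E)ᵀ * J (Fin d) ℝ * (compProj C * E) =
      rmat (eᵀ * J (Fin d) ℤ * e) := by
    have h1 : (C * Z)ᵀ * J (Fin d) ℝ * E = 0 := by
      rw [transpose_mul, Matrix.mul_assoc, Matrix.mul_assoc, ← Matrix.mul_assoc Cᵀ, hCE,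
        Matrix.mul_zero]
    have h2 : (C * Z)ᵀ * J (Fin d) ℝ * (C * Z) = 0 := by
      rw [transpose_mul, Matrix.mul_assoc Zᵀ, Matrix.mul_assoc Zᵀ, ← Matrix.mul_assoc _ C, hCC,
        Matrix.zero_mul, Matrix.mul_zero]
    have h3 : Eᵀ * J (Fin d) ℝ * (C * Z) = 0 := by
      rw [← Matrix.mul_assoc, hEC, Matrix.zero_mul]
    rw [hZ, transpose_sub, Matrix.sub_mul, Matrix.sub_mul, Matrix.mul_sub, Matrix.mul_sub, h1, h2,
      h3, hEE]
    simp
  have hfin := one_le_abs_det_mul_gramDet hK (right_ne_zero_of_mul hne) hΩ hform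
  nlinarith [gramDet_nonneg C]

theorem isIsotropic_of_col_mem_sat {b : Matrix (Fin d ⊕ Fin d) κ ℤ} (hb : IsIsotropic b)
    {c : Matrix (Fin d ⊕ Fin d) κ' ℤ} (hc : ∀ j, c.col j ∈ sat b) : IsIsotropic c := by
  obtain ⟨A, hA⟩ := exists_eq_rmat_mul_of_col_mem_sat hc
  apply rmat_injective
  rw [← rmat_form, hA, transpose_mul, Matrix.mul_assoc Aᵀ, Matrix.mul_assoc Aᵀ,
    ← Matrix.mul_assoc _ (rmat b), hb.rmat, Matrix.zero_mul, Matrix.mul_zero]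
  ext; simp [rmat]

/-- Two isotropic lattices of rank `k` spanning different subspaces give rise to isotropic lattices
of ranks `k - j` and at most `k + j` with controlled product of volumes. -/
theorem exists_isotropic_pair (d : ℕ) : ∃ K : ℝ, 1 ≤ K ∧ ∀ {k : ℕ}
    (b b' : Matrix (Fin d ⊕ Fin d) (Fin k) ℤ), IsFrame b → IsFrame b' → IsIsotropic b →
    sat b ≠ sat b' → ∃ r t j : ℕ, 1 ≤ j ∧ r + j = k ∧ t ≤ k + j ∧
      ∃ (c : Matrix (Fin d ⊕ Fin d) (Fin r) ℤ) (e : Matrix (Fin d ⊕ Fin d) (Fin t) ℤ),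
        IsFrame c ∧ IsFrame e ∧ IsIsotropic c ∧ IsIsotropic e ∧ ∀ g : Sp d,
          gramDet (g.1 * rmat c) * gramDet (g.1 * rmat e) ≤
            K * (gramDet (g.1 * rmat b) * gramDet (g.1 * rmat b')) := by
  obtain ⟨K, hK1, hK⟩ := exists_isotropic_le d
  refine ⟨K, hK1, fun {k} b b' hb hb' hi hne => ?_⟩
  -- The saturations replace `b` and `b'`: their intersection is primitive in both, so its basis `c`
  -- extends by `a` and by `a'`.
  obtain ⟨r, c, hc⟩ := exists_isBasisMat (sat b ⊓ sat b')
  obtain ⟨j, a, ha⟩ := exists_isBasisMat_fromCols (P := sat b ⊓ sat b') (Q := sat b) inf_le_left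
    (fun x _ n hn hnx => ⟨mem_sat_of_smul_mem hn hnx.1, mem_sat_of_smul_mem hn hnx.2⟩) hc
  obtain ⟨j', a', ha'⟩ := exists_isBasisMat_fromCols (P := sat b ⊓ sat b') (Q := sat b')
    inf_le_right
    (fun x _ n hn hnx => ⟨mem_sat_of_smul_mem hn hnx.1, mem_sat_of_smul_mem hn hnx.2⟩) hc
  have hk := ha.card_eq_of_sat hb
  have hk' := ha'.card_eq_of_sat hb'
  simp only [Fintype.card_fin, Fintype.card_sum] at hk hk'
  -- If `j = 0`, both saturations equal their intersection, contradicting `sat b ≠ sat b'`.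
  have hj : 1 ≤ j := by
    by_contra! hj0
    have h1 : j = 0 := by omega
    have h2 : j' = 0 := by omega
    subst h1 h2
    apply hne
    have key : ∀ {N : Submodule ℤ (Fin d ⊕ Fin d → ℤ)} {a : Matrix (Fin d ⊕ Fin d) (Fin 0) ℤ},
        IsBasisMat (fromCols c a) N → N ≤ sat b ⊓ sat b' := by
      intro N a h x hx
      obtain ⟨v, rfl⟩ := (h.mem_iff x).1 hx
      rw [fromCols_mulVec, mulVec_empty, add_zero]
      exact (hc.mem_iff _).2 ⟨_, rfl⟩
    exact le_antisymm ((key ha).trans inf_le_right) ((key ha').trans inf_le_left)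
  have hs : IsFrame (fromCols c (fromCols a a')) := by
    intro v hv
    rw [fromCols_mulVec, fromCols_mulVec] at hv
    set x := v ∘ Sum.inl with hx
    set y := (v ∘ Sum.inr) ∘ Sum.inl with hy
    set z := (v ∘ Sum.inr) ∘ Sum.inr with hz
    have h1 : a' *ᵥ z = -(c *ᵥ x + a *ᵥ y) := by
      rw [eq_neg_iff_add_eq_zero, ← hv]; abel
    have h2 : a' *ᵥ z ∈ sat b := by
      rw [h1]
      refine neg_mem ((ha.mem_iff _).2 ⟨Sum.elim x y, ?_⟩)
      rw [fromCols_mulVec, Sum.elim_comp_inl, Sum.elim_comp_inr]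
    have h3 : a' *ᵥ z ∈ sat b' := (ha'.mem_iff _).2 ⟨Sum.elim 0 z, by
      rw [fromCols_mulVec, Sum.elim_comp_inl, Sum.elim_comp_inr, mulVec_zero, zero_add]⟩
    obtain ⟨w, hw⟩ := (hc.mem_iff _).1 ⟨h2, h3⟩
    have h4 := ha'.isFrame (Sum.elim (-w) z) (by
      rw [fromCols_mulVec, Sum.elim_comp_inl, Sum.elim_comp_inr, mulVec_neg, hw, neg_add_cancel])
    have hz0 : z = 0 := funext fun i => congrFun h4 (Sum.inr i)
    rw [hz0, mulVec_zero, add_zero] at hv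
    have h5 := ha.isFrame (Sum.elim x y) (by
      rw [fromCols_mulVec, Sum.elim_comp_inl, Sum.elim_comp_inr, hv])
    ext (i | i | i)
    · exact congrFun h5 (Sum.inl i)
    · exact congrFun h5 (Sum.inr i)
    · exact congrFun hz0 i
  -- The sum of the two lattices has rank `k + j` but need not be isotropic, so it is replaced by
  -- its isotropic part.
  obtain ⟨t, ht, e, he, hei, hle⟩ := hK _ hs
  simp only [Fintype.card_fin, Fintype.card_sum] at ht
  refine ⟨r, t, j, hj, hk.symm, by omega, c, e, hc.isFrame, he,
    isIsotropic_of_col_mem_sat hi fun l => (hc.col_mem l).1, hei, fun g => ?_⟩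
  have hcne := hc.isFrame.gramDet_ne_zero g
  have hane := ha.isFrame.gramDet_ne_zero g
  have h1 := hle g
  have h2 := ha.gramDet_le_of_sat hb g.1
  have h3 := ha'.gramDet_le_of_sat hb' g.1
  rw [rmat_fromCols, mul_fromCols] at hane h2 h3
  rw [rmat_fromCols, rmat_fromCols, mul_fromCols, mul_fromCols] at h1
  have h4 := gramDet_fromCols_mul_le hcne hane (g.1 * rmat a')
  have h5 := mul_le_mul h2 h3 (gramDet_nonneg _) (gramDet_nonneg _)
  have h6 := mul_le_mul_of_nonneg_left h1 (gramDet_nonneg (g.1 * rmat c))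
  have h7 := mul_le_mul_of_nonneg_left (h4.trans h5) (by linarith : 0 ≤ K)
  linarith

end Isotropic

/-! ### The height of isotropic frames -/

section Weights

variable {d k : ℕ}

/-- The isotropic integral frames of rank `k`. -/
abbrev IsoFrame (d k : ℕ) : Type :=
  {b : Matrix (Fin d ⊕ Fin d) (Fin k) ℤ // IsFrame b ∧ IsIsotropic b}

/-- The `d`-th power of the inverse volume of the frame `g b`. -/
def weight (g : Sp d) (b : Matrix (Fin d ⊕ Fin d) (Fin k) ℤ) : ℝ := (vol (g.1 * rmat b))⁻¹ ^ d

theorem vol_pos {b : Matrix (Fin d ⊕ Fin d) (Fin k) ℤ} (hb : IsFrame b) (g : Sp d) :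
    0 < vol (g.1 * rmat b) :=
  Real.sqrt_pos.2 ((gramDet_nonneg _).lt_of_ne' (hb.gramDet_ne_zero g))

theorem weight_pos {b : Matrix (Fin d ⊕ Fin d) (Fin k) ℤ} (hb : IsFrame b) (g : Sp d) :
    0 < weight g b := pow_pos (inv_pos.2 (vol_pos hb g)) d

/-- The distortion of volumes by `h⁻¹` is bounded uniformly in the frame, whatever `g` is. -/
theorem exists_inv_vol_mul_le (h : Sp d) : ∃ K : ℝ, 1 ≤ K ∧ ∀ {k : ℕ} (g : Sp d)
    (b : Matrix (Fin d ⊕ Fin d) (Fin k) ℤ), IsFrame b →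
      (vol ((h * g).1 * rmat b))⁻¹ ≤ K * (vol (g.1 * rmat b))⁻¹ := by
  obtain ⟨K, hK, hle⟩ := exists_gramDet_mul_le (h⁻¹ : Sp d).1
  refine ⟨√K, Real.one_le_sqrt.2 hK, fun g b hb => ?_⟩
  have h1 := hle ((h * g).1 * rmat b) (hb.gramDet_ne_zero (h * g))
  have h2 : (h⁻¹ : Sp d).1 * ((h * g).1 * rmat b) = g.1 * rmat b := by
    rw [← Matrix.mul_assoc]
    congr 1
    exact congrArg Subtype.val (inv_mul_cancel_left h g)
  rw [h2] at h1
  have h3 : vol (g.1 * rmat b) ≤ √K * vol ((h * g).1 * rmat b) := by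
    rw [vol, vol, ← Real.sqrt_mul (by linarith)]
    exact Real.sqrt_le_sqrt h1
  rw [inv_eq_one_div, ← div_eq_mul_inv, div_le_div_iff₀ (vol_pos hb _) (vol_pos hb _), one_mul]
  exact h3

theorem exists_weight_mul_le (h : Sp d) : ∃ K : ℝ, 1 ≤ K ∧ ∀ {k : ℕ} (g : Sp d)
    (b : Matrix (Fin d ⊕ Fin d) (Fin k) ℤ), IsFrame b → weight (h * g) b ≤ K * weight g b := by
  obtain ⟨K, hK, hle⟩ := exists_inv_vol_mul_le h
  refine ⟨K ^ d, one_le_pow₀ hK, fun g b hb => ?_⟩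
  rw [weight, weight, ← mul_pow]
  exact pow_le_pow_left₀ (inv_nonneg.2 (Real.sqrt_nonneg _)) (hle g b hb) d

theorem inv_vol_one_le {b : Matrix (Fin d ⊕ Fin d) (Fin k) ℤ} (hb : IsFrame b) :
    (vol ((1 : Sp d).1 * rmat b))⁻¹ ≤ 1 := by
  refine inv_le_one_of_one_le₀ (Real.one_le_sqrt.2 ?_)
  have : (1 : Sp d).1 * rmat b = rmat b := Matrix.one_mul _
  rw [this]
  exact hb.one_le_gramDet

/-- At the identity integral frames have volume at least one, and `g` distorts volumes boundedly.
Hence the suprema below are finite. -/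
theorem exists_inv_vol_le (g : Sp d) : ∃ K : ℝ, ∀ {k : ℕ} (b : Matrix (Fin d ⊕ Fin d) (Fin k) ℤ),
    IsFrame b → (vol (g.1 * rmat b))⁻¹ ≤ K := by
  obtain ⟨K, hK, hle⟩ := exists_inv_vol_mul_le g
  refine ⟨K, fun b hb => ?_⟩
  have h := hle 1 b hb
  rw [mul_one] at h
  exact h.trans (mul_le_of_le_one_right (by linarith) (inv_vol_one_le hb))

/-- The largest weight of an isotropic frame of rank `k`. -/
def phi (k : ℕ) (g : Sp d) : ℝ := ⨆ b : IsoFrame d k, weight g b.1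

theorem bddAbove_weight (k : ℕ) (g : Sp d) :
    BddAbove (Set.range fun b : IsoFrame d k => weight g b.1) := by
  obtain ⟨K, hK⟩ := exists_inv_vol_le g
  refine ⟨K ^ d, ?_⟩
  rintro _ ⟨b, rfl⟩
  exact pow_le_pow_left₀ (inv_nonneg.2 (Real.sqrt_nonneg _)) (hK b.1 b.2.1) d

theorem weight_le_phi (g : Sp d) (b : IsoFrame d k) : weight g b.1 ≤ phi k g :=
  le_ciSup (bddAbove_weight k g) b

theorem phi_nonneg (k : ℕ) (g : Sp d) : 0 ≤ phi k g :=
  Real.iSup_nonneg fun b => (weight_pos b.2.1 g).le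

theorem phi_zero (g : Sp d) : phi 0 g = 1 := by
  have h : ∀ b : IsoFrame d 0, weight g b.1 = 1 := fun b => by simp [weight, vol, gramDet]
  have : Nonempty (IsoFrame d 0) :=
    ⟨⟨0, fun v _ => Subsingleton.elim _ _, Subsingleton.elim _ _⟩⟩
  simp [phi, h]

theorem continuous_weight {b : Matrix (Fin d ⊕ Fin d) (Fin k) ℤ} (hb : IsFrame b) :
    Continuous fun g : Sp d => weight g b := by
  have h : Continuous fun g : Sp d => g.1 * rmat b :=
    continuous_subtype_val.matrix_mul continuous_const
  exact (((h.matrix_transpose.matrix_mul h).matrix_det.sqrt).inv₀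
    fun g => (vol_pos hb g).ne').pow d

instance (d k : ℕ) : Countable (IsoFrame d k) := by
  have : Countable (Matrix (Fin d ⊕ Fin d) (Fin k) ℤ) :=
    inferInstanceAs (Countable (Fin d ⊕ Fin d → Fin k → ℤ))
  exact Subtype.countable

theorem measurable_phi (k : ℕ) : Measurable (phi k : Sp d → ℝ) :=
  Measurable.iSup fun b : IsoFrame d k => (continuous_weight b.2.1).measurable

/-- An element of `Sp(2d, ℤ)` maps isotropic integral frames to isotropic integral frames. -/
theorem phi_mul_le (g : Sp d) {γ : Sp d} (hγ : γ ∈ intSp d) : phi k (g * γ) ≤ phi k g := by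
  obtain ⟨M, hM⟩ := hγ
  refine Real.iSup_le (fun b => ?_) (phi_nonneg k g)
  have hr : γ.1 * rmat b.1 = rmat (M * b.1) := by rw [rmat_mul, hM]; rfl
  have hf : IsFrame (M * b.1) := by
    rw [isFrame_iff_gramDet, ← hr]
    exact b.2.1.gramDet_ne_zero γ
  have hi : IsIsotropic (M * b.1) := by
    refine rmat_injective ?_
    rw [← rmat_form, ← hr, conj_J, b.2.2.rmat]
    ext; simp [rmat]
  have hw : weight (g * γ) b.1 = weight g (M * b.1) := by
    rw [weight, weight, ← hr, ← Matrix.mul_assoc]; rfl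
  rw [hw]
  exact weight_le_phi g ⟨M * b.1, hf, hi⟩

theorem phi_mul (g : Sp d) {γ : Sp d} (hγ : γ ∈ intSp d) : phi k (g * γ) = phi k g := by
  refine le_antisymm (phi_mul_le g hγ) ?_
  have := phi_mul_le (k := k) (g * γ) (inv_mem hγ)
  rwa [mul_inv_cancel_right] at this

/-- Call a frame nearly maximal if its weight is at least `φ_k / Ω²`, where `Ω` bounds the
distortion by all `h i` and their inverses. If all nearly maximal frames span one subspace, they are
scaled by a common `r i` whose average is at most `c`. Otherwise two of them feed the intersection
and sum inequality. -/
theorem exists_phi_drift (hd : 1 ≤ d) :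
    ∃ (I : Type) (_ : Fintype I) (w : I → ℝ) (h : I → Sp d) (c K : ℝ), (∀ i, 0 ≤ w i) ∧
      ∑ i, w i = 1 ∧ 0 ≤ c ∧ c < 1 ∧ 1 ≤ K ∧ (∀ k g i, phi k (h i * g) ≤ K * phi k g) ∧
      ∀ k g, 1 ≤ k → ∑ i, w i * phi k (h i * g) ≤ c * phi k g ∨
        ∃ r t j : ℕ, 1 ≤ j ∧ r + j = k ∧ t ≤ k + j ∧ t ≤ 2 * d ∧
          phi k g ^ 2 ≤ K * (phi r g * phi t g) := by
  obtain ⟨I, hI, w, h, c, hw, hw1, hc0, hc1, hcon⟩ := exists_contraction hd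
  choose K₁ hK₁ hle₁ using fun i => exists_weight_mul_le (h i)
  choose K₂ hK₂ hle₂ using fun i => exists_weight_mul_le (h i)⁻¹
  obtain ⟨K₀, hK₀, hpair⟩ := exists_isotropic_pair d
  obtain ⟨Ω, hΩ1, hΩ₁, hΩ₂⟩ : ∃ Ω : ℝ, 1 < Ω ∧ (∀ i, K₁ i ≤ Ω) ∧ ∀ i, K₂ i ≤ Ω := by
    have hs₁ : ∀ i, K₁ i ≤ ∑ i, K₁ i := fun i =>
      Finset.single_le_sum (fun i _ => zero_le_one.trans (hK₁ i)) (Finset.mem_univ i)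
    have hs₂ : ∀ i, K₂ i ≤ ∑ i, K₂ i := fun i =>
      Finset.single_le_sum (fun i _ => zero_le_one.trans (hK₂ i)) (Finset.mem_univ i)
    have hn₁ : 0 ≤ ∑ i, K₁ i := Finset.sum_nonneg fun i _ => zero_le_one.trans (hK₁ i)
    have hn₂ : 0 ≤ ∑ i, K₂ i := Finset.sum_nonneg fun i _ => zero_le_one.trans (hK₂ i)
    exact ⟨2 + ∑ i, K₁ i + ∑ i, K₂ i, by linarith, fun i => by linarith [hs₁ i],
      fun i => by linarith [hs₂ i]⟩
  have hΩ0 : 0 < Ω := by linarith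
  have hup : ∀ {k : ℕ} (i : I) (g : Sp d) (b : IsoFrame d k),
      weight (h i * g) b.1 ≤ Ω * weight g b.1 := fun i g b =>
    (hle₁ i g b.1 b.2.1).trans (mul_le_mul_of_nonneg_right (hΩ₁ i) (weight_pos b.2.1 g).le)
  have hlow : ∀ {k : ℕ} (i : I) (g : Sp d) (b : IsoFrame d k),
      weight g b.1 ≤ Ω * weight (h i * g) b.1 := fun i g b => by
    have := hle₂ i (h i * g) b.1 b.2.1
    rw [inv_mul_cancel_left] at this
    exact this.trans (mul_le_mul_of_nonneg_right (hΩ₂ i) (weight_pos b.2.1 _).le)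
  have hphi : ∀ k (g : Sp d) i, phi k (h i * g) ≤ Ω * phi k g := fun k g i =>
    Real.iSup_le (fun b => (hup i g b).trans
      (mul_le_mul_of_nonneg_left (weight_le_phi g b) hΩ0.le))
      (mul_nonneg hΩ0.le (phi_nonneg k g))
  have hsK : 1 ≤ √K₀ ^ d := one_le_pow₀ (Real.one_le_sqrt.2 hK₀)
  refine ⟨I, hI, w, h, c, Ω ^ 4 * √K₀ ^ d, hw, hw1, hc0, hc1,
    one_le_mul_of_one_le_of_one_le (one_le_pow₀ hΩ1.le) hsK, fun k g i => ?_, fun k g hk => ?_⟩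
  · refine (hphi k g i).trans (mul_le_mul_of_nonneg_right ?_ (phi_nonneg k g))
    calc Ω = Ω * 1 := (mul_one _).symm
      _ ≤ Ω ^ 4 * √K₀ ^ d := mul_le_mul (le_self_pow₀ hΩ1.le (by norm_num)) hsK zero_le_one
        (by positivity)
  by_cases hsame : ∀ b b' : IsoFrame d k, phi k g ≤ Ω ^ 2 * weight g b.1 →
      phi k g ≤ Ω ^ 2 * weight g b'.1 → sat b.1 = sat b'.1
  · left
    rcases (phi_nonneg k g).eq_or_lt with h0 | h0
    · have : ∀ i, phi k (h i * g) = 0 := fun i =>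
        le_antisymm (by simpa [← h0] using hphi k g i) (phi_nonneg _ _)
      simp [this, ← h0]
    have hne : Nonempty (IsoFrame d k) := by
      by_contra hne
      rw [not_nonempty_iff] at hne
      simp [phi] at h0
    obtain ⟨b₀, hb₀⟩ : ∃ b₀ : IsoFrame d k, phi k g ≤ Ω ^ 2 * weight g b₀.1 := by
      have hlt : phi k g / Ω ^ 2 < ⨆ b : IsoFrame d k, weight g b.1 :=
        div_lt_self h0 (one_lt_pow₀ hΩ1 (by norm_num))
      obtain ⟨b₀, hb₀⟩ := exists_lt_of_lt_ciSup hlt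
      exact ⟨b₀, ((div_lt_iff₀' (by positivity)).1 hb₀).le⟩
    obtain ⟨r, hr0, hrc, hr⟩ := hcon (g.1 * rmat b₀.1) hk (b₀.2.1.gramDet_ne_zero g)
      (by rw [conj_J]; exact b₀.2.2.rmat)
    have hr' : ∀ (b : IsoFrame d k) i, sat b.1 = sat b₀.1 →
        weight (h i * g) b.1 = r i * weight g b.1 := by
      intro b i hb
      obtain ⟨A, hA⟩ := exists_eq_rmat_mul_of_col_mem_sat (b := b₀.1) (b' := b.1)
        fun j => hb ▸ col_mem_sat b.1 j
      have := hr A i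
      rw [Matrix.mul_assoc, ← hA, ← Matrix.mul_assoc] at this
      exact this
    have hri : ∀ i, 1 ≤ Ω * r i := by
      intro i
      have h1 := hlow i g b₀
      rw [hr' b₀ i rfl, ← mul_assoc] at h1
      exact le_of_mul_le_mul_right (by rwa [one_mul]) (weight_pos b₀.2.1 g)
    -- A frame that is not nearly maximal ends with weight at most `φ_k / Ω`, and `r i ≥ 1 / Ω`, so
    -- it cannot exceed `r i φ_k`.
    have hi : ∀ i, phi k (h i * g) ≤ r i * phi k g := by
      intro i
      refine Real.iSup_le (fun b => ?_) (mul_nonneg (hr0 i) h0.le)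
      by_cases hb : phi k g ≤ Ω ^ 2 * weight g b.1
      · rw [hr' b i (hsame b b₀ hb hb₀)]
        exact mul_le_mul_of_nonneg_left (weight_le_phi g b) (hr0 i)
      · refine le_of_mul_le_mul_left ?_ hΩ0
        calc Ω * weight (h i * g) b.1 ≤ Ω * (Ω * weight g b.1) :=
              mul_le_mul_of_nonneg_left (hup i g b) hΩ0.le
          _ = Ω ^ 2 * weight g b.1 := by ring
          _ ≤ phi k g := (not_le.1 hb).le
          _ ≤ Ω * r i * phi k g := le_mul_of_one_le_left h0.le (hri i)
          _ = Ω * (r i * phi k g) := mul_assoc _ _ _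
    calc ∑ i, w i * phi k (h i * g) ≤ ∑ i, w i * (r i * phi k g) :=
          Finset.sum_le_sum fun i _ => mul_le_mul_of_nonneg_left (hi i) (hw i)
      _ = (∑ i, w i * r i) * phi k g := by rw [Finset.sum_mul]; simp only [mul_assoc]
      _ ≤ c * phi k g := mul_le_mul_of_nonneg_right hrc h0.le
  · right
    push Not at hsame
    obtain ⟨b, b', hb, hb', hne⟩ := hsame
    obtain ⟨r, t, j, hj, hrj, htj, cc, e, hcc, he, hci, hei, hg⟩ :=
      hpair b.1 b'.1 b.2.1 b'.2.1 b.2.2 hne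
    have htd : t ≤ 2 * d := by
      have := card_le_of_gramDet_ne_zero (isFrame_iff_gramDet.1 he)
      simpa [two_mul] using this
    refine ⟨r, t, j, hj, hrj, htj, htd, ?_⟩
    have hvol : vol (g.1 * rmat cc) * vol (g.1 * rmat e) ≤
        √K₀ * (vol (g.1 * rmat b.1) * vol (g.1 * rmat b'.1)) := by
      simp only [vol]
      rw [← Real.sqrt_mul (gramDet_nonneg _), ← Real.sqrt_mul (gramDet_nonneg _),
        ← Real.sqrt_mul (by linarith)]
      exact Real.sqrt_le_sqrt (hg g)
    have hww : weight g b.1 * weight g b'.1 ≤ √K₀ ^ d * (weight g cc * weight g e) := by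
      simp only [weight, ← mul_pow, ← mul_inv]
      refine pow_le_pow_left₀ (inv_nonneg.2 (mul_nonneg (vol_pos b.2.1 g).le (vol_pos b'.2.1 g).le)) ?_ d
      rw [inv_eq_one_div, ← div_eq_mul_inv, div_le_div_iff₀
        (mul_pos (vol_pos b.2.1 g) (vol_pos b'.2.1 g)) (mul_pos (vol_pos hcc g) (vol_pos he g)),
        one_mul]
      exact hvol
    calc phi k g ^ 2 = phi k g * phi k g := sq _
      _ ≤ (Ω ^ 2 * weight g b.1) * (Ω ^ 2 * weight g b'.1) :=
        mul_le_mul hb hb' (phi_nonneg k g) ((phi_nonneg k g).trans hb)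
      _ = Ω ^ 4 * (weight g b.1 * weight g b'.1) := by ring
      _ ≤ Ω ^ 4 * (√K₀ ^ d * (weight g cc * weight g e)) :=
        mul_le_mul_of_nonneg_left hww (by positivity)
      _ ≤ Ω ^ 4 * (√K₀ ^ d * (phi r g * phi t g)) := by
        refine mul_le_mul_of_nonneg_left (mul_le_mul_of_nonneg_left ?_ (by positivity))
          (by positivity)
        exact mul_le_mul (weight_le_phi g ⟨cc, hcc, hci⟩) (weight_le_phi g ⟨e, he, hei⟩)
          (weight_pos he g).le (phi_nonneg _ _)
      _ = _ := by ring

/-- The exponent of the `k`-th term of the Margulis function. -/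
def margulisExp (d k : ℕ) : ℕ := k * (4 * d + 1 - k)

/-- The exponent is quadratic, with `f (k - j) + f (k + j) = 2 f k - 2 j²`, and increases up to `2
d`; so `j ≥ 1` leaves a gain of `2`. -/
theorem margulisExp_add_le {r t j k : ℕ} (hj : 1 ≤ j) (hrj : r + j = k) (htj : t ≤ k + j)
    (ht : t ≤ 2 * d) (hk : k ≤ 2 * d) :
    margulisExp d r + margulisExp d t + 2 ≤ 2 * margulisExp d k := by
  subst hrj
  unfold margulisExp
  zify [show r ≤ 4 * d + 1 by omega, show t ≤ 4 * d + 1 by omega, show r + j ≤ 4 * d + 1 by omega]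
  have h1 : (t : ℤ) ≤ r + 2 * j := by omega
  have h2 : (t : ℤ) ≤ 2 * d := by omega
  have h3 : (1 : ℤ) ≤ j := by omega
  have h4 : (r : ℤ) + j ≤ 2 * d := by omega
  have h5 : (0 : ℤ) ≤ r := by omega
  rcases le_or_gt ((r : ℤ) + 2 * j) (2 * d) with h6 | h6
  · nlinarith [mul_nonneg (sub_nonneg.2 h1) (show (0 : ℤ) ≤ 4 * d + 1 - (r + 2 * j) - t by linarith)]
  -- When `k + j` exceeds `2 d`, the exponent at `t` is compared with its value at `2 d` instead.
  · have h7 : (t : ℤ) * (4 * d + 1 - t) ≤ 2 * d * (2 * d + 1) := by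
      nlinarith [mul_nonneg (sub_nonneg.2 h2) (show (0 : ℤ) ≤ 2 * d + 1 - t by linarith)]
    obtain ⟨m, hm⟩ : ∃ m : ℤ, 2 * (d : ℤ) = r + j + m := ⟨2 * d - r - j, by ring⟩
    have h8 : 0 ≤ m := by linarith
    have h9 : m + 1 ≤ j := by linarith
    have h10 : (4 : ℤ) * d = 2 * (r + j + m) := by linarith
    rw [hm] at h7
    rw [h10] at h7 ⊢
    nlinarith [mul_nonneg (sub_nonneg.2 h9) (show (0 : ℤ) ≤ j + m by linarith)]

/-- A weighted sum of the heights of isotropic frames of all ranks. -/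
def margulis (ε : ℝ) (g : Sp d) : ℝ :=
  ∑ k ∈ Finset.range (2 * d + 1), ε ^ margulisExp d k * phi k g

theorem margulisTerm_nonneg {ε : ℝ} (hε : 0 ≤ ε) (g : Sp d) (k : ℕ) :
    0 ≤ ε ^ margulisExp d k * phi k g := mul_nonneg (pow_nonneg hε _) (phi_nonneg k g)

theorem margulis_nonneg {ε : ℝ} (hε : 0 ≤ ε) (g : Sp d) : 0 ≤ margulis ε g :=
  Finset.sum_nonneg fun k _ => margulisTerm_nonneg hε g k

theorem margulisTerm_le {ε : ℝ} (hε : 0 ≤ ε) (g : Sp d) {k : ℕ} (hk : k ≤ 2 * d) :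
    ε ^ margulisExp d k * phi k g ≤ margulis ε g :=
  Finset.single_le_sum (f := fun k => ε ^ margulisExp d k * phi k g)
    (fun k _ => margulisTerm_nonneg hε g k) (Finset.mem_range.2 (by omega))

theorem measurable_margulis (ε : ℝ) : Measurable (margulis ε : Sp d → ℝ) :=
  Finset.measurable_fun_sum _ fun k _ => (measurable_phi k).const_mul _

theorem margulis_mul (ε : ℝ) (g : Sp d) {γ : Sp d} (hγ : γ ∈ intSp d) :
    margulis ε (g * γ) = margulis ε g := by
  simp only [margulis, phi_mul g hγ]

/-- Each positive rank either contracts by `c` or has a term of size at most `K ε F`, by the gain of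
`ε²` in the exponents. The additive constant comes from rank zero, where `φ_0 = 1`. -/
theorem exists_margulis_drift (hd : 1 ≤ d) :
    ∃ (ε : ℝ) (I : Type) (_ : Fintype I) (w : I → ℝ) (h : I → Sp d) (c : ℝ), 0 < ε ∧
      (∀ i, 0 ≤ w i) ∧ ∑ i, w i = 1 ∧ 0 ≤ c ∧ c < 1 ∧
      ∀ g : Sp d, ∑ i, w i * margulis ε (h i * g) ≤ c * margulis ε g + 1 := by
  obtain ⟨I, hI, w, h, c, K, hw, hw1, hc0, hc1, hK, hle, hdrift⟩ := exists_phi_drift hd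
  -- Chosen so that the `2 d + 1` error terms `K² ε F` sum to `(1 - c) / 2 * F`.
  set ε : ℝ := (1 - c) / (2 * (2 * d + 1) * K ^ 2) with hε
  have hK2 : 1 ≤ K ^ 2 := one_le_pow₀ hK
  have hden : (1 : ℝ) ≤ 2 * (2 * d + 1) * K ^ 2 := by
    have : (0 : ℝ) ≤ d := Nat.cast_nonneg d
    nlinarith
  have hε0 : 0 < ε := div_pos (by linarith) (by linarith)
  have hε1 : ε ≤ 1 := (div_le_one₀ (by linarith)).2 (by linarith)
  have hεK : (2 * d + 1) * (K ^ 2 * ε) = (1 - c) / 2 := by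
    rw [hε]
    have : (2 * (d : ℝ) + 1) ≠ 0 := by positivity
    have : K ≠ 0 := by positivity
    field_simp
  refine ⟨ε, I, hI, w, h, (1 + c) / 2, hε0, hw, hw1, by linarith, by linarith, fun g => ?_⟩
  set F := margulis ε g with hF
  have hF0 : 0 ≤ F := margulis_nonneg hε0.le g
  have hterm : ∀ k ∈ Finset.range (2 * d + 1),
      ε ^ margulisExp d k * ∑ i, w i * phi k (h i * g) ≤
        (c * (ε ^ margulisExp d k * phi k g) + K ^ 2 * ε * F) + if k = 0 then 1 else 0 := by
    intro k hk
    have hk' : k ≤ 2 * d := by simpa [Nat.lt_succ_iff] using hk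
    have hn : 0 ≤ K ^ 2 * ε * F := by positivity
    have hn' : 0 ≤ c * (ε ^ margulisExp d k * phi k g) :=
      mul_nonneg hc0 (margulisTerm_nonneg hε0.le g k)
    rcases Nat.eq_zero_or_pos k with rfl | hk0
    · simp only [phi_zero, mul_one, hw1, if_true] at hn' ⊢
      have : ε ^ margulisExp d 0 = 1 := by simp [margulisExp]
      rw [this] at hn' ⊢
      linarith
    rw [if_neg hk0.ne', add_zero]
    rcases hdrift k g hk0 with h1 | ⟨r, t, j, hj, hrj, htj, htd, h1⟩
    · have := mul_le_mul_of_nonneg_left h1 (pow_nonneg hε0.le (margulisExp d k))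
      linarith
    · have h2 : ε ^ margulisExp d k * phi k g ≤ K * ε * F := by
        refine le_of_sq_le_sq ?_ (by positivity)
        have hexp := margulisExp_add_le hj hrj htj htd hk'
        calc (ε ^ margulisExp d k * phi k g) ^ 2
            = ε ^ (2 * margulisExp d k) * phi k g ^ 2 := by rw [mul_pow, ← pow_mul, mul_comm 2]
          _ ≤ ε ^ (margulisExp d r + margulisExp d t + 2) * (K * (phi r g * phi t g)) :=
            mul_le_mul (pow_le_pow_of_le_one hε0.le hε1 hexp) h1 (sq_nonneg _) (by positivity)
          _ = K * ε ^ 2 * ((ε ^ margulisExp d r * phi r g) * (ε ^ margulisExp d t * phi t g)) := by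
            rw [pow_add, pow_add]; ring
          _ ≤ K * ε ^ 2 * (F * F) := by
            refine mul_le_mul_of_nonneg_left ?_ (by positivity)
            exact mul_le_mul (margulisTerm_le hε0.le g (by omega)) (margulisTerm_le hε0.le g htd)
              (margulisTerm_nonneg hε0.le g t) hF0
          _ ≤ K ^ 2 * ε ^ 2 * (F * F) := by
            refine mul_le_mul_of_nonneg_right (mul_le_mul_of_nonneg_right ?_ (by positivity))
              (by positivity)
            nlinarith
          _ = (K * ε * F) ^ 2 := by ring
      have h3 : ∑ i, w i * phi k (h i * g) ≤ K * phi k g := by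
        calc ∑ i, w i * phi k (h i * g) ≤ ∑ i, w i * (K * phi k g) :=
              Finset.sum_le_sum fun i _ => mul_le_mul_of_nonneg_left (hle k g i) (hw i)
          _ = K * phi k g := by rw [← Finset.sum_mul, hw1, one_mul]
      calc ε ^ margulisExp d k * ∑ i, w i * phi k (h i * g)
          ≤ ε ^ margulisExp d k * (K * phi k g) :=
            mul_le_mul_of_nonneg_left h3 (pow_nonneg hε0.le _)
        _ = K * (ε ^ margulisExp d k * phi k g) := by ring
        _ ≤ K * (K * ε * F) := mul_le_mul_of_nonneg_left h2 (by linarith)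
        _ = K ^ 2 * ε * F := by ring
        _ ≤ _ := by linarith
  calc ∑ i, w i * margulis ε (h i * g)
      = ∑ k ∈ Finset.range (2 * d + 1), ε ^ margulisExp d k * ∑ i, w i * phi k (h i * g) := by
        simp only [margulis, Finset.mul_sum]
        rw [Finset.sum_comm]
        exact Finset.sum_congr rfl fun k _ => Finset.sum_congr rfl fun i _ => by ring
    _ ≤ ∑ k ∈ Finset.range (2 * d + 1), ((c * (ε ^ margulisExp d k * phi k g) + K ^ 2 * ε * F) +
          if k = 0 then 1 else 0) := Finset.sum_le_sum hterm
    _ = c * F + (2 * d + 1) * (K ^ 2 * ε) * F + 1 := by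
        rw [Finset.sum_add_distrib, Finset.sum_add_distrib, ← Finset.mul_sum, Finset.sum_ite_eq']
        simp [hF, margulis]
        ring
    _ = (1 + c) / 2 * F + 1 := by rw [hεK]; ring

end Weights

/-! ### Mahler's compactness criterion -/

section Mahler

/-- In a lattice of covolume one whose non-zero vectors have length at least `δ`, the vectors of
bounded length span the whole space. -/
theorem exists_span_bounded_eq_top (E : Type*) [NormedAddCommGroup E] [InnerProductSpace ℝ E]
    [FiniteDimensional ℝ E] [MeasurableSpace E] [BorelSpace E] {δ : ℝ} (hδ : 0 < δ) :
    ∃ R : ℝ, ∀ (L : Submodule ℤ E) [DiscreteTopology L] [IsZLattice ℝ L],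
      ZLattice.covolume L volume = 1 → (∀ x ∈ L, x ≠ 0 → δ ≤ ‖x‖) →
      Submodule.span ℝ {x | x ∈ L ∧ ‖x‖ ≤ R} = ⊤ := by
  set v : ℝ≥0∞ := (volume : Measure E) (Metric.ball 0 (δ / 8)) with hv
  have hv0 : v ≠ 0 := (Metric.measure_ball_pos volume _ (by positivity)).ne'
  -- Enough small balls to exceed the covolume; they will be placed along a line orthogonal to the
  -- span.
  obtain ⟨m, hm⟩ : ∃ m : ℕ, 1 < m * v := by
    obtain ⟨m, hm⟩ := ENNReal.exists_nat_mul_gt hv0 ENNReal.one_ne_top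
    exact ⟨m, hm⟩
  refine ⟨(m + 1) * δ, fun L _ _ hcov hmin => ?_⟩
  by_contra hne
  set V := Submodule.span ℝ {x | x ∈ L ∧ ‖x‖ ≤ (m + 1) * δ} with hV
  obtain ⟨w₀, hw₀, hw₀'⟩ := Submodule.exists_mem_ne_zero_of_ne_bot
    (mt (Submodule.orthogonal_eq_bot_iff (K := V)).1 hne)
  set w : E := ‖w₀‖⁻¹ • w₀ with hw
  have hw1 : ‖w‖ = 1 := by
    rw [hw, norm_smul, norm_inv, norm_norm, inv_mul_cancel₀ (norm_ne_zero_iff.2 hw₀')]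
  have hwV : ∀ x ∈ V, inner ℝ x w = 0 := fun x hx => by
    rw [hw, inner_smul_right, Submodule.inner_right_of_mem_orthogonal hx hw₀, mul_zero]
  let p : Fin m → E := fun j => ((j : ℝ) * (δ / 2)) • w
  have hp : ∀ i j : Fin m, p i - p j = (((i : ℝ) - j) * (δ / 2)) • w := fun i j => by
    simp only [p, ← sub_smul]
    congr 1
    ring
  have hnp : ∀ i j : Fin m, ‖p i - p j‖ = |(i : ℝ) - j| * (δ / 2) := fun i j => by
    rw [hp, norm_smul, hw1, mul_one, Real.norm_eq_abs, abs_mul, abs_of_pos (half_pos hδ)]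
  let S : Set E := ⋃ j, Metric.ball (p j) (δ / 8)
  have hdisj : Pairwise (Function.onFun Disjoint fun j => Metric.ball (p j) (δ / 8)) := by
    intro i j hij
    refine Metric.ball_disjoint_ball ?_
    rw [dist_eq_norm, hnp]
    have h1 : (1 : ℝ) ≤ |(i : ℝ) - j| := by
      have h2 : (1 : ℤ) ≤ |((i : ℕ) : ℤ) - (j : ℕ)| :=
        Int.one_le_abs (sub_ne_zero.2 fun h => hij (Fin.ext (by exact_mod_cast h)))
      exact_mod_cast h2
    nlinarith
  have hS : volume S = m * v := by
    rw [measure_iUnion hdisj fun j => measurableSet_ball]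
    simp [Measure.addHaar_ball_center, hv]
  have : Countable L := inferInstance
  let F := ZSpan.fundamentalDomain ((Module.Free.chooseBasis ℤ L).ofZLatticeBasis ℝ L)
  have hfund : IsAddFundamentalDomain L F volume :=
    ZLattice.isAddFundamentalDomain (Module.Free.chooseBasis ℤ L) volume
  have hF : volume F = 1 := by
    rw [ZLattice.covolume_eq_measure_fundamentalDomain L volume hfund, measureReal_def,
      ENNReal.toReal_eq_one_iff] at hcov
    exact hcov
  have : MeasurableVAdd L E := (inferInstance : MeasurableVAdd L.toAddSubgroup E)
  have : VAddInvariantMeasure L E volume :=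
    (inferInstance : VAddInvariantMeasure L.toAddSubgroup E volume)
  -- Minkowski's principle: two points of the union of balls differ by a nonzero lattice vector.
  obtain ⟨x, y, hxy, hxyS⟩ := exists_pair_mem_lattice_not_disjoint_vadd hfund
    (MeasurableSet.iUnion fun j : Fin m => measurableSet_ball (x := p j)
      (ε := δ / 8)).nullMeasurableSet (hF ▸ hS ▸ hm)
  obtain ⟨_, ⟨a, ha, rfl⟩, b, hb, hab⟩ := Set.not_disjoint_iff.1 hxyS
  obtain ⟨i, hi⟩ := Set.mem_iUnion.1 ha
  obtain ⟨j, hj⟩ := Set.mem_iUnion.1 hb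
  rw [mem_ball_iff_norm] at hi hj
  have hab' : (y : E) + b = x + a := hab
  set l : E := x - y with hl
  have hlL : l ∈ L := sub_mem x.2 y.2
  have hl0 : l ≠ 0 := sub_ne_zero.2 fun h => hxy (Subtype.ext h)
  set e : E := (b - p j) - (a - p i) with he
  have hle : l = (p j - p i) + e := by
    rw [hl, he, sub_eq_sub_iff_add_eq_add.2 (show (x : E) + a = b + y by rw [← hab', add_comm])]
    abel
  have hen : ‖e‖ < δ / 4 := (norm_sub_le _ _).trans_lt (by linarith)
  have hmij : |(j : ℝ) - i| ≤ m := by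
    have hi' : ((i : ℕ) : ℝ) ≤ m := by exact_mod_cast i.2.le
    have hj' : ((j : ℕ) : ℝ) ≤ m := by exact_mod_cast j.2.le
    have hi0 : (0 : ℝ) ≤ (i : ℕ) := Nat.cast_nonneg _
    have hj0 : (0 : ℝ) ≤ (j : ℕ) := Nat.cast_nonneg _
    exact abs_sub_le_iff.2 ⟨by linarith, by linarith⟩
  have hlV : l ∈ V := by
    refine Submodule.subset_span ⟨hlL, ?_⟩
    rw [hle]
    refine (norm_add_le _ _).trans ?_
    rw [hnp]
    nlinarith
  -- The lattice vector is bounded by `R`, hence orthogonal to `w`. So the offset between the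
  -- centres is at most `‖e‖`, and the vector is shorter than `δ`.
  have hinner : ((j : ℝ) - i) * (δ / 2) = -inner ℝ e w := by
    have := hwV l hlV
    rw [hle, inner_add_left, hp, inner_smul_left, real_inner_self_eq_norm_sq, hw1] at this
    simp at this
    linarith
  have hsmall : ‖p j - p i‖ ≤ ‖e‖ := by
    rw [hnp, ← abs_of_pos (half_pos hδ), ← abs_mul, hinner, abs_neg]
    exact (abs_real_inner_le_norm e w).trans (by rw [hw1, mul_one])
  have := hmin l hlL hl0
  have h2 := norm_add_le (p j - p i) e
  rw [← hle] at h2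
  linarith

/-! ### Bounded representatives modulo the arithmetic group -/

variable {d : ℕ}

/-- Two integral matrices with the same determinant, the same Gram matrix for the symplectic form
and the same residue modulo a multiple of the determinant differ by an element of `Sp(2d, ℤ)`. -/
theorem exists_mem_intSp_mul_eq {A A' : Matrix (Fin d ⊕ Fin d) (Fin d ⊕ Fin d) ℤ} {N : ℤ}
    (hA : A.det ≠ 0) (hdet : A.det = A'.det) (hN : A.det ∣ N)
    (hJ : Aᵀ * J (Fin d) ℤ * A = A'ᵀ * J (Fin d) ℤ * A') (hmod : ∀ i j, N ∣ A i j - A' i j) :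
    ∃ γ ∈ intSp d, γ.1 * rmat A' = rmat A := by
  have hdvd : ∀ i j, ∃ m : ℤ, (A * A'.adjugate) i j = A.det * m := by
    intro i j
    -- The congruence makes `A * A'.adjugate` divisible by the determinant, so `A A'⁻¹` is integral;
    -- equal Gram matrices make it symplectic.
    have h : A * A'.adjugate = (A - A') * A'.adjugate + A.det • (1 : Matrix _ _ ℤ) := by
      rw [Matrix.sub_mul, mul_adjugate, hdet, sub_add_cancel]
    rw [h]
    refine dvd_add ?_ ⟨(1 : Matrix _ _ ℤ) i j, rfl⟩
    rw [Matrix.mul_apply]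
    exact Finset.dvd_sum fun k _ => ((hN.trans (hmod i k))).mul_right _
  choose m hm using hdvd
  have hMA : A.det • (Matrix.of m * A') = A.det • A := by
    have h : A.det • Matrix.of m = A * A'.adjugate := by
      ext i j
      rw [hm]; rfl
    rw [← Matrix.smul_mul, h, Matrix.mul_assoc, adjugate_mul, hdet, Matrix.mul_smul, Matrix.mul_one]
  have hMA' : Matrix.of m * A' = A := smul_right_injective _ hA hMA
  have hr : rmat (Matrix.of m) * rmat A' = rmat A := by rw [← rmat_mul, hMA']
  have hunit : IsUnit (rmat A') := by
    rw [isUnit_iff_isUnit_det, det_rmat, isUnit_iff_ne_zero]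
    exact_mod_cast hdet ▸ hA
  have hsymp : rmat (Matrix.of m) ∈ symplecticGroup (Fin d) ℝ := by
    rw [SymplecticGroup.mem_iff']
    have h1 : (rmat A')ᵀ * ((rmat (Matrix.of m))ᵀ * J (Fin d) ℝ * rmat (Matrix.of m)) * rmat A' =
        (rmat A')ᵀ * J (Fin d) ℝ * rmat A' := by
      rw [rmat_form A' A', ← hJ, ← rmat_form, ← hr]
      simp only [transpose_mul, Matrix.mul_assoc]
    have h2 := hunit.mul_right_cancel h1
    exact ((isUnit_transpose _).2 hunit).mul_left_cancel h2
  exact ⟨⟨_, hsymp⟩, ⟨Matrix.of m, rfl⟩, hr⟩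

theorem abs_mul_apply_le {ι κ κ' : Type*} [Fintype κ] {X : Matrix ι κ ℝ} {Y : Matrix κ κ' ℝ}
    {R S : ℝ} (hX : ∀ i j, |X i j| ≤ R) (hY : ∀ i j, |Y i j| ≤ S) (i : ι) (j : κ') :
    |(X * Y) i j| ≤ Fintype.card κ * (R * S) := by
  rw [Matrix.mul_apply]
  refine (Finset.abs_sum_le_sum_abs _ _).trans ?_
  refine (Finset.sum_le_card_nsmul _ _ (R * S) fun k _ => ?_).trans (by simp)
  rw [abs_mul]
  exact mul_le_mul (hX i k) (hY k j) (abs_nonneg _) ((abs_nonneg _).trans (hX i k))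

theorem abs_J_apply_le (i j : Fin d ⊕ Fin d) : |J (Fin d) ℝ i j| ≤ 1 := by
  rcases i with i | i <;> rcases j with j | j <;> simp [J, one_apply] <;> split_ifs <;> simp

/-- If `g A` is bounded, then the determinant and the symplectic Gram matrix of `A` are bounded
integers, so with a residue they take finitely many values. Fix one `B` per value. Then `γ B = A`
for an integral symplectic `γ`, and `g γ = (g A) B⁻¹` is bounded. -/
theorem exists_bounded_translate (d : ℕ) (R : ℝ) : ∃ S : ℝ, ∀ (g : Sp d)
    (A : Matrix (Fin d ⊕ Fin d) (Fin d ⊕ Fin d) ℤ), A.det ≠ 0 →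
    (∀ i j, |(g.1 * rmat A) i j| ≤ R) → ∃ γ ∈ intSp d, ∀ i j, |(g * γ).1 i j| ≤ S := by
  classical
  let 𝒜 : Set (Matrix (Fin d ⊕ Fin d) (Fin d ⊕ Fin d) ℤ) :=
    {A | A.det ≠ 0 ∧ ∃ g : Sp d, ∀ i j, |(g.1 * rmat A) i j| ≤ R}
  obtain ⟨T, hT⟩ : ∃ T : ℕ, ∀ A ∈ 𝒜, ∀ i j, |(Aᵀ * J (Fin d) ℤ * A) i j| ≤ T := by
    set n := (Fintype.card (Fin d ⊕ Fin d) : ℝ) with hn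
    obtain ⟨T, hT⟩ := exists_nat_ge (n * (n * (R * 1) * R))
    refine ⟨T, ?_⟩
    rintro A ⟨-, g, hg⟩ i j
    have h1 : (g.1 * rmat A)ᵀ * J (Fin d) ℝ * (g.1 * rmat A) = rmat (Aᵀ * J (Fin d) ℤ * A) := by
      rw [conj_J, rmat_form]
    have h2 := (abs_mul_apply_le (abs_mul_apply_le (X := (g.1 * rmat A)ᵀ)
      (fun i j => hg j i) abs_J_apply_le) hg i j).trans hT
    rw [h1] at h2
    have h3 : |(((Aᵀ * J (Fin d) ℤ * A) i j : ℤ) : ℝ)| ≤ T := h2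
    exact_mod_cast h3
  obtain ⟨D, hD⟩ : ∃ D : ℕ, ∀ A ∈ 𝒜, |A.det| ≤ D := by
    obtain ⟨D, hD⟩ := exists_nat_ge
      ((Fintype.card (Fin d ⊕ Fin d)).factorial • R ^ Fintype.card (Fin d ⊕ Fin d))
    refine ⟨D, ?_⟩
    rintro A ⟨-, g, hg⟩
    have h1 := (Matrix.det_le (abv := AbsoluteValue.abs) hg).trans hD
    rw [det_mul, SymplecticGroup.det_eq_one g.2, one_mul, det_rmat] at h1
    have h2 : |(A.det : ℝ)| ≤ D := h1
    exact_mod_cast h2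
  -- `D!` is a common modulus divisible by every determinant that occurs.
  have hdvd : ∀ A ∈ 𝒜, A.det ∣ ((D.factorial : ℕ) : ℤ) := fun A hA =>
    Int.natAbs_dvd.1 (Int.natCast_dvd_natCast.2 (Nat.dvd_factorial
      (Int.natAbs_pos.2 hA.1) (by exact_mod_cast (Int.abs_eq_natAbs A.det) ▸ hD A hA)))
  have : NeZero D.factorial := ⟨D.factorial_ne_zero⟩
  let Φ : Matrix (Fin d ⊕ Fin d) (Fin d ⊕ Fin d) ℤ → (Fin d ⊕ Fin d → Fin d ⊕ Fin d → ℤ) × ℤ ×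
      (Fin d ⊕ Fin d → Fin d ⊕ Fin d → ZMod D.factorial) :=
    fun A => (Aᵀ * J (Fin d) ℤ * A, A.det, fun i j => (A i j : ZMod D.factorial))
  have hfin : (Φ '' 𝒜).Finite := by
    refine Set.Finite.subset ((Set.Finite.pi' fun _ => Set.Finite.pi' fun _ =>
      Set.finite_Icc (-(T : ℤ)) T).prod ((Set.finite_Icc (-(D : ℤ)) D).prod Set.finite_univ)) ?_
    rintro _ ⟨A, hA, rfl⟩
    exact ⟨fun i j => abs_le.1 (hT A hA i j), abs_le.1 (hD A hA), Set.mem_univ _⟩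
  obtain ⟨s, hs, hsΦ⟩ := Finset.subset_set_image_iff.1 (hfin.coe_toFinset).le
  refine ⟨Fintype.card (Fin d ⊕ Fin d) * (R * ∑ A ∈ s, ∑ i, ∑ j, |(rmat A)⁻¹ i j|), ?_⟩
  intro g A hA hg
  have hA' : A ∈ 𝒜 := ⟨hA, g, hg⟩
  obtain ⟨B, hB, hBA⟩ : ∃ B ∈ s, Φ B = Φ A := by
    have : Φ A ∈ hfin.toFinset := hfin.mem_toFinset.2 ⟨A, hA', rfl⟩
    rwa [← hsΦ, Finset.mem_image] at this
  obtain ⟨hBJ, hBA⟩ := Prod.ext_iff.1 hBA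
  obtain ⟨hBdet, hBmod⟩ := Prod.ext_iff.1 hBA
  obtain ⟨γ, hγ, hγA⟩ := exists_mem_intSp_mul_eq hA hBdet.symm (hdvd A hA') hBJ.symm
    fun i j => (ZMod.intCast_eq_intCast_iff_dvd_sub _ _ _).1 (congrFun (congrFun hBmod i) j)
  refine ⟨γ, hγ, fun i j => ?_⟩
  have hunit : IsUnit (rmat B).det := by
    rw [det_rmat, isUnit_iff_ne_zero]
    exact_mod_cast (hs hB).1
  have heq : (g * γ).1 = (g.1 * rmat A) * (rmat B)⁻¹ := by
    rw [← hγA, Matrix.mul_assoc, Matrix.mul_assoc, mul_nonsing_inv _ hunit, Matrix.mul_one]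
    rfl
  rw [heq]
  refine abs_mul_apply_le hg (fun i j => ?_) i j
  refine le_trans ?_ (Finset.single_le_sum (f := fun A => ∑ i, ∑ j, |(rmat A)⁻¹ i j|)
    (fun A _ => Finset.sum_nonneg fun i _ => Finset.sum_nonneg fun j _ => abs_nonneg _) hB)
  refine le_trans ?_ (Finset.single_le_sum (f := fun i => ∑ j, |(rmat B)⁻¹ i j|)
    (fun i _ => Finset.sum_nonneg fun j _ => abs_nonneg _) (Finset.mem_univ i))
  exact Finset.single_le_sum (f := fun j => |(rmat B)⁻¹ i j|) (fun j _ => abs_nonneg _)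
    (Finset.mem_univ j)

/-- Without short vectors, the bounded lattice vectors span; a basis chosen among them supplies the
integral matrix `A`. -/
theorem exists_translate_of_le_norm (d : ℕ) {δ : ℝ} (hδ : 0 < δ) : ∃ S : ℝ, ∀ g : Sp d,
    (∀ x ∈ latticeOf g, x ≠ 0 → δ ≤ ‖x‖) → ∃ γ ∈ intSp d, ∀ i j, |(g * γ).1 i j| ≤ S := by
  obtain ⟨R, hR⟩ := exists_span_bounded_eq_top (Space d) hδ
  obtain ⟨S, hS⟩ := exists_bounded_translate d R
  refine ⟨S, fun g hg => ?_⟩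
  have hL := isSymplecticLattice_latticeOf g
  obtain ⟨h1, h2⟩ := hL.isLattice
  have hspan := hR (latticeOf g) hL.unimodular hg
  obtain ⟨b, hb, hbs, hbi⟩ := exists_linearIndependent ℝ {x | x ∈ latticeOf g ∧ ‖x‖ ≤ R}
  rw [hspan] at hbs
  let B := Module.Basis.mk hbi (by rw [Subtype.range_coe, hbs])
  have : Fintype b := FiniteDimensional.fintypeBasisIndex B
  have hcard : Fintype.card b = Fintype.card (Fin d ⊕ Fin d) := by
    rw [← Module.finrank_eq_card_basis B, finrank_euclideanSpace]
  let e : Fin d ⊕ Fin d ≃ b := (Fintype.equivOfCardEq hcard).symm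
  choose z hz using fun j => mem_latticeOf.1 (hb (e j).2).1
  let A : Matrix (Fin d ⊕ Fin d) (Fin d ⊕ Fin d) ℤ := Matrix.of fun i j => z j i
  have hcol : ∀ i j, (g.1 * rmat A) i j = (e j : Space d) i := by
    intro i j
    rw [hz j]
    rfl
  have hunit : IsUnit (g.1 * rmat A) := by
    rw [← linearIndependent_cols_iff_isUnit]
    have h := (hbi.comp e e.injective).map' (WithLp.linearEquiv 2 ℝ (Fin d ⊕ Fin d → ℝ)).toLinearMap
      (LinearEquiv.ker _)
    have hcol' : (g.1 * rmat A).col =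
        (WithLp.linearEquiv 2 ℝ (Fin d ⊕ Fin d → ℝ)).toLinearMap ∘ Subtype.val ∘ e := by
      ext j i
      exact hcol i j
    rw [hcol']
    exact h
  refine hS g A (fun h0 => ?_) fun i j => ?_
  · rw [isUnit_iff_isUnit_det, det_mul, det_rmat, h0] at hunit
    simp at hunit
  · rw [hcol]
    exact (PiLp.norm_apply_le (e j : Space d) i).trans (hb (e j).2).2

theorem isCompact_bounded (d : ℕ) (S : ℝ) : IsCompact {g : Sp d | ∀ i j, |g.1 i j| ≤ S} := by
  have hc : IsClosed {A : Matrix (Fin d ⊕ Fin d) (Fin d ⊕ Fin d) ℝ |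
      A ∈ symplecticGroup (Fin d) ℝ} := by
    simp only [SymplecticGroup.mem_iff]
    exact isClosed_eq ((continuous_id.matrix_mul continuous_const).matrix_mul
      continuous_id.matrix_transpose) continuous_const
  have hK : IsCompact (Set.univ.pi fun _ => Set.univ.pi fun _ => Set.Icc (-S) S :
      Set (Fin d ⊕ Fin d → Fin d ⊕ Fin d → ℝ)) :=
    isCompact_univ_pi fun _ => isCompact_univ_pi fun _ => isCompact_Icc
  have h : {g : Sp d | ∀ i j, |g.1 i j| ≤ S} = Subtype.val ⁻¹' (Set.univ.pi fun _ =>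
      Set.univ.pi fun _ => Set.Icc (-S) S : Set (Fin d ⊕ Fin d → Fin d ⊕ Fin d → ℝ)) := by
    ext g
    exact ⟨fun h i _ j _ => abs_le.1 (h i j), fun h i j => abs_le.2 (h i trivial j trivial)⟩
  rw [h]
  exact hc.isClosedEmbedding_subtypeVal.isCompact_preimage hK

/-- An integral vector, as a matrix with one column. -/
def colMat {ι : Type*} (z : ι → ℤ) : Matrix ι (Fin 1) ℤ := Matrix.of fun i _ => z i

theorem isFrame_colMat {z : Fin d ⊕ Fin d → ℤ} (hz : z ≠ 0) : IsFrame (colMat z) := by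
  intro v hv
  obtain ⟨i, hi⟩ := Function.ne_iff.1 hz
  have h := congrFun hv i
  simp only [colMat, mulVec, dotProduct, Finset.univ_unique, Finset.sum_singleton, of_apply,
    Pi.zero_apply, mul_eq_zero] at h
  ext j
  rw [Subsingleton.elim j default]
  exact h.resolve_left hi

theorem isIsotropic_colMat (z : Fin d ⊕ Fin d → ℤ) : IsIsotropic (colMat z) := by
  have h : ((colMat z)ᵀ * J (Fin d) ℤ * colMat z)ᵀ = -((colMat z)ᵀ * J (Fin d) ℤ * colMat z) := by
    simp [transpose_mul, J_transpose, Matrix.mul_assoc]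
  ext i j
  have h1 := congrFun (congrFun h i) j
  rw [transpose_apply, Subsingleton.elim j i, Matrix.neg_apply] at h1
  rw [Subsingleton.elim j i]
  exact self_eq_neg.1 h1

theorem vol_colMat (g : Sp d) (z : Fin d ⊕ Fin d → ℤ) :
    vol (g.1 * rmat (colMat z)) = ‖(WithLp.toLp 2 (g.1 *ᵥ fun i => (z i : ℝ)) : Space d)‖ := by
  rw [vol, gramDet, det_unique, EuclideanSpace.norm_eq]
  congr 1
  rw [Matrix.mul_apply]
  refine Finset.sum_congr rfl fun i _ => ?_
  rw [Real.norm_eq_abs, sq_abs, sq]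
  rfl

/-- A nonzero lattice vector is an isotropic frame of rank one, and its weight is a power of its
inverse length. -/
theorem exists_le_norm_of_margulis_le (hd : 1 ≤ d) {ε : ℝ} (hε : 0 < ε) (M : ℝ) :
    ∃ δ : ℝ, 0 < δ ∧ ∀ g : Sp d, margulis ε g ≤ M → ∀ x ∈ latticeOf g, x ≠ 0 → δ ≤ ‖x‖ := by
  -- The maximum with `1` gives `M' ≤ M' ^ d`, which avoids a `d`-th root.
  set M' : ℝ := max 1 (M / ε ^ margulisExp d 1) with hM'
  have hM1 : 1 ≤ M' := le_max_left _ _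
  refine ⟨M'⁻¹, by positivity, fun g hg x hx hx0 => ?_⟩
  obtain ⟨z, rfl⟩ := mem_latticeOf.1 hx
  have hz : z ≠ 0 := by
    rintro rfl
    refine hx0 ?_
    ext i
    simp [mulVec, dotProduct]
  have h1 : weight g (colMat z) ≤ M' ^ d := by
    calc weight g (colMat z) ≤ phi 1 g :=
          weight_le_phi g ⟨colMat z, isFrame_colMat hz, isIsotropic_colMat z⟩
      _ ≤ M / ε ^ margulisExp d 1 :=
          (le_div_iff₀' (by positivity)).2 ((margulisTerm_le hε.le g (by omega)).trans hg)
      _ ≤ M' := le_max_right _ _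
      _ ≤ M' ^ d := le_self_pow₀ hM1 (by omega)
  rw [weight, vol_colMat] at h1
  have h2 := (pow_le_pow_iff_left₀ (inv_nonneg.2 (norm_nonneg _)) (by positivity) (by omega)).1 h1
  exact inv_le_of_inv_le₀ (norm_pos_iff.2 hx0) h2

/-- By Mahler's criterion every point of the sublevel set has a translate in one fixed compact set.
-/
theorem haar_fundSet_inter_margulis_le (hd : 1 ≤ d) {ε : ℝ} (hε : 0 < ε) (M : ℝ) :
    (Measure.haar : Measure (Sp d)) (fundSet d ∩ {g | margulis ε g ≤ M}) < ∞ := by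
  obtain ⟨δ, hδ, hle⟩ := exists_le_norm_of_margulis_le hd hε M
  obtain ⟨S, hS⟩ := exists_translate_of_le_norm d hδ
  exact (measure_le_of_translate_cover (C := {g | ∀ i j, |g.1 i j| ≤ S}) Set.inter_subset_left fun g hg =>
    hS g (hle g hg.2)).trans_lt (isCompact_bounded d S).measure_lt_top

end Mahler

/-! ### Finiteness of the measure and integrability of the Margulis function -/

section Finiteness

variable {d : ℕ}

theorem exists_setLIntegral_margulis_lt_top (hd : 1 ≤ d) : ∃ ε : ℝ, 0 < ε ∧
    (Measure.haar : Measure (Sp d)) (fundSet d) < ∞ ∧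
      ∫⁻ g in fundSet d, ENNReal.ofReal (margulis ε g) ∂Measure.haar < ∞ := by
  obtain ⟨ε, I, hI, w, h, c, hε, hw, hw1, hc0, hc1, hdrift⟩ := exists_margulis_drift hd
  have hmeas : Measurable fun g : Sp d => ENNReal.ofReal (margulis ε g) :=
    (measurable_margulis ε).ennreal_ofReal
  have hkey := measure_lt_top_and_lintegral_lt_top_of_drift
    (m := (Measure.haar : Measure (Sp d)).restrict (fundSet d))
    (f := fun g => ENNReal.ofReal (margulis ε g)) (T := fun i g => h i * g)
    (w := fun i => ENNReal.ofReal (w i)) (c := ENNReal.ofReal c) (b := 1) hmeas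
    (fun i => hmeas.comp (measurable_const_mul (h i))) (fun _ => ENNReal.ofReal_ne_top)
    (by rw [← ENNReal.ofReal_sum_of_nonneg fun i _ => hw i, hw1, ENNReal.ofReal_one])
    (fun i R => setLIntegral_fundSet_mul_left (fun g => R - ENNReal.ofReal (margulis ε g))
      (fun g γ hγ => by rw [margulis_mul ε g hγ]) (h i))
    (by rw [← ENNReal.ofReal_one]; exact (ENNReal.ofReal_lt_ofReal_iff one_pos).2 hc1)
    ENNReal.one_ne_top (fun g => ?_) fun R hR => ?_
  · rw [Measure.restrict_apply_univ] at hkey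
    exact ⟨ε, hε, hkey⟩
  · have h1 := ENNReal.ofReal_le_ofReal (hdrift g)
    rw [ENNReal.ofReal_sum_of_nonneg fun i _ => mul_nonneg (hw i) (margulis_nonneg hε.le _),
      ENNReal.ofReal_add (mul_nonneg hc0 (margulis_nonneg hε.le g)) zero_le_one,
      ENNReal.ofReal_mul hc0, ENNReal.ofReal_one] at h1
    simpa only [ENNReal.ofReal_mul (hw _)] using h1
  · have hset : {g : Sp d | ENNReal.ofReal (margulis ε g) ≤ R} = {g | margulis ε g ≤ R.toReal} := by
      ext g
      exact ENNReal.ofReal_le_iff_le_toReal hR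
    rw [hset, Measure.restrict_apply (measurableSet_le (measurable_margulis ε) measurable_const),
      Set.inter_comm]
    exact (haar_fundSet_inter_margulis_le hd hε _).ne

end Finiteness

/-! ### The height function in terms of integral frames -/

section Height

/-- The covolume of a lattice is the square root of the Gram determinant of a basis. -/
theorem covolume_eq_sqrt_det_inner {E : Type*} [NormedAddCommGroup E] [InnerProductSpace ℝ E]
    [FiniteDimensional ℝ E] [MeasurableSpace E] [BorelSpace E] (L : Submodule ℤ E)
    [DiscreteTopology L] [IsZLattice ℝ L] {k : ℕ} (b : Module.Basis (Fin k) ℤ L)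
    (hk : Module.finrank ℝ E = k) :
    ZLattice.covolume L volume =
      √(Matrix.of fun i j => inner ℝ (b i : E) (b j : E)).det := by
  subst hk
  let o := stdOrthonormalBasis ℝ E
  have hvol : volume.real (ZSpan.fundamentalDomain o.toBasis) = 1 := by
    rw [measureReal_congr (ZSpan.fundamentalDomain_ae_parallelepiped o.toBasis volume)]
    have : volume (parallelepiped o.toBasis) = 1 := by simpa using o.volume_parallelepiped
    rw [Measure.real, this, ENNReal.toReal_one]
  rw [ZLattice.covolume_eq_det_mul_measureReal L volume b o.toBasis, hvol, mul_one,
    ← Real.sqrt_sq_eq_abs]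
  congr 1
  rw [Module.Basis.det_apply, sq]
  nth_rewrite 1 [← det_transpose]
  rw [← det_mul]
  congr 1
  ext i j
  rw [Matrix.mul_apply, of_apply, ← o.sum_inner_mul_inner]
  refine Finset.sum_congr rfl fun l _ => ?_
  rw [transpose_apply, Module.Basis.toMatrix_apply, Module.Basis.toMatrix_apply,
    OrthonormalBasis.coe_toBasis_repr_apply, OrthonormalBasis.coe_toBasis_repr_apply,
    o.repr_apply_apply, o.repr_apply_apply, real_inner_comm]
  rfl

variable {d : ℕ}

/-- The columns of `c` are the integral coordinates of a `ℤ`-basis of `V ∩ Λ`; injectivity of `g`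
transfers the generating property. -/
theorem exists_frame_covolume_eq (g : Sp d) (V : Submodule ℝ (Space d))
    (hV : IsLattice (inter (latticeOf g) V)) :
    ∃ c : Matrix (Fin d ⊕ Fin d) (Fin (Module.finrank ℝ V)) ℤ, IsFrame c ∧
      ZLattice.covolume (inter (latticeOf g) V) volume = vol (g.1 * rmat c) ∧
      ∀ z : Fin d ⊕ Fin d → ℤ, (WithLp.toLp 2 (g.1 *ᵥ fun i => (z i : ℝ)) : Space d) ∈ V →
        ∃ v, z = c *ᵥ v := by
  obtain ⟨h1, h2⟩ := hV
  let B := Module.finBasisOfFinrankEq ℤ (inter (latticeOf g) V) (ZLattice.rank ℝ _)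
  have hmem : ∀ j, ((B j : V) : Space d) ∈ latticeOf g := fun j => (B j).2
  choose z hz using fun j => mem_latticeOf.1 (hmem j)
  let c : Matrix (Fin d ⊕ Fin d) (Fin (Module.finrank ℝ V)) ℤ := Matrix.of fun i j => z j i
  have hcov : ZLattice.covolume (inter (latticeOf g) V) volume = vol (g.1 * rmat c) := by
    rw [covolume_eq_sqrt_det_inner _ B rfl, vol, gramDet]
    congr 2
    ext i j
    rw [of_apply, Submodule.coe_inner, hz, hz, Matrix.mul_apply]
    simp only [PiLp.inner_apply]
    refine Finset.sum_congr rfl fun l _ => ?_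
    rw [RCLike.inner_apply, conj_trivial, mul_comm]
    rfl
  have hg0 : gramDet (g.1 * rmat c) ≠ 0 := fun h0 => by
    refine ZLattice.covolume_ne_zero (inter (latticeOf g) V) volume ?_
    rw [hcov, vol, h0, Real.sqrt_zero]
  refine ⟨c, ?_, hcov, fun x hx => ?_⟩
  · rw [isFrame_iff_gramDet, gramDet_ne_zero_iff]
    intro v hv
    refine gramDet_ne_zero_iff.1 hg0 v ?_
    rw [← mulVec_mulVec, hv, mulVec_zero]
  · let y : inter (latticeOf g) V := ⟨⟨_, hx⟩, mem_latticeOf.2 ⟨x, rfl⟩⟩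
    refine ⟨fun j => B.repr y j, ?_⟩
    have h4 : (∑ j, B.repr y j • ((B j : V) : Space d)) =
        WithLp.toLp 2 (g.1 *ᵥ fun i => (x i : ℝ)) := by
      have h3 := congrArg ((V.subtype.restrictScalars ℤ).comp (inter (latticeOf g) V).subtype)
        (B.sum_repr y)
      rw [map_sum] at h3
      simp only [map_smul] at h3
      exact h3
    have h5 : g.1 *ᵥ (fun i => (x i : ℝ)) = g.1 *ᵥ fun i => ((c *ᵥ fun j => B.repr y j) i : ℝ) := by
      rw [← rmat_mulVec, mulVec_mulVec]
      ext i
      have h6 := congrArg (fun u : Space d => u i) h4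
      simp only [WithLp.ofLp_sum, Finset.sum_apply] at h6
      rw [← h6, mulVec, dotProduct]
      refine Finset.sum_congr rfl fun j _ => ?_
      rw [hz, ← Int.cast_smul_eq_zsmul ℝ, PiLp.smul_apply, smul_eq_mul, mul_comm]
      rfl
    have h6 := mulVec_injective_of_isUnit (A := g.1) ((isUnit_iff_isUnit_det _).2
      (by rw [SymplecticGroup.det_eq_one g.2]; exact isUnit_one)) h5
    ext i
    exact Int.cast_injective (α := ℝ) (congrFun h6 i)

/-- For `V` the real span of `g b`, the lattice generated by `g b` has finite index in `V ∩ Λ`, so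
its volume is at least the covolume. -/
theorem exists_le_covolume_inv (g : Sp d) {k : ℕ} (hk : 1 ≤ k)
    {b : Matrix (Fin d ⊕ Fin d) (Fin k) ℤ} (hb : IsFrame b) :
    ∃ V : Submodule ℝ (Space d), V ≠ ⊥ ∧ IsLattice (inter (latticeOf g) V) ∧
      (vol (g.1 * rmat b))⁻¹ ≤ (ZLattice.covolume (inter (latticeOf g) V) volume)⁻¹ := by
  let v : Fin k → Space d := fun j => WithLp.toLp 2 (g.1 *ᵥ fun i => (b i j : ℝ))
  have hvL : ∀ j, v j ∈ latticeOf g := fun j => mem_latticeOf.2 ⟨fun i => b i j, rfl⟩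
  have hvi : LinearIndependent ℝ v := by
    rw [Fintype.linearIndependent_iff]
    intro a ha
    have h := gramDet_ne_zero_iff.1 (hb.gramDet_ne_zero g) a ?_
    · exact congrFun h
    · ext i
      have h6 := congrArg (fun u : Space d => u i) ha
      simp only [WithLp.ofLp_sum, Finset.sum_apply] at h6
      refine Eq.trans ?_ h6
      rw [mulVec, dotProduct]
      refine Finset.sum_congr rfl fun j _ => ?_
      rw [PiLp.smul_apply, smul_eq_mul, mul_comm]
      rfl
  let V := Submodule.span ℝ (Set.range v)
  have hvV : ∀ j, v j ∈ V := fun j => Submodule.subset_span ⟨j, rfl⟩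
  have hrank : Module.finrank ℝ V = k := by
    rw [finrank_span_eq_card hvi, Fintype.card_fin]
  have hlat : IsLattice (inter (latticeOf g) V) := by
    obtain ⟨h1, h2⟩ := (isSymplecticLattice_latticeOf g).isLattice
    have h3 : Continuous fun x : inter (latticeOf g) V => (⟨x.1.1, x.2⟩ : latticeOf g) :=
      (continuous_subtype_val.comp continuous_subtype_val).subtype_mk _
    have h4 : DiscreteTopology (inter (latticeOf g) V) :=
      DiscreteTopology.of_continuous_injective h3 fun x y hxy =>
        Subtype.ext (Subtype.ext (congrArg (fun u : latticeOf g => (u : Space d)) hxy))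
    refine ⟨h4, ⟨top_le_iff.1 ((Submodule.span_span_coe_preimage (R := ℝ)
      (s := Set.range v)).ge.trans (Submodule.span_mono ?_))⟩⟩
    rintro x ⟨j, hj⟩
    change (x : Space d) ∈ latticeOf g
    exact hj ▸ hvL j
  refine ⟨V, fun h0 => ?_, hlat, ?_⟩
  · rw [h0, finrank_bot] at hrank
    omega
  · obtain ⟨c, hc, hcov, hmem⟩ := exists_frame_covolume_eq g V hlat
    rw [hcov]
    choose a ha using fun j => hmem (fun i => b i j) (hvV j)
    have hbc : b = c * Matrix.of fun i j => a j i := by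
      ext i j
      exact congrFun (ha j) i
    have h := gramDet_le_of_eq_mul hb (by simp [hrank]) hbc g.1
    have hpos : 0 < gramDet (g.1 * rmat c) :=
      (gramDet_nonneg _).lt_of_ne' (hc.gramDet_ne_zero g)
    exact inv_anti₀ (Real.sqrt_pos.2 hpos) (Real.sqrt_le_sqrt h)

/-- The height of `g ℤ^{2d}` is the supremum of the inverse volumes of the integral frames. -/
theorem alpha_orbitMap (g : Sp d) : alpha (orbitMap g) =
    ⨆ (k : ℕ) (b : {b : Matrix (Fin d ⊕ Fin d) (Fin (k + 1)) ℤ // IsFrame b}),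
      ENNReal.ofReal (vol (g.1 * rmat b.1))⁻¹ := by
  apply le_antisymm
  · refine iSup₂_le ?_
    rintro V ⟨hV, hlat⟩
    obtain ⟨c, hc, hcov, -⟩ := exists_frame_covolume_eq g V hlat
    change ENNReal.ofReal (ZLattice.covolume (inter (latticeOf g) V) volume)⁻¹ ≤ _
    rw [hcov]
    obtain ⟨k, hk⟩ : ∃ k, Module.finrank ℝ V = k + 1 :=
      Nat.exists_eq_succ_of_ne_zero fun h => hV (Submodule.finrank_eq_zero.1 h)
    clear hcov
    revert c
    rw [hk]
    intro c hc
    exact le_iSup₂_of_le (f := fun k (b : {b : Matrix (Fin d ⊕ Fin d) (Fin (k + 1)) ℤ //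
      IsFrame b}) => ENNReal.ofReal (vol (g.1 * rmat b.1))⁻¹) k ⟨c, hc⟩ le_rfl
  · refine iSup₂_le fun k b => ?_
    obtain ⟨V, hV, hlat, hle⟩ := exists_le_covolume_inv g (Nat.succ_pos k) b.2
    exact le_iSup₂_of_le V ⟨hV, hlat⟩ (ENNReal.ofReal_le_ofReal hle)

/-- Integral frames turn the supremum over all subspaces into a countable supremum of measurable
functions. -/
theorem measurable_alpha (d : ℕ) : Measurable (alpha (d := d)) := by
  have h : Measurable fun g : Sp d => alpha (orbitMap g) := by
    simp only [alpha_orbitMap]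
    refine Measurable.iSup fun k => ?_
    have : Countable (Matrix (Fin d ⊕ Fin d) (Fin (k + 1)) ℤ) :=
      inferInstanceAs (Countable (Fin d ⊕ Fin d → Fin (k + 1) → ℤ))
    refine Measurable.iSup fun b => ?_
    have hc : Continuous fun g : Sp d => g.1 * rmat b.1 :=
      continuous_subtype_val.matrix_mul continuous_const
    exact ((hc.matrix_transpose.matrix_mul hc).matrix_det.sqrt).measurable.inv.ennreal_ofReal
  exact fun s hs => h hs

end Height

/-! ### Integrability of the height -/

section Upper

variable {d : ℕ}

/-- Each frame is replaced by an isotropic one at the cost of `√K`, whose weight is a term of the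
Margulis function up to a fixed power of `ε`. -/
theorem exists_alpha_pow_le_margulis (hd : 1 ≤ d) {ε : ℝ} (hε : 0 < ε) : ∃ C : ℝ, 0 ≤ C ∧
    ∀ g : Sp d, alpha (orbitMap g) ^ d ≤ ENNReal.ofReal C * ENNReal.ofReal (margulis ε g) := by
  obtain ⟨K, hK, hle⟩ := exists_isotropic_le d
  set E : ℝ := ∑ k ∈ Finset.range (2 * d + 1), (ε ^ margulisExp d k)⁻¹ with hE
  have hE0 : 0 ≤ E := Finset.sum_nonneg fun k _ => by positivity
  refine ⟨√K ^ d * E, by positivity, fun g => ?_⟩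
  have hF := margulis_nonneg hε.le g
  -- The bound is tested against its `d`-th root, so that the supremum can be taken before the
  -- power.
  set y : ℝ := (√K ^ d * E * margulis ε g) ^ ((d : ℝ)⁻¹) with hy
  have hy0 : 0 ≤ y := Real.rpow_nonneg (by positivity) _
  have hyd : y ^ d = √K ^ d * E * margulis ε g :=
    Real.rpow_inv_natCast_pow (by positivity) (by omega)
  have hα : alpha (orbitMap g) ≤ ENNReal.ofReal y := by
    rw [alpha_orbitMap]
    refine iSup₂_le fun k b => ENNReal.ofReal_le_ofReal ?_
    refine le_of_pow_le_pow_left₀ (by omega : d ≠ 0) hy0 ?_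
    obtain ⟨r, -, c, hc, hci, hcb⟩ := hle b.1 b.2
    have hr : r ≤ 2 * d := by
      simpa [two_mul] using card_le_of_gramDet_ne_zero (isFrame_iff_gramDet.1 hc)
    have h1 : vol (g.1 * rmat c) ≤ √K * vol (g.1 * rmat b.1) := by
      rw [vol, vol, ← Real.sqrt_mul (by linarith)]
      exact Real.sqrt_le_sqrt (hcb g)
    have h2 : (vol (g.1 * rmat b.1))⁻¹ ≤ √K * (vol (g.1 * rmat c))⁻¹ := by
      rw [inv_eq_one_div, ← div_eq_mul_inv, div_le_div_iff₀ (vol_pos b.2 g) (vol_pos hc g), one_mul]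
      exact h1
    calc (vol (g.1 * rmat b.1))⁻¹ ^ d ≤ (√K * (vol (g.1 * rmat c))⁻¹) ^ d :=
          pow_le_pow_left₀ (inv_nonneg.2 (vol_pos b.2 g).le) h2 d
      _ = √K ^ d * weight g c := mul_pow _ _ _
      _ ≤ √K ^ d * phi r g :=
          mul_le_mul_of_nonneg_left (weight_le_phi g ⟨c, hc, hci⟩) (by positivity)
      _ = √K ^ d * ((ε ^ margulisExp d r)⁻¹ * (ε ^ margulisExp d r * phi r g)) := by
          rw [inv_mul_cancel_left₀ (by positivity)]
      _ ≤ √K ^ d * (E * margulis ε g) := by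
          refine mul_le_mul_of_nonneg_left (mul_le_mul ?_ (margulisTerm_le hε.le g hr)
            (margulisTerm_nonneg hε.le g r) hE0) (by positivity)
          exact Finset.single_le_sum (f := fun k => (ε ^ margulisExp d k)⁻¹)
            (fun k _ => by positivity) (Finset.mem_range.2 (by omega))
      _ = y ^ d := by rw [hyd, mul_assoc]
  calc alpha (orbitMap g) ^ d ≤ ENNReal.ofReal y ^ d := pow_le_pow_left' hα d
    _ = ENNReal.ofReal (√K ^ d * E * margulis ε g) := by rw [← ENNReal.ofReal_pow hy0, hyd]
    _ = _ := ENNReal.ofReal_mul (by positivity)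

theorem quotientMeasure_univ (d : ℕ) :
    quotientMeasure d Set.univ = (Measure.haar : Measure (Sp d)) (fundSet d) := by
  rw [quotientMeasure_eq_map, Measure.map_apply measurable_orbitMap MeasurableSet.univ,
    Set.preimage_univ, Measure.restrict_apply_univ]

theorem quotientMeasure_univ_ne_zero (d : ℕ) : quotientMeasure d Set.univ ≠ 0 := by
  rw [quotientMeasure_univ]
  exact (isFundamentalDomain_fundSet d).measure_ne_zero (NeZero.ne _)

theorem quotientMeasure_univ_ne_top (hd : 1 ≤ d) : quotientMeasure d Set.univ ≠ ∞ := by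
  obtain ⟨ε, -, h, -⟩ := exists_setLIntegral_margulis_lt_top hd
  rw [quotientMeasure_univ]
  exact h.ne

theorem lintegral_alpha_pow_lt_top (hd : 1 ≤ d) :
    ∫⁻ Λ, alpha Λ ^ d ∂quotientMeasure d < ∞ := by
  obtain ⟨ε, hε, -, h⟩ := exists_setLIntegral_margulis_lt_top hd
  obtain ⟨C, -, hle⟩ := exists_alpha_pow_le_margulis hd hε
  rw [quotientMeasure_eq_map, lintegral_map ((measurable_alpha d).pow_const d) measurable_orbitMap]
  calc _ ≤ ∫⁻ g in fundSet d, ENNReal.ofReal C * ENNReal.ofReal (margulis ε g) ∂Measure.haar :=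
        lintegral_mono hle
    _ = ENNReal.ofReal C * ∫⁻ g in fundSet d, ENNReal.ofReal (margulis ε g) ∂Measure.haar :=
        lintegral_const_mul _ (measurable_margulis ε).ennreal_ofReal
    _ < ∞ := ENNReal.mul_lt_top ENNReal.ofReal_lt_top h

theorem isProbabilityMeasure_mu (hd : 1 ≤ d) : IsProbabilityMeasure (mu d) where
  measure_univ := by
    rw [mu, Measure.smul_apply, smul_eq_mul]
    exact ENNReal.inv_mul_cancel (quotientMeasure_univ_ne_zero d) (quotientMeasure_univ_ne_top hd)

theorem memLp_alpha_iff {n : ℕ} (hn : n ≠ 0) :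
    MemLp (alpha (d := d)) n (mu d) ↔ ∫⁻ Λ, alpha Λ ^ n ∂mu d < ∞ := by
  have h : ∀ Λ : Y d, ‖alpha Λ‖ₑ ^ (n : ℝ≥0∞).toReal = alpha Λ ^ n := fun Λ => by
    rw [enorm_eq_self, ENNReal.toReal_natCast, ENNReal.rpow_natCast]
  rw [MemLp, eLpNorm_lt_top_iff_lintegral_rpow_enorm_lt_top (by exact_mod_cast hn)
    (ENNReal.natCast_ne_top n)]
  simp only [h, and_iff_right_iff_imp]
  exact fun _ => (measurable_alpha d).aestronglyMeasurable

theorem memLp_alpha (hd : 1 ≤ d) {p : ℝ} (hp : p ≤ d) :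
    MemLp (alpha (d := d)) (ENNReal.ofReal p) (mu d) := by
  have := isProbabilityMeasure_mu hd
  have h : MemLp (alpha (d := d)) d (mu d) := by
    rw [memLp_alpha_iff (by omega), mu, lintegral_smul_measure, smul_eq_mul]
    exact ENNReal.mul_lt_top (ENNReal.inv_lt_top.2 (quotientMeasure_univ_ne_zero d).bot_lt)
      (lintegral_alpha_pow_lt_top hd)
  refine h.mono_exponent ?_
  rw [← ENNReal.ofReal_natCast]
  exact ENNReal.ofReal_le_ofReal hp

theorem exists_mu_le_alpha_le (hd : 1 ≤ d) {p : ℝ} (hp0 : 0 < p) (hp : p ≤ d) :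
    ∃ C : ℝ, ∀ L : ℝ, 0 < L →
      mu d {Λ | ENNReal.ofReal L ≤ alpha Λ} ≤ ENNReal.ofReal (C * L ^ (-p)) := by
  have h := (memLp_alpha hd hp).2
  rw [eLpNorm_lt_top_iff_lintegral_rpow_enorm_lt_top (by simpa using hp0) ENNReal.ofReal_ne_top,
    ENNReal.toReal_ofReal hp0.le] at h
  simp only [enorm_eq_self] at h
  refine ⟨(∫⁻ Λ, alpha Λ ^ p ∂mu d).toReal, fun L hL => ?_⟩
  have h1 := mul_meas_ge_le_lintegral (μ := mu d) ((measurable_alpha d).pow_const p)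
    (ENNReal.ofReal L ^ p)
  have h2 : {Λ : Y d | ENNReal.ofReal L ^ p ≤ alpha Λ ^ p} = {Λ | ENNReal.ofReal L ≤ alpha Λ} := by
    ext Λ
    exact ENNReal.rpow_le_rpow_iff hp0
  rw [h2, ENNReal.ofReal_rpow_of_pos hL] at h1
  rw [ENNReal.ofReal_mul ENNReal.toReal_nonneg, ENNReal.ofReal_toReal h.ne, Real.rpow_neg hL.le,
    ENNReal.ofReal_inv_of_pos (Real.rpow_pos_of_pos hL p), ← div_eq_mul_inv,
    ENNReal.le_div_iff_mul_le (Or.inl ?_) (Or.inl ENNReal.ofReal_ne_top), mul_comm]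
  · exact h1
  · simpa using Real.rpow_pos_of_pos hL p

end Upper

/-! ### The height is not in `L^{d+1}` -/

section Lower

variable {d : ℕ}

/-- The positive integer `n`, as an inverse scalar matrix. -/
def natScalar (d n : ℕ) [NeZero n] : (Matrix (Fin d) (Fin d) ℝ)ˣ :=
  ⟨diagonal fun _ => (n : ℝ)⁻¹, diagonal fun _ => (n : ℝ), by
    rw [diagonal_mul_diagonal]; simp, by rw [diagonal_mul_diagonal]; simp⟩

/-- The diagonal entries of the cusp element `diag(n⁻¹, n)`. -/
def cuspEntry (d n : ℕ) : Fin d ⊕ Fin d → ℝ := Sum.elim (fun _ => (n : ℝ)⁻¹) fun _ => (n : ℝ)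

/-- The element `diag(n⁻¹, n)`, which moves lattices into the cusp. -/
def cusp (d n : ℕ) [NeZero n] : Sp d := levi (natScalar d n)

theorem cusp_val (d n : ℕ) [NeZero n] : (cusp d n).1 = diagonal (cuspEntry d n) := by
  change fromBlocks (diagonal fun _ => (n : ℝ)⁻¹) 0 0 (diagonal fun _ => (n : ℝ))ᵀ = _
  rw [diagonal_transpose, fromBlocks_diagonal]
  rfl

/-- The frame spanning the first Lagrangian coordinate subspace. -/
def lagrangian (d : ℕ) : Matrix (Fin d ⊕ Fin d) (Fin d) ℤ := fromRows 1 0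

theorem lagrangian_transpose_mul_self : (lagrangian d)ᵀ * lagrangian d = 1 := by
  simp [lagrangian, transpose_fromRows, fromCols_mul_fromRows]

theorem isFrame_lagrangian : IsFrame (lagrangian d) := by
  intro v hv
  have := congrArg ((lagrangian d)ᵀ *ᵥ ·) hv
  simpa [mulVec_mulVec, lagrangian_transpose_mul_self] using this

theorem vol_one_mul_lagrangian : vol ((1 : Sp d).1 * rmat (lagrangian d)) = 1 := by
  have h : (1 : Sp d).1 * rmat (lagrangian d) = rmat (lagrangian d) := Matrix.one_mul _
  rw [h, vol, gramDet, ← rmat_transpose, ← rmat_mul, lagrangian_transpose_mul_self, det_rmat]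
  simp

theorem cusp_mul_lagrangian (n : ℕ) [NeZero n] : (cusp d n).1 * rmat (lagrangian d) =
    rmat (lagrangian d) * (diagonal fun _ => (n : ℝ)⁻¹ : Matrix (Fin d) (Fin d) ℝ) := by
  rw [cusp_val]
  ext i j
  rw [diagonal_mul, mul_diagonal]
  rcases i with i | i
  · exact mul_comm _ _
  · simp [rmat, lagrangian]

/-- The cusp element acts on the Lagrangian as the scalar `n⁻¹`, for any left factor `u`. -/
theorem vol_mul_cusp_lagrangian (u : Sp d) (n : ℕ) [NeZero n] :
    vol ((u * cusp d n).1 * rmat (lagrangian d)) =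
      ((n : ℝ) ^ d)⁻¹ * vol (u.1 * rmat (lagrangian d)) := by
  have h : (u * cusp d n).1 * rmat (lagrangian d) =
      u.1 * rmat (lagrangian d) * (diagonal fun _ => (n : ℝ)⁻¹ : Matrix (Fin d) (Fin d) ℝ) := by
    rw [Matrix.mul_assoc, ← cusp_mul_lagrangian, ← Matrix.mul_assoc]
    rfl
  rw [h, vol, gramDet_mul, Real.sqrt_mul (sq_nonneg _), Real.sqrt_sq, vol]
  · simp
  · rw [det_diagonal]
    exact Finset.prod_nonneg fun _ _ => by positivity

theorem le_alpha_orbitMap (hd : 1 ≤ d) (g : Sp d) :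
    ENNReal.ofReal (vol (g.1 * rmat (lagrangian d)))⁻¹ ≤ alpha (orbitMap g) := by
  obtain ⟨V, hV, hlat, hle⟩ := exists_le_covolume_inv g hd isFrame_lagrangian
  exact le_iSup₂_of_le V ⟨hV, hlat⟩ (ENNReal.ofReal_le_ofReal hle)

/-- The integral symplectic matrices that the cusp element conjugates close to the identity are
unipotent with symmetric off-diagonal block of bounded size. -/
theorem eq_fromBlocks_of_conj_mem_nearOne {n : ℕ} [NeZero n] {γ : Sp d}
    {M : Matrix (Fin d ⊕ Fin d) (Fin d ⊕ Fin d) ℤ} (hM : γ.1 = rmat M)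
    (h : cusp d n * γ * (cusp d n)⁻¹ ∈ nearOne d 1) :
    M = fromBlocks 1 M.toBlocks₁₂ 0 1 ∧ (M.toBlocks₁₂)ᵀ = M.toBlocks₁₂ ∧
      ∀ i j, |M.toBlocks₁₂ i j| ≤ (n : ℤ) ^ 2 := by
  have hn : (1 : ℝ) ≤ n := by exact_mod_cast NeZero.one_le
  have hn0 : (0 : ℝ) < n := by linarith
  set w := cusp d n * γ * (cusp d n)⁻¹ with hw
  have hwc : w.1 * diagonal (cuspEntry d n) = diagonal (cuspEntry d n) * rmat M := by
    rw [← cusp_val, ← hM]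
    have : w * cusp d n = cusp d n * γ := by rw [hw, inv_mul_cancel_right]
    exact congrArg Subtype.val this
  -- Conjugation fixes the diagonal blocks, divides the upper right one by `n²` and multiplies the
  -- lower left one by `n²`.
  have hent : ∀ i j, w.1 i j * cuspEntry d n j = cuspEntry d n i * (M i j : ℝ) := by
    intro i j
    have := congrFun (congrFun hwc i) j
    rwa [mul_diagonal, diagonal_mul] at this
  rw [mem_nearOne] at h
  have hint : ∀ {a : ℤ}, |(a : ℝ)| < 1 → a = 0 := fun {a} ha => by
    have : |a| < 1 := by exact_mod_cast ha
    exact Int.abs_lt_one_iff.1 this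
  have h11 : M.toBlocks₁₁ = 1 := by
    ext i j
    have h1 := hent (Sum.inl i) (Sum.inl j)
    have h2 := h (Sum.inl i) (Sum.inl j)
    simp only [cuspEntry, Sum.elim_inl] at h1
    rw [mul_comm] at h1
    rw [mul_left_cancel₀ (inv_ne_zero hn0.ne') h1, one_apply] at h2
    have h3 : |((M (Sum.inl i) (Sum.inl j) - (1 : Matrix (Fin d) (Fin d) ℤ) i j : ℤ) : ℝ)| < 1 := by
      rw [one_apply]
      simpa using h2
    exact sub_eq_zero.1 (hint h3)
  have h22 : M.toBlocks₂₂ = 1 := by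
    ext i j
    have h1 := hent (Sum.inr i) (Sum.inr j)
    have h2 := h (Sum.inr i) (Sum.inr j)
    simp only [cuspEntry, Sum.elim_inr] at h1
    rw [mul_comm] at h1
    rw [mul_left_cancel₀ hn0.ne' h1, one_apply] at h2
    have h3 : |((M (Sum.inr i) (Sum.inr j) - (1 : Matrix (Fin d) (Fin d) ℤ) i j : ℤ) : ℝ)| < 1 := by
      rw [one_apply]
      simpa using h2
    exact sub_eq_zero.1 (hint h3)
  have h21 : M.toBlocks₂₁ = 0 := by
    ext i j
    have h1 := hent (Sum.inr i) (Sum.inl j)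
    have h2 := h (Sum.inr i) (Sum.inl j)
    simp only [cuspEntry, Sum.elim_inr, Sum.elim_inl] at h1
    rw [one_apply_ne (by simp), sub_zero] at h2
    refine hint (a := M (Sum.inr i) (Sum.inl j)) ?_
    have h3 : (M (Sum.inr i) (Sum.inl j) : ℝ) = w.1 (Sum.inr i) (Sum.inl j) / (n * n) := by
      field_simp at h1 ⊢
      linarith
    rw [h3, abs_div, abs_of_pos (mul_pos hn0 hn0), div_lt_one (mul_pos hn0 hn0)]
    nlinarith
  have h12 : ∀ i j, |M.toBlocks₁₂ i j| ≤ (n : ℤ) ^ 2 := by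
    intro i j
    have h1 := hent (Sum.inl i) (Sum.inr j)
    have h2 := h (Sum.inl i) (Sum.inr j)
    simp only [cuspEntry, Sum.elim_inr, Sum.elim_inl] at h1
    rw [one_apply_ne (by simp), sub_zero] at h2
    have h3 : (M (Sum.inl i) (Sum.inr j) : ℝ) = w.1 (Sum.inl i) (Sum.inr j) * (n * n) := by
      field_simp at h1 ⊢
      linarith
    have h4 : |(M (Sum.inl i) (Sum.inr j) : ℝ)| ≤ (n : ℝ) ^ 2 := by
      rw [h3, abs_mul, abs_of_pos (mul_pos hn0 hn0), sq]
      exact mul_le_of_le_one_left (mul_pos hn0 hn0).le h2.le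
    exact_mod_cast h4
  have hMb : M = fromBlocks 1 M.toBlocks₁₂ 0 1 := by
    conv_lhs => rw [← fromBlocks_toBlocks M, h11, h22, h21]
  refine ⟨hMb, ?_, h12⟩
  have hJ : Mᵀ * J (Fin d) ℤ * M = J (Fin d) ℤ := by
    apply rmat_injective
    rw [← rmat_form, ← hM, rmat_J]
    exact SymplecticGroup.mem_iff'.1 γ.2
  have hmem : fromBlocks 1 M.toBlocks₁₂ 0 1 ∈ symplecticGroup (Fin d) ℤ := by
    rw [← hMb]
    exact SymplecticGroup.mem_iff'.2 hJ
  have := SymplecticGroup.fromBlocks_mem_iff.1 hmem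
  simpa using this.2.1

/-- A symmetric block is determined by its entries over unordered pairs of indices, `(d + 1).choose
2` in number, each with at most `2 n² + 1 ≤ 3 n²` values. -/
theorem encard_conj_mem_nearOne_le (n : ℕ) [NeZero n] :
    {γ : (intSp d).op | cusp d n * γ.1.unop * (cusp d n)⁻¹ ∈ nearOne d 1}.encard ≤
      ((3 * n ^ 2) ^ (d + 1).choose 2 : ℕ) := by
  choose M hM using fun γ : (intSp d).op => (show ∃ M : Matrix (Fin d ⊕ Fin d) (Fin d ⊕ Fin d) ℤ,
    γ.1.unop.1 = rmat M from γ.2)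
  let F : (intSp d).op → Sym2 (Fin d) → ℤ := fun γ s => (M γ).toBlocks₁₂ s.out.1 s.out.2
  let T : Finset (Sym2 (Fin d) → ℤ) := Fintype.piFinset fun _ => Finset.Icc (-(n : ℤ) ^ 2) (n ^ 2)
  have hT : T.card ≤ (3 * n ^ 2) ^ (d + 1).choose 2 := by
    simp only [T, Fintype.card_piFinset, Finset.prod_const, Finset.card_univ, Sym2.card,
      Fintype.card_fin, Int.card_Icc]
    refine Nat.pow_le_pow_left ?_ _
    have : 1 ≤ n ^ 2 := Nat.one_le_pow _ _ (NeZero.pos n)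
    zify at this ⊢
    rw [Int.toNat_of_nonneg (by linarith)]
    linarith
  refine le_trans ?_ ((Set.encard_coe_eq_coe_finsetCard T).le.trans (by exact_mod_cast hT))
  refine Set.encard_le_encard_of_injOn (f := F) (fun γ hγ => ?_) fun γ hγ γ' hγ' hFF => ?_
  · refine Finset.mem_coe.2 (Fintype.mem_piFinset.2 fun s => Finset.mem_Icc.2 ?_)
    exact abs_le.1 ((eq_fromBlocks_of_conj_mem_nearOne (hM γ) hγ).2.2 _ _)
  · obtain ⟨h1, h2, -⟩ := eq_fromBlocks_of_conj_mem_nearOne (hM γ) hγ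
    obtain ⟨h1', h2', -⟩ := eq_fromBlocks_of_conj_mem_nearOne (hM γ') hγ'
    have hB : (M γ).toBlocks₁₂ = (M γ').toBlocks₁₂ := by
      ext i j
      have h3 := congrFun hFF s(i, j)
      have h4 : s((s(i, j) : Sym2 (Fin d)).out.1, (s(i, j) : Sym2 (Fin d)).out.2) = s(i, j) :=
        Quot.out_eq _
      simp only [F] at h3
      rcases Sym2.eq_iff.1 h4 with ⟨h5, h6⟩ | ⟨h5, h6⟩
      · rwa [h5, h6] at h3
      · rw [h5, h6] at h3
        rw [← h2, ← h2']
        exact h3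
    have hMM : M γ = M γ' := by rw [h1, h1', hB]
    exact Subtype.ext (MulOpposite.unop_injective (Subtype.ext (by rw [hM, hM, hMM])))

/-- The right translate by the cusp element of a fixed neighbourhood keeps its Haar measure `v`. It
lies in the given superlevel set, with controlled multiplicity. -/
theorem exists_le_mul_quotientMeasure (hd : 1 ≤ d) : ∃ v : ℝ≥0∞, 0 < v ∧ ∀ (n : ℕ) [NeZero n],
    v ≤ ((3 * n ^ 2) ^ (d + 1).choose 2 : ℕ) *
      quotientMeasure d {Λ | ENNReal.ofReal ((n : ℝ) ^ d / 2) ≤ alpha Λ} := by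
  obtain ⟨U₀, hU₀, h1U₀, hU₀'⟩ := exists_isOpen_inv_mul_mem_nearOne (d := d) 1 one_pos
  let W : Set (Sp d) := {u | vol (u.1 * rmat (lagrangian d)) < 2}
  have hW : IsOpen W := by
    have hc : Continuous fun g : Sp d => g.1 * rmat (lagrangian d) :=
      continuous_subtype_val.matrix_mul continuous_const
    exact isOpen_lt (hc.matrix_transpose.matrix_mul hc).matrix_det.sqrt continuous_const
  have h1W : (1 : Sp d) ∈ W := by
    change vol _ < 2
    rw [vol_one_mul_lagrangian]
    norm_num
  have hU : IsOpen (U₀ ∩ W) := hU₀.inter hW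
  refine ⟨Measure.haar (U₀ ∩ W), hU.measure_pos _ ⟨1, h1U₀, h1W⟩, fun n _ => ?_⟩
  have hn0 : (0 : ℝ) < n := by exact_mod_cast NeZero.pos n
  rw [← measure_preimage_mul_right Measure.haar (cusp d n)⁻¹]
  refine measure_le_mul_quotientMeasure ((hU.preimage (continuous_mul_const _)).measurableSet)
    (measurableSet_le measurable_const (measurable_alpha d)) (fun x hx => ?_) _ fun x hx => ?_
  · obtain ⟨-, hxW⟩ := hx
    refine le_trans (ENNReal.ofReal_le_ofReal ?_) (le_alpha_orbitMap hd x)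
    have h1 := vol_mul_cusp_lagrangian (x * (cusp d n)⁻¹) n
    rw [inv_mul_cancel_right] at h1
    have h2 : vol ((x * (cusp d n)⁻¹).1 * rmat (lagrangian d)) < 2 := hxW
    rw [h1, mul_inv, inv_inv, div_eq_mul_inv]
    exact mul_le_mul_of_nonneg_left (inv_anti₀ (vol_pos isFrame_lagrangian _) h2.le) (by positivity)
  · refine (Set.encard_le_encard fun γ hγ => ?_).trans (encard_conj_mem_nearOne_le n)
    -- If `x` and `x γ` both lie in the translated neighbourhood, then `γ` conjugated by the cusp
    -- element is close to the identity.
    have h1 := hU₀' _ hx.1 _ (show (x * γ.1.unop) * (cusp d n)⁻¹ ∈ U₀ from hγ.1)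
    have h2 : (x * (cusp d n)⁻¹)⁻¹ * (x * γ.1.unop * (cusp d n)⁻¹) =
        cusp d n * γ.1.unop * (cusp d n)⁻¹ := by group
    rwa [h2] at h1

/-- The lower bound on the tails keeps the integral of `α ^ (d + 1)` over `{α ≥ n ^ d / 2}` above a
positive constant. For an integrable function these integrals would tend to zero. -/
theorem lintegral_alpha_pow_eq_top (hd : 1 ≤ d) :
    ∫⁻ Λ, alpha Λ ^ (d + 1) ∂quotientMeasure d = ∞ := by
  by_contra hfin
  obtain ⟨v, hv, hle⟩ := exists_le_mul_quotientMeasure hd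
  set D := (d + 1).choose 2 with hD
  have hDd : 2 * D = d * (d + 1) := by
    rw [hD, mul_comm, Nat.choose_two_right, Nat.div_mul_cancel (Nat.even_mul_pred_self _).two_dvd]
    rw [Nat.add_sub_cancel, mul_comm]
  let A : ℕ → Set (Y d) := fun n => {Λ | ENNReal.ofReal ((n : ℝ) ^ d / 2) ≤ alpha Λ}
  have hmarkov : ∀ n : ℕ, ENNReal.ofReal ((n : ℝ) ^ d / 2) ^ (d + 1) * quotientMeasure d (A n) ≤
      ∫⁻ Λ in A n, alpha Λ ^ (d + 1) ∂quotientMeasure d := fun n => by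
    rw [← setLIntegral_const]
    exact setLIntegral_mono ((measurable_alpha d).pow_const _) fun Λ hΛ => pow_le_pow_left' hΛ _
  have hkey : ∀ (n : ℕ) [NeZero n], v ≤ (3 ^ D * 2 ^ (d + 1)) *
      ∫⁻ Λ in A n, alpha Λ ^ (d + 1) ∂quotientMeasure d := by
    intro n _
    -- The multiplicity grows like `n ^ (2 D) = (n ^ d) ^ (d + 1)`, which exactly matches the power
    -- of `α`.
    have h2 : (((3 * n ^ 2) ^ D : ℕ) : ℝ≥0∞) =
        (3 ^ D * 2 ^ (d + 1)) * ENNReal.ofReal ((n : ℝ) ^ d / 2) ^ (d + 1) := by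
      rw [ENNReal.ofReal_div_of_pos two_pos, ENNReal.ofReal_pow (Nat.cast_nonneg n),
        ENNReal.ofReal_natCast, ENNReal.ofReal_ofNat, mul_assoc, ← mul_pow,
        ENNReal.mul_div_cancel two_ne_zero ENNReal.ofNat_ne_top, ← pow_mul, ← hDd, pow_mul,
        ← mul_pow]
      push_cast
      rfl
    calc v ≤ (((3 * n ^ 2) ^ D : ℕ) : ℝ≥0∞) * quotientMeasure d (A n) := hle n
      _ = (3 ^ D * 2 ^ (d + 1)) *
          (ENNReal.ofReal ((n : ℝ) ^ d / 2) ^ (d + 1) * quotientMeasure d (A n)) := by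
        rw [h2, mul_assoc]
      _ ≤ _ := mul_le_mul_right (hmarkov n) _
  have hc0 : (3 ^ D * 2 ^ (d + 1) : ℝ≥0∞) ≠ 0 := by positivity
  have hct : (3 ^ D * 2 ^ (d + 1) : ℝ≥0∞) ≠ ∞ :=
    ENNReal.mul_ne_top (ENNReal.pow_ne_top ENNReal.ofNat_ne_top)
      (ENNReal.pow_ne_top ENNReal.ofNat_ne_top)
  obtain ⟨δ, hδ, hsmall⟩ := exists_pos_setLIntegral_lt_of_measure_lt hfin
    (ENNReal.div_pos hv.ne' hct).ne'
  obtain ⟨n, hn⟩ : ∃ n : ℕ, quotientMeasure d (A (n + 1)) < δ := by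
    obtain ⟨m, hm⟩ := ENNReal.exists_nat_mul_gt hδ.ne' hfin
    -- The set used has index `2 (m + 1)`, so its level is at least `m + 1`, and Markov's inequality
    -- contradicts the choice of `m`.
    refine ⟨2 * m + 1, lt_of_not_ge fun hge => hm.not_ge ?_⟩
    have hN : ((2 * m + 1 + 1 : ℕ) : ℝ) = 2 * (m + 1) := by push_cast; ring
    have h1 : (m : ℝ≥0∞) ≤ ENNReal.ofReal (((2 * m + 1 + 1 : ℕ) : ℝ) ^ d / 2) ^ (d + 1) := by
      have hm0 : (0 : ℝ) ≤ m := Nat.cast_nonneg m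
      have h2 : (m : ℝ) + 1 ≤ ((2 * m + 1 + 1 : ℕ) : ℝ) ^ d / 2 := by
        rw [hN, le_div_iff₀ two_pos, mul_comm]
        exact le_self_pow₀ (by linarith) (by omega)
      rw [← ENNReal.ofReal_pow (by positivity), ← ENNReal.ofReal_natCast]
      refine ENNReal.ofReal_le_ofReal ?_
      exact (by linarith : (m : ℝ) ≤ _).trans (le_self_pow₀ (by linarith) (by omega))
    calc (m : ℝ≥0∞) * δ
        ≤ ENNReal.ofReal (((2 * m + 1 + 1 : ℕ) : ℝ) ^ d / 2) ^ (d + 1) *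
            quotientMeasure d (A (2 * m + 1 + 1)) := mul_le_mul' h1 hge
      _ ≤ ∫⁻ Λ in A (2 * m + 1 + 1), alpha Λ ^ (d + 1) ∂quotientMeasure d := hmarkov _
      _ ≤ _ := setLIntegral_le_lintegral _ _
  have := (ENNReal.lt_div_iff_mul_lt (Or.inl hc0) (Or.inl hct)).1 (hsmall _ hn)
  rw [mul_comm] at this
  exact (hkey (n + 1)).not_gt this

theorem not_memLp_alpha (hd : 1 ≤ d) : ¬ MemLp (alpha (d := d)) (d + 1) (mu d) := by
  have h := memLp_alpha_iff (d := d) (n := d + 1) (by omega)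
  rw [Nat.cast_add_one] at h
  rw [h, mu, lintegral_smul_measure, smul_eq_mul, lintegral_alpha_pow_eq_top hd,
    ENNReal.mul_top (ENNReal.inv_ne_zero.2 (quotientMeasure_univ_ne_top hd))]
  exact lt_irrefl _

end Lower

end SymplecticLattices

end

/-! ### The main theorem -/

theorem theorem2 (d : ℕ) (hd : 1 ≤ d) :
    IsProbabilityMeasure (SymplecticLattices.mu d) ∧
    (∀ p : ℝ, 0 < p → p ≤ d →
      MemLp (SymplecticLattices.alpha (d := d)) (ENNReal.ofReal p) (SymplecticLattices.mu d) ∧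
      ∃ C : ℝ, ∀ L : ℝ, 0 < L →
        SymplecticLattices.mu d {Λ | ENNReal.ofReal L ≤ SymplecticLattices.alpha Λ} ≤
          ENNReal.ofReal (C * L ^ (-p))) ∧
    ¬ MemLp (SymplecticLattices.alpha (d := d)) (d + 1) (SymplecticLattices.mu d) :=
  ⟨SymplecticLattices.isProbabilityMeasure_mu hd, fun _ hp0 hp =>
    ⟨SymplecticLattices.memLp_alpha hd hp, SymplecticLattices.exists_mu_le_alpha_le hd hp0 hp⟩,
    SymplecticLattices.not_memLp_alpha hd⟩
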